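/- Let $q\in\mathbb C$ with $0<|q|<1$. For $x\in\mathbb C$ put $(x;q)_\infty=\prod_{n\ge 0}(1-xq^n)$; for $n\ge 0$ put $(x;q)_n=\prod_{k=0}^{n-1}(1-xq^k)$ and $(x;q)_{-n}=\prod_{k=1}^{n}(1-xq^{-k})^{-1}$. Products are abbreviated $(x_1,\dots,x_m;q)_n=\prod_i(x_i;q)_n$ for $n\in\mathbb Z\cup\{\infty\}$. For $x\ne 0$ let $$\theta(x)=\frac{1}{(q;q)_\infty}\sum_{n\in\mathbb Z}(-1)^nq^{n(n-1)/2}x^n,\qquad \theta(x_1,\dots,x_m)=\prod_i\theta(x_i),$$ $$\Omega(x_1,\dots,x_n;a_1,\dots,a_m)=\prod_{i=1}^n\prod_{j=1}^m(x_i/a_j;q)_\infty .$$ For $A\neq 0$ and nonzero parameters define the very-well-poised series $${}_8W_7[A;a_4,\dots,a_8;q,w]=\sum_{n=0}^\infty\frac{(A,q\sqrt A,-q\sqrt A,a_4,\dots,a_8;q)_n}{(q,\sqrt A,-\sqrt A,Aq/a_4,\dots,Aq/a_8;q)_n}\,w^n,$$ $${}_8\psi_8[A;a_3,\dots,a_8;q,w]=\sum_{n=-\infty}^\infty\frac{(q\sqrt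 A,-q\sqrt A,a_3,\dots,a_8;q)_n}{(\sqrt A,-\sqrt A,Aq/a_3,\dots,Aq/a_8;q)_n}\,w^n .$$ Let $a,b,c,d,e,f,g$ be nonzero complex numbers and $z=bcde/(aq)$, such that $$\left|\frac{a^2q}{fgz}\right|<1,\qquad \left|\frac{aq}{fg}\right|<1 ,$$ and suppose that no denominator occurring below, either in a term of one of the three series or in a coefficient, vanishes. Then the three series below converge absolutely, and \begin{align*} &{}_{8}W_{7}\left[\frac{b^{2}}a ; \frac{bc}a, \frac{bd}a, \frac{be}a, \frac{bf}a, \frac{bg}a ; q, \frac{a^{2}q}{fgz}\right]\\ &=\Big(1-\frac1z\Big)\frac{\theta(bz/a,z/b)}{\theta(z/a,z)}\, \frac{(b^2 q/a; q)_{\infty}}{\Omega(aq/b, bq;f,g)}\,\frac{\Omega(q;b,c,d,e)\,\Omega(aq;f,g,cd,ce,de,fg, fz,gz)}{\Omega( bq;b,c,d,e)\,\Omega(1/z;1/b,1/c,1/d,1/e,fg/(a^{2}q) )}\\ &\qquad\times {}_{8} \psi_{8}\left[z ; b, c, d, e, \frac{fz}a, \frac{gz}a ; q, \frac{aq}{f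 g}\right]\\ &+\frac{(zq/b;q)_{\infty}}{(z^2q/a;q)_{\infty}}\,\frac{\theta(1/b)}{\theta(z/a)}\, \frac{\Omega(b/a;1/(bq),1/c,1/d,1/e)\,\Omega(zq;f,g)}{\Omega(1/z;z/(aq),1/c,1/d,1/e)\,\Omega(aq/b;f,g)}\, \frac{\Omega(aq/z;b,c,d,e,f,g)}{\Omega(bq;b,c,d,e,f,g)}\\ &\qquad\times {}_{8}\psi_{8}\left[\frac{z^2}a;\frac{bz}a,\frac{cz}a,\frac{dz}a,\frac{ez}a,\frac{fz}a,\frac{gz}a;q,\frac{a^2q}{fgz}\right]. \end{align*} -/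

import Mathlib

noncomputable section

namespace QSeries

/-- The infinite `q`-shifted factorial `(x;q)_∞ = ∏_{n ≥ 0} (1 - x q^n)`. -/
def qPochInf (q x : ℂ) : ℂ := ∏' n : ℕ, (1 - x * q ^ n)

/-- The `q`-shifted factorial `(x;q)_n` for an integer `n`: it is `∏_{0 ≤ k < n} (1 - x q^k)` for
`n ≥ 0` and `1 / ∏_{1 ≤ k ≤ -n} (1 - x q^{-k})` for `n < 0`.  This is `(x;q)_∞ / (x q^n;q)_∞`
wherever that quotient is not `0 / 0`. -/
def qPoch (q x : ℂ) : ℤ → ℂ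
  | Int.ofNat n => ∏ k ∈ Finset.range n, (1 - x * q ^ k)
  | Int.negSucc n => (∏ k ∈ Finset.range (n + 1), (1 - x / q ^ (k + 1)))⁻¹

/-- The theta function `θ(x) = (q;q)_∞⁻¹ ∑_{n ∈ ℤ} (-1)^n q^{n(n-1)/2} x^n`. -/
def theta (q x : ℂ) : ℂ :=
  (qPochInf q q)⁻¹ * ∑' n : ℤ, (-1 : ℂ) ^ n * q ^ (n * (n - 1) / 2) * x ^ n

/-- `Ω(x₁,…,xₙ; a₁,…,aₘ) = ∏ᵢ ∏ⱼ (xᵢ / aⱼ; q)_∞`. -/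
def Omega (q : ℂ) (xs as : List ℂ) : ℂ :=
  (xs.map fun x => (as.map fun a => qPochInf q (x / a)).prod).prod

/-- The `n`-th term of the basic hypergeometric series `_{r+1}φ_r`. -/
def phiTerm {r : ℕ} (q : ℂ) (as : Fin (r + 1) → ℂ) (bs : Fin r → ℂ) (w : ℂ) (n : ℕ) : ℂ :=
  (∏ i, qPoch q (as i) n) / (∏ i, qPoch q (bs i) n) * (w ^ n / qPoch q q n)

/-- The `n`-th term of the bilateral basic hypergeometric series `_rψ_r`. -/
def psiTerm {r : ℕ} (q : ℂ) (as bs : Fin r → ℂ) (w : ℂ) (n : ℤ) : ℂ :=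
  (∏ i, qPoch q (as i) n) / (∏ i, qPoch q (bs i) n) * w ^ n

/-- No factor in the denominator of a term of `_{r+1}φ_r` vanishes: no lower parameter is one of
`1, q⁻¹, q⁻², …`. -/
def PhiWellDefined {r : ℕ} (q : ℂ) (bs : Fin r → ℂ) : Prop :=
  ∀ i, ∀ k : ℕ, 1 - bs i * q ^ k ≠ 0

/-- No factor in the denominator of a term of `_rψ_r` vanishes: no lower parameter is one of
`1, q⁻¹, q⁻², …` (terms with `n > 0`) and no upper parameter is one of `q, q², …`
(terms with `n < 0`). -/
def PsiWellDefined {r : ℕ} (q : ℂ) (as bs : Fin r → ℂ) : Prop :=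
  (∀ i, ∀ k : ℕ, 1 - bs i * q ^ k ≠ 0) ∧ (∀ i, ∀ k : ℕ, 1 - as i / q ^ (k + 1) ≠ 0)

/-- Upper parameters `A, q√A, -q√A, a₄, …` of the very-well-poised `_{r+3}W_{r+2}`. -/
def vwpPhiUpper {r : ℕ} (q A : ℂ) (ps : Fin r → ℂ) : Fin (r + 2 + 1) → ℂ :=
  Matrix.vecCons A (Matrix.vecCons (q * A ^ (1 / 2 : ℂ))
    (Matrix.vecCons (-(q * A ^ (1 / 2 : ℂ))) ps))

/-- Lower parameters of the very-well-poised `_{r+3}W_{r+2}`, given by `a_{i+1} b_i = A q`. -/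
def vwpPhiLower {r : ℕ} (q A : ℂ) (ps : Fin r → ℂ) : Fin (r + 2) → ℂ :=
  fun i => A * q / vwpPhiUpper q A ps i.succ

/-- Upper parameters `q√A, -q√A, a₃, …` of the very-well-poised `_{r+2}ψ_{r+2}`. -/
def vwpPsiUpper {r : ℕ} (q A : ℂ) (ps : Fin r → ℂ) : Fin (r + 2) → ℂ :=
  Matrix.vecCons (q * A ^ (1 / 2 : ℂ)) (Matrix.vecCons (-(q * A ^ (1 / 2 : ℂ))) ps)

/-- Lower parameters of the very-well-poised `_{r+2}ψ_{r+2}`, given by `a_i b_i = A q`. -/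
def vwpPsiLower {r : ℕ} (q A : ℂ) (ps : Fin r → ℂ) : Fin (r + 2) → ℂ :=
  fun i => A * q / vwpPsiUpper q A ps i

/-- The `n`-th term of `_{r+3}W_{r+2}[A; a₄, …, a_{r+3}; q, w]`. -/
def WTerm {r : ℕ} (q A : ℂ) (ps : Fin r → ℂ) (w : ℂ) (n : ℕ) : ℂ :=
  phiTerm q (vwpPhiUpper q A ps) (vwpPhiLower q A ps) w n

/-- `_{r+3}W_{r+2}[A; a₄, …, a_{r+3}; q, w]`. -/
def W {r : ℕ} (q A : ℂ) (ps : Fin r → ℂ) (w : ℂ) : ℂ := ∑' n : ℕ, WTerm q A ps w n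

/-- The `n`-th term of the very-well-poised `_{r+2}ψ_{r+2}[A; a₃, …, a_{r+2}; q, w]`. -/
def vwpPsiTerm {r : ℕ} (q A : ℂ) (ps : Fin r → ℂ) (w : ℂ) (n : ℤ) : ℂ :=
  psiTerm q (vwpPsiUpper q A ps) (vwpPsiLower q A ps) w n

/-- The very-well-poised `_{r+2}ψ_{r+2}[A; a₃, …, a_{r+2}; q, w]`. -/
def vwpPsi {r : ℕ} (q A : ℂ) (ps : Fin r → ℂ) (w : ℂ) : ℂ := ∑' n : ℤ, vwpPsiTerm q A ps w n

/-- All terms of `_{r+3}W_{r+2}[A; a₄, …; q, w]` are meaningful. -/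
def WWellDefined {r : ℕ} (q A : ℂ) (ps : Fin r → ℂ) : Prop :=
  PhiWellDefined q (vwpPhiLower q A ps)

/-- All terms of the very-well-poised `_{r+2}ψ_{r+2}[A; a₃, …; q, w]` are meaningful. -/
def VwpPsiWellDefined {r : ℕ} (q A : ℂ) (ps : Fin r → ℂ) : Prop :=
  PsiWellDefined q (vwpPsiUpper q A ps) (vwpPsiLower q A ps)

end QSeries

end

noncomputable section

namespace QSeries

open Filter Topology

variable {q : ℂ}

/-! ### The infinite `q`-shifted factorial -/

/-! Multiplying a very-well-poised bilateral series by the infinite products in its denominators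
turns it into a sum over a lattice s q^ℤ of products of the functions `pairTerm`. In this cleared
form (`sixSum`, with base point s and modulus A, the leading parameter of the series being s²/A) the
terms are continuous in nonzero parameters and no infinite product stands in a denominator. Up to
products, the two ₈ψ₈ series are S = `sixSum q z z b c d e (f*z/a) (g*z/a)` and T = `sixSum q z a b
c d e f g`. The ₈W₇ is `sixSum q b a b c d e f g`, whose terms of negative index vanish because the
base point is one of the parameters.

The three sums are linked by a bilateral Bailey transform (`bailey_transform`): an absolutely
convergent double series over t q^ℤ and s q^ℤ is summed in both orders. For a fixed point of s q^ℤ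
the inner sum is a ₆ψ₆, evaluated by Bailey's formula `fourSum_eq`; what remains is `sixSum q s z b
c d e (f*z/a) (g*z/a)`, for every t. For a fixed point of t q^ℤ the inner sum has six parameters
with product q z³, that is, it is balanced. With t = s = b it terminates and is a product, as in
Jackson's sum (`inner_sum_terminating`), so the auxiliary sum B over b q^ℤ is a multiple of the ₈W₇.
With t = z, a combination of the inner sums for s = b and s = z is a product (`inner_sum_cross`,
from `sixCross_eq`); this is a linear relation between B, S and T. Eliminating B gives the
three-term relation `three_term_generic`. The divisions made on the way require generic parameters,
but the cleared identity is continuous, so `three_term` holds without them. The theorem then follows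
by restoring the denominators.

The product evaluations share one method: telescoping gives contiguous relations, these are iterated
until parameters go to 0 or ∞, and the limit is identified. For `fourSum_eq` all four parameters go
to ∞ and the limit is a Jacobi theta series, evaluated by the triple product `tsum_gauss_eq`. For
`sixCross_eq` powers of q are moved from one parameter to another; the balanced sums degenerate to
₆ψ₆ sums, and the identity left between theta functions is Weierstrass' addition formula in the form
`thetaProd_balanced`. The triple product is the limit of its finite form, which also comes from a
contiguous relation; the addition formula comes from multiplying two theta series and splitting ℤ²
by parity. -/

lemma summable_norm_mul_pow (hq : ‖q‖ < 1) (x : ℂ) : Summable fun n : ℕ => ‖-(x * q ^ n)‖ := by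
  simp only [norm_neg, norm_mul, norm_pow]
  exact (summable_geometric_of_lt_one (norm_nonneg q) hq).mul_left _

lemma multipliable_qPochInf (hq : ‖q‖ < 1) (x : ℂ) : Multipliable fun n : ℕ => 1 - x * q ^ n := by
  simpa only [sub_eq_add_neg] using multipliable_one_add_of_summable (summable_norm_mul_pow hq x)

lemma qPochInf_eq_mul (hq : ‖q‖ < 1) (x : ℂ) :
    qPochInf q x = (1 - x) * qPochInf q (x * q) := by
  have e : (fun n : ℕ => 1 - x * q ^ (n + 1)) = fun n => 1 - x * q * q ^ n := by
    funext n; rw [pow_succ]; ring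
  have h : Multipliable fun n : ℕ => 1 - x * q ^ (n + 1) := e ▸ multipliable_qPochInf hq (x * q)
  have h2 := tprod_eq_zero_mul' (f := fun n : ℕ => 1 - x * q ^ n) h
  rw [e, pow_zero, mul_one] at h2
  exact h2

lemma qPochInf_eq_prod_mul (hq : ‖q‖ < 1) (x : ℂ) (n : ℕ) :
    qPochInf q x = (∏ k ∈ Finset.range n, (1 - x * q ^ k)) * qPochInf q (x * q ^ n) := by
  induction n with
  | zero => simp
  | succ n ih =>
    rw [ih, Finset.prod_range_succ, qPochInf_eq_mul hq (x * q ^ n), pow_succ]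
    ring_nf

lemma qPochInf_ne_zero (hq : ‖q‖ < 1) {x : ℂ} (h : ∀ n : ℕ, 1 - x * q ^ n ≠ 0) :
    qPochInf q x ≠ 0 := by
  have := tprod_one_add_ne_zero_of_summable (f := fun n : ℕ => -(x * q ^ n))
    (fun n => by simpa only [sub_eq_add_neg] using h n) (summable_norm_mul_pow hq x)
  simpa only [qPochInf, sub_eq_add_neg] using this

lemma qPochInf_zpow_eq_zero (hq0 : q ≠ 0) {m : ℤ} (hm : m ≤ 0) : qPochInf q (q ^ m) = 0 := by
  refine tprod_of_exists_eq_zero ⟨(-m).toNat, ?_⟩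
  rw [← zpow_natCast q, Int.toNat_of_nonneg (by omega), ← zpow_add₀ hq0]
  simp

@[fun_prop]
lemma continuous_qPochInf (hq : ‖q‖ < 1) : Continuous (qPochInf q) := by
  rw [continuous_iff_continuousAt]
  intro x
  have h := tendsto_tprod_one_add_of_dominated_convergence (𝓕 := 𝓝 x)
    (f := fun y (n : ℕ) => -(y * q ^ n)) (g := fun n => -(x * q ^ n))
    (bound := fun n => (‖x‖ + 1) * ‖q‖ ^ n)
    ((summable_geometric_of_lt_one (norm_nonneg q) hq).mul_left _)
    (fun k => Continuous.tendsto (f := fun y => -(y * q ^ k)) (by fun_prop) x) ?_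
  · simp only [← sub_eq_add_neg] at h
    exact h
  · have : ∀ᶠ y in 𝓝 x, ‖y‖ < ‖x‖ + 1 :=
      continuous_norm.continuousAt.eventually_lt continuousAt_const (by simp)
    filter_upwards [this] with y hy k
    rw [norm_neg, norm_mul, norm_pow]
    gcongr

@[simp] lemma qPochInf_zero : qPochInf q 0 = 1 := by simp [qPochInf]

/-- From 1 + t ≤ exp t and the geometric series. The bound does not depend on n, so it passes to the
infinite product and later dominates the one-sided series. -/
lemma norm_prod_one_sub_le (hq : ‖q‖ < 1) (x : ℂ) (n : ℕ) :
    ‖∏ k ∈ Finset.range n, (1 - x * q ^ k)‖ ≤ Real.exp (‖x‖ / (1 - ‖q‖)) := by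
  have h1 : ‖∏ k ∈ Finset.range n, (1 - x * q ^ k)‖ ≤
      ∏ k ∈ Finset.range n, Real.exp (‖x‖ * ‖q‖ ^ k) := by
    refine (Finset.norm_prod_le _ _).trans (Finset.prod_le_prod (fun _ _ => norm_nonneg _) ?_)
    intro k _
    calc ‖1 - x * q ^ k‖ ≤ ‖(1 : ℂ)‖ + ‖x * q ^ k‖ := norm_sub_le _ _
      _ = ‖x‖ * ‖q‖ ^ k + 1 := by simp [add_comm]
      _ ≤ _ := Real.add_one_le_exp _
  refine h1.trans ?_
  rw [← Real.exp_sum, ← Finset.mul_sum, div_eq_mul_inv]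
  gcongr
  rw [← tsum_geometric_of_lt_one (norm_nonneg q) hq]
  exact (summable_geometric_of_lt_one (norm_nonneg q) hq).sum_le_tsum _
    fun _ _ => by positivity

lemma tendsto_prod_qPochInf (hq : ‖q‖ < 1) (x : ℂ) :
    Tendsto (fun n => ∏ k ∈ Finset.range n, (1 - x * q ^ k)) atTop (𝓝 (qPochInf q x)) :=
  (multipliable_qPochInf hq x).hasProd.tendsto_prod_nat

lemma norm_qPochInf_le (hq : ‖q‖ < 1) (x : ℂ) :
    ‖qPochInf q x‖ ≤ Real.exp (‖x‖ / (1 - ‖q‖)) :=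
  le_of_tendsto (tendsto_prod_qPochInf hq x).norm
    (Eventually.of_forall fun n => norm_prod_one_sub_le hq x n)

lemma tendsto_mul_pow_zero (hq : ‖q‖ < 1) (x : ℂ) :
    Tendsto (fun n : ℕ => x * q ^ n) atTop (𝓝 0) := by
  simpa using (tendsto_pow_atTop_nhds_zero_of_norm_lt_one hq).const_mul x

lemma tendsto_qPochInf_mul_pow (hq : ‖q‖ < 1) (x : ℂ) :
    Tendsto (fun n : ℕ => qPochInf q (x * q ^ n)) atTop (𝓝 1) := by
  have := ((continuous_qPochInf hq).tendsto 0).comp (tendsto_mul_pow_zero hq x)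
  rwa [qPochInf_zero] at this

/-! ### Powers, Gaussian weights, and the two-sided bound -/

/-- The weight `(-1)^k q^{k(k-1)/2}`. -/
def gauss (q : ℂ) (k : ℤ) : ℂ := (-1 : ℂ) ^ k * q ^ (k * (k - 1) / 2)

lemma triangle_succ (k : ℤ) : (k + 1) * (k + 1 - 1) / 2 = k * (k - 1) / 2 + k := by
  have : (k + 1) * (k + 1 - 1) = k * (k - 1) + k * 2 := by ring
  rw [this, Int.add_mul_ediv_right _ _ (by norm_num)]

@[simp] lemma gauss_zero : gauss q 0 = 1 := by simp [gauss]

lemma gauss_succ (hq0 : q ≠ 0) (k : ℤ) : gauss q (k + 1) = -(q ^ k * gauss q k) := by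
  rw [gauss, gauss, triangle_succ, zpow_add₀ hq0, zpow_add_one₀ (by norm_num)]
  ring

lemma gauss_neg (hq0 : q ≠ 0) (k : ℤ) : gauss q (-k) = q ^ k * gauss q k := by
  have h : -k * (-k - 1) / 2 = k * (k - 1) / 2 + k := by
    rw [← triangle_succ]; congr 1; ring
  rw [gauss, gauss, h, zpow_add₀ hq0, zpow_neg, ← inv_zpow]
  norm_num
  ring

lemma gauss_ne_zero (hq0 : q ≠ 0) (k : ℤ) : gauss q k ≠ 0 :=
  mul_ne_zero (zpow_ne_zero _ (by norm_num)) (zpow_ne_zero _ hq0)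

/-- `u ^ k` for `k ≥ 0` and `v ^ (-k)` for `k < 0`. -/
def twoSided (u v : ℝ) : ℤ → ℝ
  | Int.ofNat n => u ^ n
  | Int.negSucc n => v ^ (n + 1)

@[simp] lemma twoSided_natCast (u v : ℝ) (n : ℕ) : twoSided u v n = u ^ n := rfl

@[simp] lemma twoSided_neg_natCast (u v : ℝ) (n : ℕ) : twoSided u v (-n) = v ^ n := by
  cases n with
  | zero => simp [twoSided]
  | succ n => rfl

lemma forall_int_iff {p : ℤ → Prop} : (∀ k, p k) ↔ (∀ n : ℕ, p n) ∧ ∀ n : ℕ, p (-n) :=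
  ⟨fun h => ⟨fun n => h n, fun n => h _⟩, fun h k => by
    obtain ⟨n, rfl | rfl⟩ := k.eq_nat_or_neg
    exacts [h.1 n, h.2 n]⟩

lemma twoSided_mul (u v u' v' : ℝ) (k : ℤ) :
    twoSided u v k * twoSided u' v' k = twoSided (u * u') (v * v') k := by
  revert k
  simp [forall_int_iff, mul_pow]

lemma twoSided_nonneg {u v : ℝ} (hu : 0 ≤ u) (hv : 0 ≤ v) (k : ℤ) : 0 ≤ twoSided u v k := by
  revert k
  simp only [forall_int_iff, twoSided_natCast, twoSided_neg_natCast]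
  exact ⟨fun n => by positivity, fun n => by positivity⟩

lemma twoSided_mono {u v u' v' : ℝ} (hu : 0 ≤ u) (hv : 0 ≤ v) (huu : u ≤ u') (hvv : v ≤ v')
    (k : ℤ) : twoSided u v k ≤ twoSided u' v' k := by
  revert k
  simp only [forall_int_iff, twoSided_natCast, twoSided_neg_natCast]
  exact ⟨fun n => by gcongr, fun n => by gcongr⟩

lemma summable_twoSided {u v : ℝ} (hu : 0 ≤ u) (hv : 0 ≤ v) (hu1 : u < 1) (hv1 : v < 1) :
    Summable (twoSided u v) := by
  refine Summable.of_nat_of_neg ?_ ?_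
  · simpa using summable_geometric_of_lt_one hu hu1
  · simpa using summable_geometric_of_lt_one hv hv1

lemma norm_zpow_eq_twoSided (w : ℂ) (k : ℤ) : ‖w ^ k‖ = twoSided ‖w‖ ‖w⁻¹‖ k := by
  revert k
  simp [forall_int_iff]

/-- `H(α, β; k) = (α q^k; q)_∞ (β q^{1-k}; q)_∞ (-1)^k q^{k(k-1)/2}`. -/
def pairTerm (q α β : ℂ) (k : ℤ) : ℂ :=
  qPochInf q (α * q ^ k) * qPochInf q (β * q ^ (1 - k)) * gauss q k

lemma pairTerm_eq_mul_left (hq : ‖q‖ < 1) (α β : ℂ) (k : ℤ) :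
    pairTerm q α β k = (1 - α * q ^ k) * pairTerm q (α * q) β k := by
  rw [pairTerm, pairTerm, qPochInf_eq_mul hq (α * q ^ k)]
  ring_nf

lemma pairTerm_eq_mul_right (hq : ‖q‖ < 1) (α β : ℂ) (k : ℤ) :
    pairTerm q α β k = (1 - β * q ^ (1 - k)) * pairTerm q α (β * q) k := by
  rw [pairTerm, pairTerm, qPochInf_eq_mul hq (β * q ^ (1 - k))]
  ring_nf

/-- A step of the summation index is the same as moving one factor q from the second parameter to
the first; this is what makes telescoping possible. -/
lemma pairTerm_shift (hq0 : q ≠ 0) (α β : ℂ) (k : ℤ) :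
    pairTerm q α β (k + 1) = -(q ^ k * pairTerm q (α * q) (β / q) k) := by
  have h1 : α * q ^ (k + 1) = α * q * q ^ k := by rw [zpow_add_one₀ hq0]; ring
  have h2 : β * q ^ (1 - (k + 1)) = β / q * q ^ (1 - k) := by
    rw [show 1 - k = (1 - (k + 1)) + 1 by ring, zpow_add_one₀ hq0]; field_simp
  rw [pairTerm, pairTerm, h1, h2, gauss_succ hq0]
  ring

/-- Reflection of the index exchanges the two parameters, so every statement about k < 0 follows
from one about k ≥ 0. -/
lemma pairTerm_neg (hq0 : q ≠ 0) (α β : ℂ) (k : ℤ) :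
    pairTerm q α β (-k) = q ^ k * pairTerm q (β * q) (α / q) k := by
  have h1 : α * q ^ (-k) = α / q * q ^ (1 - k) := by
    rw [show 1 - k = -k + 1 by ring, zpow_add_one₀ hq0]; field_simp
  have h2 : β * q ^ (1 - -k) = β * q * q ^ k := by
    rw [show 1 - -k = k + 1 by ring, zpow_add_one₀ hq0]; ring
  rw [pairTerm, pairTerm, h1, h2, gauss_neg hq0]
  ring

/-- The growing product (β q^{1-n};q)_∞ splits into n factors 1 - β q^{-k} and a fixed tail; the
Gaussian weight supplies exactly the sign and power of q that turn each of them into β - q^k. No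
negative power of q remains, and the growth rate |β| becomes visible. -/
lemma pairTerm_natCast (hq0 : q ≠ 0) (hq : ‖q‖ < 1) (α β : ℂ) (n : ℕ) :
    pairTerm q α β n =
      (∏ k ∈ Finset.range n, (β - q ^ k)) * qPochInf q (α * q ^ n) * qPochInf q (β * q) := by
  induction n with
  | zero => simp [pairTerm]
  | succ n ih =>
    have h := pairTerm_shift hq0 (α := α) (β := β) n
    have h2 : qPochInf q (β / q * q ^ (1 - (n : ℤ))) =
        (1 - β * (q ^ n)⁻¹) * qPochInf q (β * q ^ (1 - (n : ℤ))) := by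
      rw [qPochInf_eq_mul hq, zpow_sub₀ hq0, zpow_one, zpow_natCast]
      congr 2
      · field_simp
      · field_simp
    have h3 : qPochInf q (β * q ^ (1 - (n : ℤ))) * gauss q n =
        (∏ k ∈ Finset.range n, (β - q ^ k)) * qPochInf q (β * q) := by
      clear h h2 ih
      induction n with
      | zero => simp
      | succ n ih =>
        have h1 : β * q ^ (1 - ((n + 1 : ℕ) : ℤ)) = β * (q ^ n)⁻¹ := by
          push_cast; rw [show (1 : ℤ) - (n + 1) = -n by ring, zpow_neg, zpow_natCast]
        have h2 : β * q ^ (1 - (n : ℤ)) = β * (q ^ n)⁻¹ * q := by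
          rw [zpow_sub₀ hq0, zpow_one, zpow_natCast]; field_simp
        rw [h1, qPochInf_eq_mul hq, ← h2, Finset.prod_range_succ]
        push_cast
        rw [gauss_succ hq0, zpow_natCast]
        have h4 : q ^ n ≠ 0 := pow_ne_zero _ hq0
        linear_combination (β - q ^ n) * ih +
          qPochInf q (β * q ^ (1 - (n : ℤ))) * gauss q n * β * (mul_inv_cancel₀ h4)
    push_cast
    rw [h, pairTerm, h2, Finset.prod_range_succ, zpow_natCast,
      show α * q * q ^ n = α * q ^ (n + 1) by ring]
    have h4 : q ^ n ≠ 0 := pow_ne_zero _ hq0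
    linear_combination qPochInf q (α * q ^ (n + 1)) * (β - q ^ n) * h3 +
      qPochInf q (β * q ^ (1 - (n : ℤ))) * gauss q n * qPochInf q (α * q ^ (n + 1)) * β *
        (mul_inv_cancel₀ h4)

/-- The constant of the two-sided bound for `pairTerm`. -/
def pairConst (q : ℂ) (A B : ℝ) : ℝ :=
  Real.exp ((A + A⁻¹ + B + B⁻¹) / (1 - ‖q‖))

lemma norm_prod_sub_pow_le (hq : ‖q‖ < 1) {β : ℂ} {B : ℝ} (hB : 0 < B) (hβ : ‖β‖ ≤ B) (n : ℕ) :
    ‖∏ k ∈ Finset.range n, (β - q ^ k)‖ ≤ B ^ n * Real.exp (B⁻¹ / (1 - ‖q‖)) := by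
  have h1 : ‖∏ k ∈ Finset.range n, (β - q ^ k)‖ ≤
      ∏ k ∈ Finset.range n, (B * Real.exp (B⁻¹ * ‖q‖ ^ k)) := by
    refine (Finset.norm_prod_le _ _).trans (Finset.prod_le_prod (fun _ _ => norm_nonneg _) ?_)
    intro k _
    calc ‖β - q ^ k‖ ≤ ‖β‖ + ‖q ^ k‖ := norm_sub_le _ _
      _ ≤ B + ‖q‖ ^ k := by rw [norm_pow]; gcongr
      _ = B * (B⁻¹ * ‖q‖ ^ k + 1) := by field_simp; ring
      _ ≤ _ := by gcongr; exact Real.add_one_le_exp _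
  refine h1.trans ?_
  rw [Finset.prod_mul_distrib, Finset.prod_const, Finset.card_range, ← Real.exp_sum,
    ← Finset.mul_sum, div_eq_mul_inv]
  gcongr
  rw [← tsum_geometric_of_lt_one (norm_nonneg q) hq]
  exact (summable_geometric_of_lt_one (norm_nonneg q) hq).sum_le_tsum _
    fun _ _ => by positivity

lemma norm_pairTerm_natCast_le (hq0 : q ≠ 0) (hq : ‖q‖ < 1) {α β : ℂ} {A B : ℝ} (hB : 0 < B)
    (hα : ‖α‖ ≤ A) (hβ : ‖β‖ ≤ B) (n : ℕ) :
    ‖pairTerm q α β n‖ ≤ Real.exp ((A + B + B⁻¹) / (1 - ‖q‖)) * B ^ n := by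
  have h0 : 0 < 1 - ‖q‖ := by linarith
  rw [pairTerm_natCast hq0 hq, norm_mul, norm_mul, add_div, add_div, Real.exp_add, Real.exp_add]
  have h1 := norm_prod_sub_pow_le hq hB hβ n
  have h2 : ‖qPochInf q (α * q ^ n)‖ ≤ Real.exp (A / (1 - ‖q‖)) := by
    refine (norm_qPochInf_le hq _).trans ?_
    gcongr
    rw [norm_mul, norm_pow]
    calc ‖α‖ * ‖q‖ ^ n ≤ ‖α‖ * 1 := by gcongr; exact pow_le_one₀ (norm_nonneg _) hq.le
      _ ≤ A := by simpa using hα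
  have h3 : ‖qPochInf q (β * q)‖ ≤ Real.exp (B / (1 - ‖q‖)) := by
    refine (norm_qPochInf_le hq _).trans ?_
    gcongr
    rw [norm_mul]
    calc ‖β‖ * ‖q‖ ≤ ‖β‖ * 1 := by gcongr
      _ ≤ B := by simpa using hβ
  calc _ ≤ (B ^ n * Real.exp (B⁻¹ / (1 - ‖q‖))) * Real.exp (A / (1 - ‖q‖)) *
        Real.exp (B / (1 - ‖q‖)) := by gcongr
    _ = _ := by ring

/-- The geometric rates are the norms of the parameters: β governs k → +∞ and α governs k → -∞. Only
upper bounds for these norms enter, so one estimate serves whole families of parameters in dominated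
convergence. -/
lemma norm_pairTerm_le (hq0 : q ≠ 0) (hq : ‖q‖ < 1) {α β : ℂ} {A B : ℝ} (hA : 0 < A) (hB : 0 < B)
    (hα : ‖α‖ ≤ A) (hβ : ‖β‖ ≤ B) (k : ℤ) :
    ‖pairTerm q α β k‖ ≤ pairConst q A B * twoSided B A k := by
  have h0 : 0 < 1 - ‖q‖ := by linarith
  have hr : 0 < ‖q‖ := norm_pos_iff.mpr hq0
  revert k
  rw [forall_int_iff]
  refine ⟨fun n => ?_, fun n => ?_⟩
  · refine (norm_pairTerm_natCast_le hq0 hq hB hα hβ n).trans ?_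
    rw [twoSided_natCast, pairConst]
    have : 0 < A⁻¹ := by positivity
    gcongr
    linarith
  · have h1 : ‖β * q‖ ≤ B := by
      rw [norm_mul]
      calc ‖β‖ * ‖q‖ ≤ ‖β‖ * 1 := by gcongr
        _ ≤ B := by simpa using hβ
    have e : pairTerm q α β (-n) = q ^ n *
      ((∏ k ∈ Finset.range n, (α / q - q ^ k)) * qPochInf q (β * q * q ^ n) * qPochInf q α) := by
      rw [pairTerm_neg hq0, pairTerm_natCast hq0 hq, zpow_natCast, div_mul_cancel₀ _ hq0]
    -- The factor q^n is distributed over the n factors; the rate is then A and the constant stays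
    -- free of |q|⁻¹.
    have e2 : q ^ n * ∏ k ∈ Finset.range n, (α / q - q ^ k) =
        ∏ k ∈ Finset.range n, (α - q * q ^ k) := by
      rw [← Finset.card_range n, ← Finset.prod_const, Finset.card_range, ← Finset.prod_mul_distrib]
      refine Finset.prod_congr rfl fun k _ => ?_
      field_simp
    have h2 : ‖∏ k ∈ Finset.range n, (α - q * q ^ k)‖ ≤
        A ^ n * Real.exp (A⁻¹ / (1 - ‖q‖)) := by
      have h1 : ‖∏ k ∈ Finset.range n, (α - q * q ^ k)‖ ≤
          ∏ k ∈ Finset.range n, (A * Real.exp (A⁻¹ * ‖q‖ ^ k)) := by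
        refine (Finset.norm_prod_le _ _).trans
          (Finset.prod_le_prod (fun _ _ => norm_nonneg _) ?_)
        intro k _
        calc ‖α - q * q ^ k‖ ≤ ‖α‖ + ‖q * q ^ k‖ := norm_sub_le _ _
          _ ≤ A + 1 * ‖q‖ ^ k := by rw [norm_mul, norm_pow]; gcongr
          _ = A * (A⁻¹ * ‖q‖ ^ k + 1) := by field_simp; ring
          _ ≤ _ := by gcongr; exact Real.add_one_le_exp _
      refine h1.trans ?_
      rw [Finset.prod_mul_distrib, Finset.prod_const, Finset.card_range, ← Real.exp_sum,
        ← Finset.mul_sum, div_eq_mul_inv]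
      gcongr
      rw [← tsum_geometric_of_lt_one (norm_nonneg q) hq]
      exact (summable_geometric_of_lt_one (norm_nonneg q) hq).sum_le_tsum _
        fun _ _ => by positivity
    have h3 : ‖qPochInf q (β * q * q ^ n)‖ ≤ Real.exp (B / (1 - ‖q‖)) := by
      refine (norm_qPochInf_le hq _).trans ?_
      gcongr
      rw [norm_mul, norm_pow]
      calc ‖β * q‖ * ‖q‖ ^ n ≤ ‖β * q‖ * 1 := by gcongr; exact pow_le_one₀ (norm_nonneg _) hq.le
        _ ≤ B := by simpa using h1
    have h4 : ‖qPochInf q α‖ ≤ Real.exp (A / (1 - ‖q‖)) := by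
      refine (norm_qPochInf_le hq _).trans ?_
      gcongr
    rw [e, ← mul_assoc, ← mul_assoc, e2, norm_mul, norm_mul, twoSided_neg_natCast]
    calc _ ≤ (A ^ n * Real.exp (A⁻¹ / (1 - ‖q‖))) * Real.exp (B / (1 - ‖q‖)) *
          Real.exp (A / (1 - ‖q‖)) := by gcongr
      _ = Real.exp ((A + A⁻¹ + B) / (1 - ‖q‖)) * A ^ n := by
        rw [add_div, add_div, Real.exp_add, Real.exp_add]; ring
      _ ≤ _ := by
        rw [pairConst]
        have h5 : 0 < B⁻¹ := by positivity
        exact mul_le_mul_of_nonneg_right (Real.exp_le_exp.mpr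
          (div_le_div_of_nonneg_right (by linarith) h0.le)) (by positivity)

/-! ### The theta function as a product -/

/-- The product `(x; q)_∞ (q / x; q)_∞`. -/
def thetaProd (q x : ℂ) : ℂ := qPochInf q x * qPochInf q (q / x)

lemma thetaProd_mul_q (hq0 : q ≠ 0) (hq : ‖q‖ < 1) {x : ℂ} (hx : x ≠ 0) :
    thetaProd q (x * q) = -(thetaProd q x / x) := by
  have h1 : q / (x * q) = 1 / x := by field_simp
  have h2 : 1 / x * q = q / x := by ring
  rw [thetaProd, thetaProd, h1, qPochInf_eq_mul hq x, qPochInf_eq_mul hq (1 / x), h2]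
  field_simp
  ring

lemma thetaProd_q_div (hq0 : q ≠ 0) (x : ℂ) :
    thetaProd q (q / x) = thetaProd q x := by
  rw [thetaProd, thetaProd, div_div_cancel₀ hq0, mul_comm]

lemma thetaProd_inv (hq0 : q ≠ 0) (hq : ‖q‖ < 1) {x : ℂ} (hx : x ≠ 0) :
    thetaProd q (1 / x) = -(thetaProd q x / x) := by
  rw [← thetaProd_mul_q hq0 hq hx, ← thetaProd_q_div hq0 (x * q)]
  congr 1; field_simp

/-- Quasi-periodicity over all of q^ℤ, stated with the multiplier next to the shifted value so that
no division is needed. -/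
lemma thetaProd_mul_zpow (hq0 : q ≠ 0) (hq : ‖q‖ < 1) {x : ℂ} (hx : x ≠ 0) (k : ℤ) :
    thetaProd q (x * q ^ k) * (gauss q k * x ^ k) = thetaProd q x := by
  have step (k : ℤ) : thetaProd q (x * q ^ (k + 1)) * (gauss q (k + 1) * x ^ (k + 1)) =
      thetaProd q (x * q ^ k) * (gauss q k * x ^ k) := by
    have h : q ^ k ≠ 0 := zpow_ne_zero _ hq0
    rw [zpow_add_one₀ hq0, ← mul_assoc x, thetaProd_mul_q hq0 hq (mul_ne_zero hx h),
      gauss_succ hq0, zpow_add_one₀ hx]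
    field_simp
  induction k with
  | zero => simp
  | succ k ih => rw [step, ih]
  | pred k ih =>
    rw [← ih, ← step (-k - 1)]
    simp

lemma zpow_ne_one_of_norm_lt_one (hq0 : q ≠ 0) (hq : ‖q‖ < 1) {m : ℤ} (hm : 0 < m) :
    q ^ m ≠ 1 := by
  intro h
  have h2 : ‖q‖ ^ m = 1 := by rw [← norm_zpow, h, norm_one]
  exact (zpow_lt_one_of_neg₀' hq0 hq hm).ne h2
where
  zpow_lt_one_of_neg₀' (hq0 : q ≠ 0) (hq : ‖q‖ < 1) {m : ℤ} (hm : 0 < m) : ‖q‖ ^ m < 1 := by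
    obtain ⟨n, rfl⟩ := Int.eq_ofNat_of_zero_le hm.le
    rw [zpow_natCast]
    exact pow_lt_one₀ (norm_nonneg _) hq (by omega)

lemma qPochInf_q_ne_zero (hq0 : q ≠ 0) (hq : ‖q‖ < 1) : qPochInf q q ≠ 0 := by
  refine qPochInf_ne_zero hq fun n h => ?_
  refine zpow_ne_one_of_norm_lt_one hq0 hq (m := n + 1) (by omega) ?_
  rw [zpow_add_one₀ hq0, zpow_natCast]
  linear_combination -h

lemma qPochInf_ne_zero_of_forall_zpow (hq0 : q ≠ 0) (hq : ‖q‖ < 1) {x : ℂ}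
    (h : ∀ m : ℤ, x ≠ q ^ m) : qPochInf q x ≠ 0 := by
  refine qPochInf_ne_zero hq fun n h0 => h (-n) ?_
  rw [zpow_neg, zpow_natCast, ← one_div, eq_div_iff (pow_ne_zero _ hq0)]
  linear_combination -h0

lemma thetaProd_ne_zero (hq0 : q ≠ 0) (hq : ‖q‖ < 1) {x : ℂ}
    (h : ∀ m : ℤ, x ≠ q ^ m) : thetaProd q x ≠ 0 := by
  refine mul_ne_zero (qPochInf_ne_zero_of_forall_zpow hq0 hq h)
    (qPochInf_ne_zero_of_forall_zpow hq0 hq fun m hm => h (1 - m) ?_)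
  have h2 : q ^ m ≠ 0 := zpow_ne_zero _ hq0
  have hx : x ≠ 0 := by rintro rfl; simp at hm; exact h2 hm.symm
  rw [zpow_sub₀ hq0, zpow_one, ← hm]
  field_simp

lemma thetaProd_zpow_eq_zero (hq0 : q ≠ 0) (m : ℤ) : thetaProd q (q ^ m) = 0 := by
  rw [thetaProd]
  rcases le_or_gt m 0 with hm | hm
  · rw [qPochInf_zpow_eq_zero hq0 hm, zero_mul]
  · have : q / q ^ m = q ^ (1 - m) := by rw [zpow_sub₀ hq0, zpow_one]
    rw [this, qPochInf_zpow_eq_zero hq0 (m := 1 - m) (by omega), mul_zero]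

/-- With second parameter 1/x the term behaves like x^{-n}. Removing this growth leaves the partial
products of (x;q)_∞ and the constant (q/x;q)_∞, while the factor with α tends to 1. All theta
functions that occur as boundary values of telescoping sums come from here. -/
lemma tendsto_pairTerm_mul_zpow (hq0 : q ≠ 0) (hq : ‖q‖ < 1) (α : ℂ) {x : ℂ} (hx : x ≠ 0) :
    Tendsto (fun n : ℕ => pairTerm q α (1 / x) n * x ^ n) atTop (𝓝 (thetaProd q x)) := by
  have e (n : ℕ) : pairTerm q α (1 / x) n * x ^ n =
      (∏ k ∈ Finset.range n, (1 - x * q ^ k)) * qPochInf q (α * q ^ n) * qPochInf q (q / x) := by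
    rw [pairTerm_natCast hq0 hq]
    have : (∏ k ∈ Finset.range n, (1 / x - q ^ k)) * x ^ n =
        ∏ k ∈ Finset.range n, (1 - x * q ^ k) := by
      rw [← Finset.card_range n, ← Finset.prod_const, Finset.card_range, ← Finset.prod_mul_distrib]
      refine Finset.prod_congr rfl fun k _ => ?_
      field_simp
    rw [← this, show 1 / x * q = q / x by ring]
    ring
  simp only [e]
  have := ((tendsto_prod_qPochInf hq x).mul (tendsto_qPochInf_mul_pow hq α)).mul_const
    (qPochInf q (q / x))
  rwa [mul_one] at this

/-! ### The Jacobi triple product -/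

/-- Beyond distance m one of the two infinite products starts at a nonpositive power of q and
contains the factor 0. Hence the theta sum at level m is finite. -/
lemma pairTerm_eq_zero_of_lt (hq0 : q ≠ 0) {m : ℕ} {k : ℤ} (hk : (m : ℤ) < |k|) :
    pairTerm q (q ^ (m + 1)) (q ^ m) k = 0 := by
  rw [pairTerm, ← zpow_natCast, ← zpow_natCast, ← zpow_add₀ hq0, ← zpow_add₀ hq0]
  rcases lt_or_ge k 0 with h | h
  · rw [abs_of_neg h] at hk
    rw [qPochInf_zpow_eq_zero hq0 (m := ((m + 1 : ℕ) : ℤ) + k) (by push_cast; omega)]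
    simp
  · rw [abs_of_nonneg h] at hk
    rw [qPochInf_zpow_eq_zero hq0 (m := (m : ℤ) + (1 - k)) (by omega)]
    simp

lemma summable_finiteTheta (hq0 : q ≠ 0) (x : ℂ) (m : ℕ) :
    Summable fun k : ℤ => pairTerm q (q ^ (m + 1)) (q ^ m) k * x ^ k := by
  refine summable_of_ne_finset_zero (s := Finset.Icc (-(m : ℤ)) m) fun k hk => ?_
  rw [pairTerm_eq_zero_of_lt hq0, zero_mul]
  rw [Finset.mem_Icc, ← abs_le] at hk
  exact not_le.mp hk

/-- Each of the three neighbouring terms is a rational multiple of the same term at the next level,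
so the relation is an identity of rational functions in u and q^k. With u = q^m it is the step from
level m to level m + 1. -/
lemma pairTerm_contiguous (hq0 : q ≠ 0) (hq : ‖q‖ < 1) (u : ℂ) (k : ℤ) :
    (1 + q * u ^ 2) * pairTerm q (u * q) u k - u * pairTerm q (u * q) u (k - 1) -
      q * u * pairTerm q (u * q) u (k + 1) =
      (1 - q * u ^ 2) * (1 - q ^ 2 * u ^ 2) * pairTerm q (u * q ^ 2) (u * q) k := by
  have hQ : q ^ k ≠ 0 := zpow_ne_zero _ hq0
  have e1 : q ^ (1 - k) = q / q ^ k := by rw [zpow_sub₀ hq0, zpow_one]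
  have e2 : q ^ (k - 1) = q ^ k / q := by rw [zpow_sub₀ hq0, zpow_one]
  have e3 : u * q * q = u * q ^ 2 := by ring
  have h0 : pairTerm q (u * q) u k = (1 - u * q * q ^ k) * (1 - u * (q / q ^ k)) *
      pairTerm q (u * q ^ 2) (u * q) k := by
    rw [pairTerm_eq_mul_left hq, pairTerm_eq_mul_right hq, e1, e3]; ring
  have h1 : pairTerm q (u * q) u (k + 1) = -(q ^ k * ((1 - u / q * (q / q ^ k)) *
      (1 - u * (q / q ^ k)) * pairTerm q (u * q ^ 2) (u * q) k)) := by
    rw [pairTerm_shift hq0, pairTerm_eq_mul_right hq, div_mul_cancel₀ _ hq0,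
      pairTerm_eq_mul_right hq _ u, e1, e3]; ring
  have h2 : pairTerm q (u * q) u (k - 1) = -(q / q ^ k * ((1 - u * q ^ k) *
      (1 - u * q * q ^ k) * pairTerm q (u * q ^ 2) (u * q) k)) := by
    have := pairTerm_shift hq0 u (u * q) (k - 1)
    rw [sub_add_cancel, mul_div_cancel_right₀ _ hq0, pairTerm_eq_mul_left hq,
      pairTerm_eq_mul_left hq (u * q), e2, e3] at this
    field_simp at this ⊢
    linear_combination this
  rw [h0, h1, h2]
  field_simp
  ring

lemma tsum_int_succ (F : ℤ → ℂ) : ∑' k : ℤ, F (k + 1) = ∑' k : ℤ, F k :=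
  (Equiv.addRight (1 : ℤ)).tsum_eq F

lemma tsum_int_pred (F : ℤ → ℂ) : ∑' k : ℤ, F (k - 1) = ∑' k : ℤ, F k :=
  (Equiv.subRight (1 : ℤ)).tsum_eq F

lemma summable_int_succ {F : ℤ → ℂ} (hF : Summable F) : Summable fun k : ℤ => F (k + 1) :=
  (Equiv.addRight (1 : ℤ)).summable_iff.mpr hF

lemma summable_int_pred {F : ℤ → ℂ} (hF : Summable F) : Summable fun k : ℤ => F (k - 1) :=
  (Equiv.subRight (1 : ℤ)).summable_iff.mpr hF

lemma tsum_three_term {F G : ℤ → ℂ} (hF : Summable F) {a b c d : ℂ}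
    (h : ∀ k, a * F k - b * F (k - 1) - c * F (k + 1) = d * G k) :
    (a - b - c) * ∑' k, F k = d * ∑' k, G k := by
  have h1 := (((hF.hasSum.mul_left a).sub ((summable_int_pred hF).hasSum.mul_left b)).sub
    ((summable_int_succ hF).hasSum.mul_left c)).tsum_eq
  rw [tsum_int_pred, tsum_int_succ] at h1
  simp only [h, tsum_mul_left] at h1
  rw [h1]
  ring

/-- Shifting the index by one in a sum weighted by x^k multiplies it by x or 1/x; the three
coefficients of `pairTerm_contiguous` then combine to (1 - x q^m)(1 - q^{m+1}/x). -/
lemma finiteTheta_succ (hq0 : q ≠ 0) (hq : ‖q‖ < 1) {x : ℂ} (hx : x ≠ 0) (m : ℕ) :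
    (1 - x * q ^ m) * (1 - q / x * q ^ m) * ∑' k : ℤ, pairTerm q (q ^ (m + 1)) (q ^ m) k * x ^ k =
      (1 - q * q ^ (2 * m)) * (1 - q * q ^ (2 * m + 1)) *
        ∑' k : ℤ, pairTerm q (q ^ (m + 2)) (q ^ (m + 1)) k * x ^ k := by
  have key := tsum_three_term (summable_finiteTheta hq0 x m) (a := 1 + q * (q ^ m) ^ 2)
    (b := q ^ m * x) (c := q * q ^ m / x) (d := (1 - q * (q ^ m) ^ 2) * (1 - q ^ 2 * (q ^ m) ^ 2))
    (G := fun k => pairTerm q (q ^ (m + 2)) (q ^ (m + 1)) k * x ^ k) fun k => ?_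
  · have e : (1 - x * q ^ m) * (1 - q / x * q ^ m) =
        1 + q * (q ^ m) ^ 2 - q ^ m * x - q * q ^ m / x := by
      field_simp; ring
    rw [e, key]
    ring
  · have := pairTerm_contiguous hq0 hq (q ^ m) k
    rw [← pow_succ, ← pow_add] at this
    rw [zpow_sub₀ hx, zpow_add₀ hx, zpow_one]
    field_simp
    linear_combination this

/-- The finite triple product. The square of (q;q)_∞ is present because `pairTerm` contains two
infinite products instead of a q-binomial coefficient. -/
lemma finiteTheta_eq (hq0 : q ≠ 0) (hq : ‖q‖ < 1) {x : ℂ} (hx : x ≠ 0) (m : ℕ) :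
    (∏ k ∈ Finset.range m, (1 - x * q ^ k)) * (∏ k ∈ Finset.range m, (1 - q / x * q ^ k)) *
        qPochInf q q ^ 2 =
      (∏ k ∈ Finset.range (2 * m), (1 - q * q ^ k)) *
        ∑' k : ℤ, pairTerm q (q ^ (m + 1)) (q ^ m) k * x ^ k := by
  induction m with
  | zero =>
    rw [tsum_eq_single 0]
    · simp [pairTerm, sq]
    · intro k hk
      rw [pairTerm_eq_zero_of_lt hq0, zero_mul]
      simpa using hk
  | succ m ih =>
    rw [Finset.prod_range_succ, Finset.prod_range_succ, show 2 * (m + 1) = 2 * m + 1 + 1 by ring,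
      Finset.prod_range_succ, Finset.prod_range_succ]
    linear_combination (1 - x * q ^ m) * (1 - q / x * q ^ m) * ih +
      (∏ k ∈ Finset.range (2 * m), (1 - q * q ^ k)) * finiteTheta_succ hq0 hq hx m

lemma summable_gauss (hq0 : q ≠ 0) (hq : ‖q‖ < 1) (x : ℂ) (hx : x ≠ 0) :
    Summable (fun k : ℤ => gauss q k * x ^ k) ∧
    Tendsto (fun m : ℕ => ∑' k : ℤ, pairTerm q (q ^ (m + 1)) (q ^ m) k * x ^ k) atTop
      (𝓝 (∑' k : ℤ, gauss q k * x ^ k)) := by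
  have hr : 0 < ‖q‖ := norm_pos_iff.mpr hq0
  have hx' : 0 < ‖x‖ := norm_pos_iff.mpr hx
  have h1 : ∀ y : ℝ, ∀ᶠ m : ℕ in atTop, ‖q‖ ^ m * y < 1 := fun y =>
    ((tendsto_pow_atTop_nhds_zero_of_lt_one hr.le hq).mul_const y).eventually_lt_const (by simp)
  -- From level M on both parameters have norm at most |q|^M, and M is chosen so large that this
  -- radius beats both x and 1/x. One summable bound then serves all later levels.
  obtain ⟨M, hM1, hM2⟩ := ((h1 ‖x‖).and (h1 ‖x⁻¹‖)).exists
  set bound : ℤ → ℝ := fun k => pairConst q (‖q‖ ^ M) (‖q‖ ^ M) *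
    twoSided (‖q‖ ^ M * ‖x‖) (‖q‖ ^ M * ‖x⁻¹‖) k with hbound
  have hsum : Summable bound := (summable_twoSided (by positivity) (by positivity) hM1 hM2).mul_left _
  have hle : ∀ m ≥ M, ∀ k : ℤ, ‖pairTerm q (q ^ (m + 1)) (q ^ m) k * x ^ k‖ ≤ bound k := by
    intro m hm k
    rw [norm_mul, norm_zpow_eq_twoSided, hbound]
    have h2 : ‖q ^ m‖ ≤ ‖q‖ ^ M := by
      rw [norm_pow]; exact pow_le_pow_of_le_one hr.le hq.le hm
    have h3 : ‖q ^ (m + 1)‖ ≤ ‖q‖ ^ M := by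
      rw [norm_pow]; exact pow_le_pow_of_le_one hr.le hq.le (by omega)
    have := norm_pairTerm_le hq0 hq (by positivity) (by positivity) h3 h2 k
    simp only [← twoSided_mul, ← mul_assoc]
    exact mul_le_mul_of_nonneg_right this (twoSided_nonneg (norm_nonneg _) (norm_nonneg _) k)
  have hlim : ∀ k : ℤ, Tendsto (fun m : ℕ => pairTerm q (q ^ (m + 1)) (q ^ m) k * x ^ k) atTop
      (𝓝 (gauss q k * x ^ k)) := by
    intro k
    have ha := tendsto_qPochInf_mul_pow hq (q ^ (k + 1))
    have hb := tendsto_qPochInf_mul_pow hq (q ^ (1 - k))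
    have := ((ha.mul hb).mul_const (gauss q k)).mul_const (x ^ k)
    rw [one_mul, one_mul] at this
    refine this.congr fun m => ?_
    rw [pairTerm, show q ^ (k + 1) * q ^ m = q ^ (m + 1) * q ^ k by
      rw [zpow_add_one₀ hq0, pow_succ]; ring, mul_comm (q ^ (1 - k))]
  refine ⟨.of_norm_bounded hsum fun k => le_of_tendsto (hlim k).norm ?_,
    tendsto_tsum_of_dominated_convergence hsum hlim ?_⟩
  · filter_upwards [eventually_ge_atTop M] with m hm using hle m hm k
  · filter_upwards [eventually_ge_atTop M] with m hm using hle m hm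

/-- The Jacobi triple product identity. -/
theorem tsum_gauss_eq (hq0 : q ≠ 0) (hq : ‖q‖ < 1) {x : ℂ} (hx : x ≠ 0) :
    ∑' k : ℤ, gauss q k * x ^ k = qPochInf q q * thetaProd q x := by
  have h1 := ((tendsto_prod_qPochInf hq x).mul (tendsto_prod_qPochInf hq (q / x))).mul_const
    (qPochInf q q ^ 2)
  have h2 := ((tendsto_prod_qPochInf hq q).comp
    (tendsto_id.const_mul_atTop' (r := 2) (by norm_num))).mul (summable_gauss hq0 hq x hx).2
  have h3 := tendsto_nhds_unique (h1.congr fun m => finiteTheta_eq hq0 hq hx m) h2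
  have h4 := qPochInf_q_ne_zero hq0 hq
  refine mul_left_cancel₀ h4 ?_
  rw [← h3, thetaProd]
  ring

lemma theta_eq_thetaProd (hq0 : q ≠ 0) (hq : ‖q‖ < 1) {x : ℂ} (hx : x ≠ 0) :
    theta q x = thetaProd q x := by
  have := tsum_gauss_eq hq0 hq hx
  simp only [gauss] at this
  rw [theta, this, inv_mul_cancel_left₀ (qPochInf_q_ne_zero hq0 hq)]

/-! ### The Weierstrass addition formula -/

/-- The bijection that splits pairs of integers by the parity of their sum. -/
def parityEquiv : (ℤ × ℤ) ⊕ (ℤ × ℤ) ≃ ℤ × ℤ where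
  toFun := Sum.elim (fun p => (p.1 + p.2, p.1 - p.2)) (fun p => (p.1 + p.2 + 1, p.1 - p.2))
  invFun p := if (p.1 + p.2) % 2 = 0 then Sum.inl ((p.1 + p.2) / 2, (p.1 - p.2) / 2)
    else Sum.inr ((p.1 + p.2) / 2, (p.1 - p.2) / 2)
  left_inv := by
    rintro (⟨i, j⟩ | ⟨i, j⟩)
    · have h : (i + j + (i - j)) % 2 = 0 := by omega
      simp only [Sum.elim_inl, h, if_true, Sum.inl.injEq, Prod.mk.injEq]
      omega
    · have h : ¬ (i + j + 1 + (i - j)) % 2 = 0 := by omega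
      simp only [Sum.elim_inr, h, if_false, Sum.inr.injEq, Prod.mk.injEq]
      omega
  right_inv := by
    rintro ⟨m, n⟩
    by_cases h : (m + n) % 2 = 0
    · simp only [h, if_true, Sum.elim_inl, Prod.mk.injEq]
      omega
    · simp only [h, if_false, Sum.elim_inr, Prod.mk.injEq]
      omega

/-- The even part `∑ q^{j²} y^{2 j}`. -/
def evenTheta (q y : ℂ) : ℂ := ∑' j : ℤ, q ^ (j * j) * y ^ (2 * j)

/-- The odd part `∑ q^{j²+j} y^{2 j + 1}`. -/
def oddTheta (q y : ℂ) : ℂ := ∑' j : ℤ, q ^ (j * j + j) * y ^ (2 * j + 1)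

lemma gauss_even (hq0 : q ≠ 0) (i j : ℤ) :
    gauss q (i + j) * gauss q (i - j) = q ^ (i * i - i) * q ^ (j * j) := by
  have h1 : (i + j) * (i + j - 1) / 2 + (i - j) * (i - j - 1) / 2 = (i * i - i) + j * j := by
    obtain ⟨s, hs⟩ := (Int.even_mul_pred_self (i + j)).two_dvd
    obtain ⟨t, ht⟩ := (Int.even_mul_pred_self (i - j)).two_dvd
    rw [hs, ht, Int.mul_ediv_cancel_left _ two_ne_zero, Int.mul_ediv_cancel_left _ two_ne_zero]
    linarith
  rw [gauss, gauss, mul_mul_mul_comm, ← zpow_add₀ hq0, h1, ← zpow_add₀ (by norm_num),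
    show i + j + (i - j) = 2 * i by ring, zpow_mul]
  norm_num [zpow_add₀ hq0]

lemma gauss_odd (hq0 : q ≠ 0) (i j : ℤ) :
    gauss q (i + j + 1) * gauss q (i - j) = -(q ^ (i * i) * q ^ (j * j + j)) := by
  rw [gauss_succ hq0, neg_mul, mul_assoc, gauss_even hq0, ← zpow_add₀ hq0, ← zpow_add₀ hq0,
    ← zpow_add₀ hq0]
  congr 2; ring

lemma gauss_sq (q : ℂ) (j : ℤ) : gauss (q ^ 2) j = (-1 : ℂ) ^ j * q ^ (j * j - j) := by
  obtain ⟨s, hs⟩ := (Int.even_mul_pred_self j).two_dvd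
  rw [gauss, hs, Int.mul_ediv_cancel_left _ two_ne_zero, ← zpow_natCast q 2, ← zpow_mul]
  push_cast
  rw [← hs]
  congr 2; ring

/-- Up to sign this is a Jacobi theta series to the base q², so its convergence is already known. -/
lemma summable_evenTheta (hq0 : q ≠ 0) (hq : ‖q‖ < 1) {y : ℂ} (hy : y ≠ 0) :
    Summable fun j : ℤ => ‖q ^ (j * j) * y ^ (2 * j)‖ := by
  have hq2 : ‖q ^ 2‖ < 1 := by rw [norm_pow]; exact pow_lt_one₀ (norm_nonneg _) hq two_ne_zero
  refine (summable_gauss (pow_ne_zero 2 hq0) hq2 (-(q * y ^ 2)) (by simp [hq0, hy])).1.norm.congr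
    fun j => ?_
  rw [gauss_sq, neg_eq_neg_one_mul (q * y ^ 2), mul_zpow, mul_zpow, zpow_sub₀ hq0, zpow_mul y]
  have := zpow_ne_zero j hq0
  simp only [norm_mul, norm_zpow, norm_neg, norm_one, one_zpow, norm_div]
  norm_cast
  field_simp
  rw [norm_pow]

lemma summable_oddTheta (hq0 : q ≠ 0) (hq : ‖q‖ < 1) {y : ℂ} (hy : y ≠ 0) :
    Summable fun j : ℤ => ‖q ^ (j * j + j) * y ^ (2 * j + 1)‖ := by
  have hq2 : ‖q ^ 2‖ < 1 := by rw [norm_pow]; exact pow_lt_one₀ (norm_nonneg _) hq two_ne_zero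
  refine ((summable_gauss (pow_ne_zero 2 hq0) hq2 (-(q ^ 2 * y ^ 2))
    (by simp [hq0, hy])).1.norm.mul_right ‖y‖).congr fun j => ?_
  rw [gauss_sq, neg_eq_neg_one_mul (q ^ 2 * y ^ 2), mul_zpow, mul_zpow, zpow_sub₀ hq0,
    zpow_add₀ hq0,
    zpow_add_one₀ hy, zpow_mul y]
  have := zpow_ne_zero j hq0
  have e : (q ^ 2) ^ j = q ^ j * q ^ j := by rw [sq, mul_zpow]
  rw [e]
  simp only [norm_mul, norm_zpow, norm_neg, norm_one, one_zpow, norm_div]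
  norm_cast
  field_simp
  rw [norm_pow]

/-- In the product of the two Jacobi series the index pair is written as (i + j, i - j) or (i + j +
1, i - j) according to the parity of its sum. This separates x from y, and the result is x times a
2×2 determinant in the pairs (`evenTheta`, `oddTheta`) at x and at y. -/
lemma thetaProd_mul_thetaProd (hq0 : q ≠ 0) (hq : ‖q‖ < 1) {x y : ℂ} (hx : x ≠ 0) (hy : y ≠ 0) :
    qPochInf q q ^ 2 * (thetaProd q (x * y) * thetaProd q (x / y)) =
      x * (oddTheta q x * evenTheta q y - evenTheta q x * oddTheta q y) := by
  have s1 := (summable_gauss hq0 hq (x * y) (mul_ne_zero hx hy)).1.norm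
  have s2 := (summable_gauss hq0 hq (x / y) (div_ne_zero hx hy)).1.norm
  have hsum := summable_mul_of_summable_norm s1 s2
  have h1 := tsum_mul_tsum_of_summable_norm s1 s2
  rw [tsum_gauss_eq hq0 hq (mul_ne_zero hx hy), tsum_gauss_eq hq0 hq (div_ne_zero hx hy)] at h1
  have hsum' := parityEquiv.summable_iff.mpr hsum
  have e1 (p : ℤ × ℤ) : gauss q (p.1 + p.2) * (x * y) ^ (p.1 + p.2) *
      (gauss q (p.1 - p.2) * (x / y) ^ (p.1 - p.2)) =
      (q ^ (p.1 * p.1 - p.1) * x ^ (2 * p.1)) * (q ^ (p.2 * p.2) * y ^ (2 * p.2)) := by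
    rw [mul_mul_mul_comm, gauss_even hq0, mul_zpow, div_zpow, zpow_add₀ hx, zpow_add₀ hy,
      zpow_sub₀ hx, zpow_sub₀ hy, two_mul, two_mul, zpow_add₀ hx, zpow_add₀ hy]
    have := zpow_ne_zero p.1 hx; have := zpow_ne_zero p.2 hx
    have := zpow_ne_zero p.1 hy; have := zpow_ne_zero p.2 hy
    field_simp
  have e2 (p : ℤ × ℤ) : gauss q (p.1 + p.2 + 1) * (x * y) ^ (p.1 + p.2 + 1) *
      (gauss q (p.1 - p.2) * (x / y) ^ (p.1 - p.2)) =
      (q ^ (p.1 * p.1) * x ^ (2 * p.1)) *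
        (-x * (q ^ (p.2 * p.2 + p.2) * y ^ (2 * p.2 + 1))) := by
    rw [mul_mul_mul_comm, gauss_odd hq0, mul_zpow, div_zpow, zpow_add_one₀ hx,
      zpow_add_one₀ hy, zpow_add_one₀ hy, zpow_add₀ hx, zpow_add₀ hy,
      zpow_sub₀ hx, zpow_sub₀ hy, two_mul, two_mul, zpow_add₀ hx, zpow_add₀ hy]
    have := zpow_ne_zero p.1 hx; have := zpow_ne_zero p.2 hx
    have := zpow_ne_zero p.1 hy; have := zpow_ne_zero p.2 hy
    field_simp
  have e3 : (fun i : ℤ => q ^ (i * i - i) * x ^ (2 * i)) =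
      fun i : ℤ => x * (q ^ ((i - 1) * (i - 1) + (i - 1)) * x ^ (2 * (i - 1) + 1)) := by
    funext i
    rw [show (i - 1) * (i - 1) + (i - 1) = i * i - i by ring,
      show 2 * i = 2 * (i - 1) + 1 + 1 by ring, zpow_add_one₀ hx]
    ring
  have s3 := (summable_evenTheta hq0 hq hy)
  have s4 : Summable fun i : ℤ => ‖q ^ (i * i - i) * x ^ (2 * i)‖ := by
    have := ((summable_int_pred (summable_oddTheta hq0 hq hx).of_norm).mul_left x)
    rw [← e3] at this
    exact this.norm
  have s5 := (summable_evenTheta hq0 hq hx)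
  have s6 : Summable fun j : ℤ => ‖-x * (q ^ (j * j + j) * y ^ (2 * j + 1))‖ :=
    ((summable_oddTheta hq0 hq hy).of_norm.mul_left (-x)).norm
  have h2 : ∑' i : ℤ, q ^ (i * i - i) * x ^ (2 * i) = x * oddTheta q x := by
    rw [e3, tsum_mul_left, oddTheta,
      tsum_int_pred fun i : ℤ => q ^ (i * i + i) * x ^ (2 * i + 1)]
  have h3 := (parityEquiv.tsum_eq fun p : ℤ × ℤ =>
    gauss q p.1 * (x * y) ^ p.1 * (gauss q p.2 * (x / y) ^ p.2)).symm
  rw [← h1] at h3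
  have h4 := Summable.tsum_sum (hsum'.comp_injective Sum.inl_injective)
    (hsum'.comp_injective Sum.inr_injective)
  simp only [Function.comp_def] at h4
  rw [h4] at h3
  simp only [parityEquiv, Equiv.coe_fn_mk, Sum.elim_inl, Sum.elim_inr, e1, e2] at h3
  rw [← tsum_mul_tsum_of_summable_norm s4 s3, ← tsum_mul_tsum_of_summable_norm s5 s6,
    h2, tsum_mul_left] at h3
  rw [← evenTheta, ← evenTheta, ← oddTheta] at h3
  linear_combination h3

/-- The Weierstrass addition formula. -/
theorem thetaProd_weierstrass (hq0 : q ≠ 0) (hq : ‖q‖ < 1) {x y u v : ℂ} (hx : x ≠ 0)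
    (hy : y ≠ 0) (hu : u ≠ 0) (hv : v ≠ 0) :
    y * (thetaProd q (x * y) * thetaProd q (x / y) * (thetaProd q (u * v) * thetaProd q (u / v)) -
      thetaProd q (x * v) * thetaProd q (x / v) * (thetaProd q (u * y) * thetaProd q (u / y))) =
      u * (thetaProd q (y * v) * thetaProd q (y / v) *
        (thetaProd q (x * u) * thetaProd q (x / u))) := by
  have h0 := pow_ne_zero 4 (qPochInf_q_ne_zero hq0 hq)
  refine mul_left_cancel₀ h0 ?_
  have h1 := thetaProd_mul_thetaProd hq0 hq hx hy
  have h2 := thetaProd_mul_thetaProd hq0 hq hu hv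
  have h3 := thetaProd_mul_thetaProd hq0 hq hx hv
  have h4 := thetaProd_mul_thetaProd hq0 hq hu hy
  have h5 := thetaProd_mul_thetaProd hq0 hq hy hv
  have h6 := thetaProd_mul_thetaProd hq0 hq hx hu
  have e (A B C D : ℂ) : qPochInf q q ^ 4 * (A * B * (C * D)) =
    (qPochInf q q ^ 2 * (A * B)) * (qPochInf q q ^ 2 * (C * D)) := by ring
  have l : qPochInf q q ^ 4 * (y * (thetaProd q (x * y) * thetaProd q (x / y) *
        (thetaProd q (u * v) * thetaProd q (u / v)) -
      thetaProd q (x * v) * thetaProd q (x / v) * (thetaProd q (u * y) * thetaProd q (u / y)))) =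
      y * (qPochInf q q ^ 4 * (thetaProd q (x * y) * thetaProd q (x / y) *
        (thetaProd q (u * v) * thetaProd q (u / v))) - qPochInf q q ^ 4 * (
      thetaProd q (x * v) * thetaProd q (x / v) *
        (thetaProd q (u * y) * thetaProd q (u / y)))) := by ring
  -- Every bracket is now a 2×2 determinant formed from two of the four vectors (`evenTheta`,
  -- `oddTheta`) at x, y, u, v; what is left is the Plücker relation.
  rw [l, mul_left_comm _ u, e, e, e, h1, h2, h3, h4, h5, h6]
  ring

/-- A form of the addition formula adapted to balanced very-well-poised series. -/
theorem thetaProd_balanced (hq0 : q ≠ 0) (hq : ‖q‖ < 1) {z p₁ p₂ p₃ p₄ p₅ p₆ : ℂ} (hz : z ≠ 0)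
    (h₁ : p₁ ≠ 0) (h₂ : p₂ ≠ 0) (h₃ : p₃ ≠ 0) (h₄ : p₄ ≠ 0) (h₆ : p₆ ≠ 0)
    (h : p₁ * p₂ * p₃ * p₄ * p₅ * p₆ = q * z ^ 3) :
    p₁ * (thetaProd q (p₁ * q / p₄) * thetaProd q (p₆ * p₅ / z) * thetaProd q (p₆ * p₂ / z) *
        thetaProd q (p₆ * p₃ / z)) -
      p₆ * (thetaProd q (p₆ * q / p₄) * thetaProd q (p₁ * p₅ / z) * thetaProd q (p₁ * p₂ / z) *
        thetaProd q (p₁ * p₃ / z)) =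
      -p₆ * (thetaProd q (p₁ / p₆) * thetaProd q (p₄ * p₂ / z) * thetaProd q (p₄ * p₃ / z) *
        thetaProd q (p₄ * p₅ / z)) := by
  -- The square root l of p₂p₃/z² makes the arguments symmetric: with x = l p₄, y = l p₁, u = p₂/(z
  -- l), v = l p₆ the products and quotients are free of l, by l² z² = p₂p₃ and the balancing
  -- condition, up to inversion and x ↦ q/x.
  obtain ⟨l, hl⟩ := IsAlgClosed.exists_pow_nat_eq (p₂ * p₃ / z ^ 2) (n := 2) (by norm_num)
  have hl0 : l ≠ 0 := by
    rintro rfl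
    rw [zero_pow two_ne_zero, eq_comm, div_eq_zero_iff] at hl
    simp [h₂, h₃, hz] at hl
  have hl' : l * l * z ^ 2 = p₂ * p₃ := by
    rw [← sq, hl]; field_simp
  have hqz : q * z = p₁ * p₄ * p₅ * p₆ * l ^ 2 :=
    mul_left_cancel₀ (pow_ne_zero 2 hz) (by
      linear_combination -h - p₁ * p₄ * p₅ * p₆ * hl')
  have W := thetaProd_weierstrass hq0 hq (x := l * p₄) (y := l * p₁) (u := p₂ / (z * l))
    (v := l * p₆) (by positivity) (by positivity) (by positivity) (by positivity)
  have hinv {x : ℂ} (hx : x ≠ 0) : thetaProd q x = -(x * thetaProd q (1 / x)) := by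
    rw [thetaProd_inv hq0 hq hx]; field_simp
  have a1 : thetaProd q (l * p₄ * (l * p₁)) = thetaProd q (p₆ * p₅ / z) := by
    rw [← thetaProd_q_div hq0]; congr 1; field_simp
    linear_combination hqz
  have a2 : thetaProd q (l * p₄ / (l * p₁)) = thetaProd q (p₁ * q / p₄) := by
    rw [← thetaProd_q_div hq0]; congr 1; field_simp
  have a3 : thetaProd q (p₂ / (z * l) * (l * p₆)) = thetaProd q (p₆ * p₂ / z) := by
    congr 1; field_simp
  have a4 : thetaProd q (p₂ / (z * l) / (l * p₆)) =
      -(z / (p₃ * p₆) * thetaProd q (p₆ * p₃ / z)) := by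
    have : p₂ / (z * l) / (l * p₆) = z / (p₃ * p₆) := by
      field_simp; linear_combination -hl'
    rw [this, hinv (by positivity)]; congr 3; field_simp
  have a5 : thetaProd q (l * p₄ * (l * p₆)) = thetaProd q (p₁ * p₅ / z) := by
    rw [← thetaProd_q_div hq0]; congr 1; field_simp
    linear_combination hqz
  have a6 : thetaProd q (l * p₄ / (l * p₆)) = thetaProd q (p₆ * q / p₄) := by
    rw [← thetaProd_q_div hq0]; congr 1; field_simp
  have a7 : thetaProd q (p₂ / (z * l) * (l * p₁)) = thetaProd q (p₁ * p₂ / z) := by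
    congr 1; field_simp
  have a8 : thetaProd q (p₂ / (z * l) / (l * p₁)) =
      -(z / (p₃ * p₁) * thetaProd q (p₁ * p₃ / z)) := by
    have : p₂ / (z * l) / (l * p₁) = z / (p₃ * p₁) := by
      field_simp; linear_combination -hl'
    rw [this, hinv (by positivity)]; congr 3; field_simp
  have a9 : thetaProd q (l * p₁ * (l * p₆)) = thetaProd q (p₄ * p₅ / z) := by
    rw [← thetaProd_q_div hq0]; congr 1; field_simp
    linear_combination hqz
  have a10 : thetaProd q (l * p₁ / (l * p₆)) = thetaProd q (p₁ / p₆) := by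
    congr 1; field_simp
  have a11 : thetaProd q (l * p₄ * (p₂ / (z * l))) = thetaProd q (p₄ * p₂ / z) := by
    congr 1; field_simp
  have a12 : thetaProd q (l * p₄ / (p₂ / (z * l))) = thetaProd q (p₄ * p₃ / z) := by
    congr 1; field_simp; linear_combination hl'
  rw [a1, a2, a3, a4, a5, a6, a7, a8, a9, a10, a11, a12] at W
  field_simp at W
  rw [mul_comm p₅ p₄] at W
  refine mul_left_cancel₀ (mul_ne_zero h₂ h₃) ?_
  linear_combination -W - (p₁ * (thetaProd q (p₁ * q / p₄) * thetaProd q (p₆ * p₅ / z) *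
      thetaProd q (p₆ * p₂ / z) * thetaProd q (p₆ * p₃ / z)) -
    p₆ * (thetaProd q (p₆ * q / p₄) * thetaProd q (p₁ * p₅ / z) * thetaProd q (p₁ * p₂ / z) *
      thetaProd q (p₁ * p₃ / z))) * hl'

section

variable {ι : Type*} {l : Filter ι}

/-! ### Uniform two-sided geometric bounds -/

/-- The sequences `F i` are eventually bounded by one multiple of `‖u i‖ ^ k` for `k ≥ 0` and of
`‖v i‖ ^ (-k)` for `k < 0`. -/
def GeomBound (l : Filter ι) (F : ι → ℤ → ℂ) (u v : ι → ℂ) : Prop :=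
  ∃ C : ℝ, 0 ≤ C ∧ ∀ᶠ i in l, ∀ k, ‖F i k‖ ≤ C * twoSided ‖u i‖ ‖v i‖ k

lemma GeomBound.mul {F G : ι → ℤ → ℂ} {u v u' v' : ι → ℂ} (hF : GeomBound l F u v)
    (hG : GeomBound l G u' v') :
    GeomBound l (fun i k => F i k * G i k) (fun i => u i * u' i) (fun i => v i * v' i) := by
  obtain ⟨C, hC, hF⟩ := hF
  obtain ⟨D, hD, hG⟩ := hG
  refine ⟨C * D, by positivity, ?_⟩
  filter_upwards [hF, hG] with i h1 h2 k
  rw [norm_mul, norm_mul, norm_mul, ← twoSided_mul]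
  have h3 := twoSided_nonneg (norm_nonneg (u i)) (norm_nonneg (v i)) k
  calc _ ≤ (C * twoSided ‖u i‖ ‖v i‖ k) * (D * twoSided ‖u' i‖ ‖v' i‖ k) :=
        mul_le_mul (h1 k) (h2 k) (norm_nonneg _) (by positivity)
    _ = _ := by ring

lemma GeomBound.prod {r : ℕ} {F : Fin r → ι → ℤ → ℂ} {u v : Fin r → ι → ℂ}
    (h : ∀ j, GeomBound l (F j) (u j) (v j)) :
    GeomBound l (fun i k => ∏ j, F j i k) (fun i => ∏ j, u j i) (fun i => ∏ j, v j i) := by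
  induction r with
  | zero =>
    refine ⟨1, zero_le_one, Eventually.of_forall fun i k => ?_⟩
    revert k
    simp [forall_int_iff]
  | succ r ih =>
    simp only [Fin.prod_univ_succ]
    exact (h 0).mul (ih fun j => h j.succ)

lemma GeomBound.congr {F G : ι → ℤ → ℂ} {u v u' v' : ι → ℂ} (hF : GeomBound l F u v)
    (hFG : ∀ᶠ i in l, ∀ k, F i k = G i k) (hu : ∀ᶠ i in l, u i = u' i)
    (hv : ∀ᶠ i in l, v i = v' i) : GeomBound l G u' v' := by
  obtain ⟨C, hC, hF⟩ := hF
  refine ⟨C, hC, ?_⟩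
  filter_upwards [hF, hFG, hu, hv] with i h1 h2 h3 h4 k
  rw [← h2, ← h3, ← h4]
  exact h1 k

lemma geomBound_zpow (w : ι → ℂ) :
    GeomBound l (fun i k => w i ^ k) w (fun i => (w i)⁻¹) :=
  ⟨1, zero_le_one, Eventually.of_forall fun i k => by rw [norm_zpow_eq_twoSided, one_mul]⟩

/-- The very-well-poised factor is bounded for k ≥ 0 and grows like |q|^{-2|k|} for k < 0; this
asymmetry is what the natural weights of `sixTerm` and `fourTerm` compensate. -/
lemma geomBound_one_sub (hq0 : q ≠ 0) (hq : ‖q‖ < 1) {c : ι → ℂ} {c₀ : ℂ}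
    (hc : Tendsto c l (𝓝 c₀)) :
    GeomBound l (fun i k => 1 - c i * q ^ (2 * k)) (fun _ => 1) (fun _ => (q ^ 2)⁻¹) := by
  refine ⟨‖c₀‖ + 2, by positivity, ?_⟩
  have h : ∀ᶠ i in l, ‖c i‖ < ‖c₀‖ + 1 := hc.norm.eventually_lt_const (by simp)
  have hr : 0 < ‖q‖ := norm_pos_iff.mpr hq0
  filter_upwards [h] with i hi k
  have hb : 1 ≤ twoSided ‖(1 : ℂ)‖ ‖(q ^ 2)⁻¹‖ k ∧
      ‖q ^ (2 * k)‖ ≤ twoSided ‖(1 : ℂ)‖ ‖(q ^ 2)⁻¹‖ k := by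
    revert k
    rw [forall_int_iff]
    refine ⟨fun n => ?_, fun n => ?_⟩
    · rw [twoSided_natCast, norm_one, one_pow]
      refine ⟨le_rfl, ?_⟩
      rw [show (2 * (n : ℤ)) = ((2 * n : ℕ) : ℤ) by push_cast; ring, zpow_natCast, norm_pow]
      exact pow_le_one₀ hr.le hq.le
    · rw [twoSided_neg_natCast, norm_inv, norm_pow]
      refine ⟨one_le_pow₀ (one_le_inv_iff₀.mpr ⟨by positivity, pow_le_one₀ hr.le hq.le⟩), ?_⟩
      rw [show 2 * (-(n : ℤ)) = -((2 * n : ℕ) : ℤ) by push_cast; ring, zpow_neg, zpow_natCast,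
        norm_inv, norm_pow, pow_mul, inv_pow]
  calc ‖1 - c i * q ^ (2 * k)‖ ≤ ‖(1 : ℂ)‖ + ‖c i * q ^ (2 * k)‖ := norm_sub_le _ _
    _ = 1 + ‖c i‖ * ‖q ^ (2 * k)‖ := by rw [norm_one, norm_mul]
    _ ≤ twoSided ‖(1 : ℂ)‖ ‖(q ^ 2)⁻¹‖ k + (‖c₀‖ + 1) * twoSided ‖(1 : ℂ)‖ ‖(q ^ 2)⁻¹‖ k := by
        gcongr
        exacts [hb.1, hb.2]
    _ = _ := by ring

/-- `pairConst` is continuous at nonzero radii, so along a convergent family the constants are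
eventually below the limiting one plus 1. -/
lemma geomBound_pairTerm (hq0 : q ≠ 0) (hq : ‖q‖ < 1) {α β : ι → ℂ} {α₀ β₀ : ℂ}
    (hα : Tendsto α l (𝓝 α₀)) (hβ : Tendsto β l (𝓝 β₀)) (hα0 : α₀ ≠ 0) (hβ0 : β₀ ≠ 0) :
    GeomBound l (fun i k => pairTerm q (α i) (β i) k) β α := by
  have h1 : Tendsto (fun i => pairConst q ‖α i‖ ‖β i‖) l (𝓝 (pairConst q ‖α₀‖ ‖β₀‖)) := by
    unfold pairConst
    have ha := hα.norm
    have hb := hβ.norm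
    have ha' := ha.inv₀ (norm_ne_zero_iff.mpr hα0)
    have hb' := hb.inv₀ (norm_ne_zero_iff.mpr hβ0)
    exact (Real.continuous_exp.tendsto _).comp ((((ha.add ha').add hb).add hb').div_const _)
  refine ⟨pairConst q ‖α₀‖ ‖β₀‖ + 1, add_nonneg (Real.exp_nonneg _) zero_le_one, ?_⟩
  filter_upwards [h1.eventually_lt_const (lt_add_one _), hα.eventually_ne hα0,
    hβ.eventually_ne hβ0] with i hi ha hb k
  refine (norm_pairTerm_le hq0 hq (norm_pos_iff.mpr ha) (norm_pos_iff.mpr hb) le_rfl le_rfl k).trans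
    ?_
  exact mul_le_mul_of_nonneg_right hi.le (twoSided_nonneg (norm_nonneg _) (norm_nonneg _) k)

/-- Rates strictly between the norms of the limits and 1 give one summable sequence dominating all
late members of the family. -/
lemma GeomBound.exists_bound {F : ι → ℤ → ℂ} {u v : ι → ℂ} {u₀ v₀ : ℂ} (hF : GeomBound l F u v)
    (hu : Tendsto u l (𝓝 u₀)) (hv : Tendsto v l (𝓝 v₀)) (hu1 : ‖u₀‖ < 1) (hv1 : ‖v₀‖ < 1) :
    ∃ bound : ℤ → ℝ, Summable bound ∧ ∀ᶠ i in l, ∀ k, ‖F i k‖ ≤ bound k := by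
  obtain ⟨C, hC, hF⟩ := hF
  obtain ⟨x, hx1, hx2⟩ := exists_between hu1
  obtain ⟨y, hy1, hy2⟩ := exists_between hv1
  refine ⟨fun k => C * twoSided x y k, (summable_twoSided ((norm_nonneg _).trans hx1.le)
    ((norm_nonneg _).trans hy1.le) hx2 hy2).mul_left _, ?_⟩
  filter_upwards [hF, hu.norm.eventually_lt_const hx1, hv.norm.eventually_lt_const hy1]
    with i h1 h2 h3 k
  exact (h1 k).trans (mul_le_mul_of_nonneg_left
    (twoSided_mono (norm_nonneg _) (norm_nonneg _) h2.le h3.le k) hC)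

lemma GeomBound.tendsto_tsum {F : ι → ℤ → ℂ} {u v : ι → ℂ} {u₀ v₀ : ℂ} {F₀ : ℤ → ℂ}
    (hF : GeomBound l F u v)
    (hu : Tendsto u l (𝓝 u₀)) (hv : Tendsto v l (𝓝 v₀)) (hu1 : ‖u₀‖ < 1) (hv1 : ‖v₀‖ < 1)
    (h : ∀ k, Tendsto (fun i => F i k) l (𝓝 (F₀ k))) :
    Tendsto (fun i => ∑' k, F i k) l (𝓝 (∑' k, F₀ k)) := by
  obtain ⟨bound, hb, hle⟩ := hF.exists_bound hu hv hu1 hv1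
  exact tendsto_tsum_of_dominated_convergence hb h hle

/-- A single sequence is treated as a constant family over `Unit`, so the uniform estimates also
yield summability. -/
lemma GeomBound.summable {F : ℤ → ℂ} {u v : ℂ}
    (hF : GeomBound (⊤ : Filter Unit) (fun _ => F) (fun _ => u) (fun _ => v))
    (hu1 : ‖u‖ < 1) (hv1 : ‖v‖ < 1) : Summable F := by
  obtain ⟨bound, hb, hle⟩ := hF.exists_bound tendsto_const_nhds tendsto_const_nhds hu1 hv1
  obtain ⟨_, h⟩ := hle.exists
  exact .of_norm_bounded hb h

/-! ### Very-well-poised bilateral sums -/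

/-- The general term of a very-well-poised bilateral sum over `s q^ℤ`, cleared of denominators. -/
def vwpTerm {r : ℕ} (q s A W : ℂ) (p : Fin r → ℂ) (k : ℤ) : ℂ :=
  (1 - s ^ 2 / A * q ^ (2 * k)) * (∏ j, pairTerm q (s * q / p j) (A / (s * p j)) k) * W ^ k

lemma geomBound_vwpTerm {r : ℕ} (hq0 : q ≠ 0) (hq : ‖q‖ < 1) {s A W : ι → ℂ}
    {p : ι → Fin r → ℂ} {s₀ A₀ : ℂ} {p₀ : Fin r → ℂ} (hs : Tendsto s l (𝓝 s₀))
    (hA : Tendsto A l (𝓝 A₀)) (hp : ∀ j, Tendsto (fun i => p i j) l (𝓝 (p₀ j)))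
    (hs0 : s₀ ≠ 0) (hA0 : A₀ ≠ 0) (hp0 : ∀ j, p₀ j ≠ 0) :
    GeomBound l (fun i k => vwpTerm q (s i) (A i) (W i) (p i) k)
      (fun i => (1 * ∏ j, A i / (s i * p i j)) * W i)
      (fun i => ((q ^ 2)⁻¹ * ∏ j, s i * q / p i j) * (W i)⁻¹) :=
  ((geomBound_one_sub hq0 hq ((hs.pow 2).div hA hA0)).mul (GeomBound.prod fun j =>
    geomBound_pairTerm hq0 hq ((hs.mul_const q).div (hp j) (hp0 j))
      (hA.div (hs.mul (hp j)) (mul_ne_zero hs0 (hp0 j)))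
      (div_ne_zero (mul_ne_zero hs0 hq0) (hp0 j))
      (div_ne_zero hA0 (mul_ne_zero hs0 (hp0 j))))).mul (geomBound_zpow W)

lemma tendsto_pairTerm (hq : ‖q‖ < 1) {α β : ι → ℂ} {α₀ β₀ : ℂ} (hα : Tendsto α l (𝓝 α₀))
    (hβ : Tendsto β l (𝓝 β₀)) (k : ℤ) :
    Tendsto (fun i => pairTerm q (α i) (β i) k) l (𝓝 (pairTerm q α₀ β₀ k)) :=
  ((((continuous_qPochInf hq).tendsto _).comp (hα.mul_const _)).mul
    (((continuous_qPochInf hq).tendsto _).comp (hβ.mul_const _))).mul_const _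

lemma tendsto_vwpTerm {r : ℕ} (hq : ‖q‖ < 1) {s A W : ι → ℂ}
    {p : ι → Fin r → ℂ} {s₀ A₀ W₀ : ℂ} {p₀ : Fin r → ℂ} (hs : Tendsto s l (𝓝 s₀))
    (hA : Tendsto A l (𝓝 A₀)) (hW : Tendsto W l (𝓝 W₀))
    (hp : ∀ j, Tendsto (fun i => p i j) l (𝓝 (p₀ j)))
    (hs0 : s₀ ≠ 0) (hA0 : A₀ ≠ 0) (hW0 : W₀ ≠ 0) (hp0 : ∀ j, p₀ j ≠ 0) (k : ℤ) :
    Tendsto (fun i => vwpTerm q (s i) (A i) (W i) (p i) k) l (𝓝 (vwpTerm q s₀ A₀ W₀ p₀ k)) := by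
  refine Tendsto.mul (Tendsto.mul ?_ (tendsto_finsetProd _ fun j _ => ?_)) (hW.zpow₀ k (.inl hW0))
  · exact tendsto_const_nhds.sub (((hs.pow 2).div hA hA0).mul_const _)
  · exact tendsto_pairTerm hq ((hs.mul_const q).div (hp j) (hp0 j))
      (hA.div (hs.mul (hp j)) (mul_ne_zero hs0 (hp0 j))) k

/-- The term with six parameters and the natural weight. -/
def sixTerm (q s A p₁ p₂ p₃ p₄ p₅ p₆ : ℂ) (k : ℤ) : ℂ :=
  vwpTerm q s A (s ^ 6 * q ^ 2 / A ^ 3) ![p₁, p₂, p₃, p₄, p₅, p₆] k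

/-- The sum with six parameters. -/
def sixSum (q s A p₁ p₂ p₃ p₄ p₅ p₆ : ℂ) : ℂ := ∑' k, sixTerm q s A p₁ p₂ p₃ p₄ p₅ p₆ k

/-- The term with four parameters and the natural weight. -/
def fourTerm (q s A p₁ p₂ p₃ p₄ : ℂ) (k : ℤ) : ℂ :=
  vwpTerm q s A (s ^ 4 * q / A ^ 2) ![p₁, p₂, p₃, p₄] k

/-- The sum with four parameters. -/
def fourSum (q s A p₁ p₂ p₃ p₄ : ℂ) : ℂ := ∑' k, fourTerm q s A p₁ p₂ p₃ p₄ k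

lemma sixTerm_eq (q s A p₁ p₂ p₃ p₄ p₅ p₆ : ℂ) (k : ℤ) :
    sixTerm q s A p₁ p₂ p₃ p₄ p₅ p₆ k = (1 - s ^ 2 / A * q ^ (2 * k)) *
      (pairTerm q (s * q / p₁) (A / (s * p₁)) k * pairTerm q (s * q / p₂) (A / (s * p₂)) k *
       pairTerm q (s * q / p₃) (A / (s * p₃)) k * pairTerm q (s * q / p₄) (A / (s * p₄)) k *
       pairTerm q (s * q / p₅) (A / (s * p₅)) k * pairTerm q (s * q / p₆) (A / (s * p₆)) k) *
      (s ^ 6 * q ^ 2 / A ^ 3) ^ k := by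
  rw [sixTerm, vwpTerm, Fin.prod_univ_six]
  rfl

lemma fourTerm_eq (q s A p₁ p₂ p₃ p₄ : ℂ) (k : ℤ) :
    fourTerm q s A p₁ p₂ p₃ p₄ k = (1 - s ^ 2 / A * q ^ (2 * k)) *
      (pairTerm q (s * q / p₁) (A / (s * p₁)) k * pairTerm q (s * q / p₂) (A / (s * p₂)) k *
       pairTerm q (s * q / p₃) (A / (s * p₃)) k * pairTerm q (s * q / p₄) (A / (s * p₄)) k) *
      (s ^ 4 * q / A ^ 2) ^ k := by
  rw [fourTerm, vwpTerm, Fin.prod_univ_four]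
  rfl

/-- With the natural weight the rates in both directions coincide and do not involve the base point
s. The same happens for six parameters, with rate A³q²/(p₁⋯p₆). -/
lemma summable_fourTerm (hq0 : q ≠ 0) (hq : ‖q‖ < 1) {s A p₁ p₂ p₃ p₄ : ℂ} (hs : s ≠ 0)
    (hA : A ≠ 0) (h₁ : p₁ ≠ 0) (h₂ : p₂ ≠ 0) (h₃ : p₃ ≠ 0) (h₄ : p₄ ≠ 0)
    (hw : ‖A ^ 2 * q / (p₁ * p₂ * p₃ * p₄)‖ < 1) : Summable (fourTerm q s A p₁ p₂ p₃ p₄) := by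
  have hB := geomBound_vwpTerm (l := (⊤ : Filter Unit)) (r := 4) hq0 hq (s := fun _ => s)
    (A := fun _ => A) (W := fun _ => s ^ 4 * q / A ^ 2) (p := fun _ => ![p₁, p₂, p₃, p₄])
    tendsto_const_nhds tendsto_const_nhds (fun j => tendsto_const_nhds) hs hA
    (by simp [Fin.forall_fin_succ, h₁, h₂, h₃, h₄])
  refine (hB.congr (Eventually.of_forall fun _ _ => rfl)
    (u' := fun _ => A ^ 2 * q / (p₁ * p₂ * p₃ * p₄))
    (v' := fun _ => A ^ 2 * q / (p₁ * p₂ * p₃ * p₄)) ?_ ?_).summable hw hw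
  · refine Eventually.of_forall fun _ => ?_
    simp only [Fin.prod_univ_four, Matrix.cons_val]
    field_simp
  · refine Eventually.of_forall fun _ => ?_
    simp only [Fin.prod_univ_four, Matrix.cons_val]
    field_simp

lemma geomBound_sixTerm (hq0 : q ≠ 0) (hq : ‖q‖ < 1) {s A p₁ p₂ p₃ p₄ p₅ p₆ : ι → ℂ}
    {s₀ A₀ a₁ a₂ a₃ a₄ a₅ a₆ : ℂ} (hs : Tendsto s l (𝓝 s₀)) (hA : Tendsto A l (𝓝 A₀))
    (h₁ : Tendsto p₁ l (𝓝 a₁)) (h₂ : Tendsto p₂ l (𝓝 a₂)) (h₃ : Tendsto p₃ l (𝓝 a₃))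
    (h₄ : Tendsto p₄ l (𝓝 a₄)) (h₅ : Tendsto p₅ l (𝓝 a₅)) (h₆ : Tendsto p₆ l (𝓝 a₆))
    (hs0 : s₀ ≠ 0) (hA0 : A₀ ≠ 0) (z₁ : a₁ ≠ 0) (z₂ : a₂ ≠ 0) (z₃ : a₃ ≠ 0) (z₄ : a₄ ≠ 0)
    (z₅ : a₅ ≠ 0) (z₆ : a₆ ≠ 0) :
    GeomBound l (fun i k => sixTerm q (s i) (A i) (p₁ i) (p₂ i) (p₃ i) (p₄ i) (p₅ i) (p₆ i) k)
      (fun i => A i ^ 3 * q ^ 2 / (p₁ i * p₂ i * p₃ i * p₄ i * p₅ i * p₆ i))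
      (fun i => A i ^ 3 * q ^ 2 / (p₁ i * p₂ i * p₃ i * p₄ i * p₅ i * p₆ i)) := by
  have hB := geomBound_vwpTerm (r := 6) hq0 hq (s := s) (A := A)
    (W := fun i => s i ^ 6 * q ^ 2 / A i ^ 3)
    (p := fun i => ![p₁ i, p₂ i, p₃ i, p₄ i, p₅ i, p₆ i]) (p₀ := ![a₁, a₂, a₃, a₄, a₅, a₆])
    hs hA (by simp [Fin.forall_fin_succ, h₁, h₂, h₃, h₄, h₅, h₆]) hs0 hA0
    (by simp [Fin.forall_fin_succ, z₁, z₂, z₃, z₄, z₅, z₆])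
  refine hB.congr (Eventually.of_forall fun _ _ => rfl) ?_ ?_
  all_goals
    filter_upwards [hs.eventually_ne hs0, hA.eventually_ne hA0, h₁.eventually_ne z₁,
      h₂.eventually_ne z₂, h₃.eventually_ne z₃, h₄.eventually_ne z₄, h₅.eventually_ne z₅,
      h₆.eventually_ne z₆] with i i0 i1 i2 i3 i4 i5 i6 i7
    simp only [Fin.prod_univ_six, Matrix.cons_val]
    field_simp

lemma tendsto_sixSum (hq0 : q ≠ 0) (hq : ‖q‖ < 1) {s A p₁ p₂ p₃ p₄ p₅ p₆ : ι → ℂ}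
    {s₀ A₀ a₁ a₂ a₃ a₄ a₅ a₆ : ℂ} (hs : Tendsto s l (𝓝 s₀)) (hA : Tendsto A l (𝓝 A₀))
    (h₁ : Tendsto p₁ l (𝓝 a₁)) (h₂ : Tendsto p₂ l (𝓝 a₂)) (h₃ : Tendsto p₃ l (𝓝 a₃))
    (h₄ : Tendsto p₄ l (𝓝 a₄)) (h₅ : Tendsto p₅ l (𝓝 a₅)) (h₆ : Tendsto p₆ l (𝓝 a₆))
    (hs0 : s₀ ≠ 0) (hA0 : A₀ ≠ 0) (z₁ : a₁ ≠ 0) (z₂ : a₂ ≠ 0) (z₃ : a₃ ≠ 0) (z₄ : a₄ ≠ 0)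
    (z₅ : a₅ ≠ 0) (z₆ : a₆ ≠ 0) (hw : ‖A₀ ^ 3 * q ^ 2 / (a₁ * a₂ * a₃ * a₄ * a₅ * a₆)‖ < 1) :
    Tendsto (fun i => sixSum q (s i) (A i) (p₁ i) (p₂ i) (p₃ i) (p₄ i) (p₅ i) (p₆ i)) l
      (𝓝 (sixSum q s₀ A₀ a₁ a₂ a₃ a₄ a₅ a₆)) := by
  have hlim : Tendsto (fun i => A i ^ 3 * q ^ 2 / (p₁ i * p₂ i * p₃ i * p₄ i * p₅ i * p₆ i)) l
      (𝓝 (A₀ ^ 3 * q ^ 2 / (a₁ * a₂ * a₃ * a₄ * a₅ * a₆))) :=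
    ((hA.pow 3).mul_const _).div (((((h₁.mul h₂).mul h₃).mul h₄).mul h₅).mul h₆) (by simp [*])
  refine (geomBound_sixTerm hq0 hq hs hA h₁ h₂ h₃ h₄ h₅ h₆ hs0 hA0 z₁ z₂ z₃ z₄ z₅
    z₆).tendsto_tsum hlim hlim hw hw fun k => ?_
  exact tendsto_vwpTerm (p₀ := ![a₁, a₂, a₃, a₄, a₅, a₆]) hq hs hA
    (((hs.pow 6).mul_const _).div (hA.pow 3) (pow_ne_zero _ hA0))
    (by simp [Fin.forall_fin_succ, h₁, h₂, h₃, h₄, h₅, h₆]) hs0 hA0 (by simp [*])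
    (by simp [Fin.forall_fin_succ, z₁, z₂, z₃, z₄, z₅, z₆]) k

lemma summable_sixTerm (hq0 : q ≠ 0) (hq : ‖q‖ < 1) {s A p₁ p₂ p₃ p₄ p₅ p₆ : ℂ} (hs : s ≠ 0)
    (hA : A ≠ 0) (h₁ : p₁ ≠ 0) (h₂ : p₂ ≠ 0) (h₃ : p₃ ≠ 0) (h₄ : p₄ ≠ 0) (h₅ : p₅ ≠ 0)
    (h₆ : p₆ ≠ 0) (hw : ‖A ^ 3 * q ^ 2 / (p₁ * p₂ * p₃ * p₄ * p₅ * p₆)‖ < 1) :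
    Summable (sixTerm q s A p₁ p₂ p₃ p₄ p₅ p₆) :=
  (geomBound_sixTerm hq0 hq (l := (⊤ : Filter Unit)) (s := fun _ => s) (A := fun _ => A)
    (p₁ := fun _ => p₁) (p₂ := fun _ => p₂) (p₃ := fun _ => p₃) (p₄ := fun _ => p₄)
    (p₅ := fun _ => p₅) (p₆ := fun _ => p₆) tendsto_const_nhds tendsto_const_nhds
    tendsto_const_nhds tendsto_const_nhds tendsto_const_nhds tendsto_const_nhds
    tendsto_const_nhds tendsto_const_nhds hs hA h₁ h₂ h₃ h₄ h₅ h₆).summable hw hw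

end

/-! ### Bailey's bilateral sum with four parameters -/

/-- Raising the numerator parameter `r` to `q r` in a factor of a very-well-poised term. -/
lemma pairTerm_raise (hq0 : q ≠ 0) (hq : ‖q‖ < 1) {s A r : ℂ} (k : ℤ) :
    pairTerm q (s * q / (q * r)) (A / (s * (q * r))) k =
      (1 - s * q ^ k / r) * (1 - A / (s * q ^ k * r)) * pairTerm q (s * q / r) (A / (s * r)) k := by
  have e1 : s * q / (q * r) = s / r := by rw [mul_comm s q, mul_div_mul_left _ _ hq0]
  have e2 : s / r * q = s * q / r := by ring
  have e3 : A / (s * (q * r)) * q = A / (s * r) := by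
    rw [div_mul_eq_mul_div, show s * (q * r) = (s * r) * q by ring, mul_div_mul_right _ _ hq0]
  have e4 : A / (s * (q * r)) * q ^ (1 - k) = A / (s * q ^ k * r) := by
    have := zpow_ne_zero k hq0
    rw [zpow_sub₀ hq0, zpow_one, ← mul_div_assoc, e3, div_div]
    congr 1; ring
  rw [pairTerm_eq_mul_left hq, pairTerm_eq_mul_right hq, e1, e2, e3, e4]
  ring

lemma pairTerm_lower_right (hq0 : q ≠ 0) (hq : ‖q‖ < 1) {s A r : ℂ} (k : ℤ) :
    pairTerm q (s * q / r) (A / (s * q * r)) k =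
      (1 - A / (s * q ^ k * r)) * pairTerm q (s * q / r) (A / (s * r)) k := by
  have e3 : A / (s * q * r) * q = A / (s * r) := by
    rw [div_mul_eq_mul_div, show s * q * r = (s * r) * q by ring, mul_div_mul_right _ _ hq0]
  have e4 : A / (s * q * r) * q ^ (1 - k) = A / (s * q ^ k * r) := by
    have := zpow_ne_zero k hq0
    rw [zpow_sub₀ hq0, zpow_one, ← mul_div_assoc, e3, div_div]
    congr 1; ring
  rw [pairTerm_eq_mul_right hq, e3, e4]

lemma pairTerm_lower_right_pred (hq0 : q ≠ 0) (hq : ‖q‖ < 1) {s A r : ℂ} (k : ℤ) :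
    pairTerm q (s * q / r) (A / (s * q * r)) (k - 1) =
      -(q / q ^ k * (1 - s * q ^ k / r) * pairTerm q (s * q / r) (A / (s * r)) k) := by
  have hQ := zpow_ne_zero k hq0
  have e3 : A / (s * r) / q = A / (s * q * r) := by rw [div_div]; congr 1; ring
  have e1 : s / r * q = s * q / r := by ring
  have h := pairTerm_shift hq0 (s / r) (A / (s * r)) (k - 1)
  rw [sub_add_cancel, pairTerm_eq_mul_left hq, e1, e3, zpow_sub₀ hq0, zpow_one] at h
  have e2 : s * q ^ k / r = s / r * q ^ k := by ring
  rw [e2]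
  field_simp at h ⊢
  linear_combination h

/-- After common factors are removed, the difference is, up to a factor y, antisymmetric under y ↦
A/y, where y = s q^k; hence 1 - y²/A divides it. The quotient is affine in y + A/y, and so is (1 -
y/r₁)(1 - A/(y r₁)), the effect of raising r₁. It is therefore a combination of the raised and the
unraised term with coefficients independent of k. -/
lemma fourTerm_telescope (hq0 : q ≠ 0) (hq : ‖q‖ < 1) {s A r₁ r₂ r₃ r₄ : ℂ} (hs : s ≠ 0)
    (hA : A ≠ 0) (h₁ : r₁ ≠ 0) (h₂ : r₂ ≠ 0) (h₃ : r₃ ≠ 0) (h₄ : r₄ ≠ 0) (k : ℤ)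
    (g : ℤ → ℂ) (hg : ∀ k, g k = pairTerm q (s * q / r₁) (A / (s * q * r₁)) k *
      pairTerm q (s * q / r₂) (A / (s * q * r₂)) k * pairTerm q (s * q / r₃) (A / (s * q * r₃)) k *
      pairTerm q (s * q / r₄) (A / (s * q * r₄)) k * (s ^ 4 * q ^ 4 / A ^ 2) ^ k) :
    g k - g (k - 1) = A * r₁ / s ^ 3 *
      ((1 - A ^ 2 / (r₁ * r₂ * r₃ * r₄)) * fourTerm q s A (q * r₁) r₂ r₃ r₄ k -
        (1 - A / (r₁ * r₂)) * (1 - A / (r₁ * r₃)) * (1 - A / (r₁ * r₄)) *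
          fourTerm q s A r₁ r₂ r₃ r₄ k) := by
  have hQ := zpow_ne_zero k hq0
  rw [hg, hg, fourTerm_eq, fourTerm_eq, pairTerm_raise hq0 hq]
  simp only [pairTerm_lower_right_pred hq0 hq]
  simp only [pairTerm_lower_right hq0 hq]
  generalize pairTerm q (s * q / r₁) (A / (s * r₁)) k = H₁
  generalize pairTerm q (s * q / r₂) (A / (s * r₂)) k = H₂
  generalize pairTerm q (s * q / r₃) (A / (s * r₃)) k = H₃
  generalize pairTerm q (s * q / r₄) (A / (s * r₄)) k = H₄
  have hW0 : s ^ 4 * q ^ 4 / A ^ 2 ≠ 0 := by simp [*]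
  have hW : (s ^ 4 * q ^ 4 / A ^ 2) ^ k = (s ^ 4 * q / A ^ 2) ^ k * (q ^ k) ^ 3 := by
    rw [show s ^ 4 * q ^ 4 / A ^ 2 = s ^ 4 * q / A ^ 2 * q ^ 3 by ring, mul_zpow]
    congr 1
    rw [← zpow_natCast (q ^ k), ← zpow_natCast q, ← zpow_mul, ← zpow_mul, mul_comm]
  rw [zpow_sub₀ hW0, zpow_one, hW, two_mul, zpow_add₀ hq0]
  generalize (s ^ 4 * q / A ^ 2) ^ k = w
  generalize q ^ k = Q at *
  have key : Q ^ 3 * ((1 - A / (s * Q * r₁)) * (1 - A / (s * Q * r₂)) * (1 - A / (s * Q * r₃)) *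
      (1 - A / (s * Q * r₄))) - A ^ 2 / (s ^ 4 * Q) * ((1 - s * Q / r₁) * (1 - s * Q / r₂) *
      (1 - s * Q / r₃) * (1 - s * Q / r₄)) = A * r₁ / s ^ 3 * (1 - s ^ 2 / A * (Q * Q)) *
      ((1 - A ^ 2 / (r₁ * r₂ * r₃ * r₄)) * ((1 - s * Q / r₁) * (1 - A / (s * Q * r₁))) -
        (1 - A / (r₁ * r₂)) * (1 - A / (r₁ * r₃)) * (1 - A / (r₁ * r₄))) := by
    field_simp
    ring
  have e : w * Q ^ 3 / (s ^ 4 * q ^ 4 / A ^ 2) = w * Q ^ 3 * A ^ 2 / (s ^ 4 * q ^ 4) := by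
    field_simp
  have e2 : (q / Q) ^ 4 * (w * Q ^ 3 * A ^ 2 / (s ^ 4 * q ^ 4)) = w * (A ^ 2 / (s ^ 4 * Q)) := by
    field_simp
  rw [e]
  generalize 1 - s * Q / r₁ = b₁ at key ⊢
  generalize 1 - s * Q / r₂ = b₂ at key ⊢
  generalize 1 - s * Q / r₃ = b₃ at key ⊢
  generalize 1 - s * Q / r₄ = b₄ at key ⊢
  generalize q / Q = t at e2 ⊢
  generalize w * Q ^ 3 * A ^ 2 / (s ^ 4 * q ^ 4) = X at e2 ⊢
  generalize A ^ 2 / (s ^ 4 * Q) = Y at key e2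
  linear_combination w * H₁ * H₂ * H₃ * H₄ * key - H₁ * H₂ * H₃ * H₄ * (b₁ * b₂ * b₃ * b₄) * e2

lemma fourSum_rotate (q s A p₁ p₂ p₃ p₄ : ℂ) :
    fourSum q s A p₁ p₂ p₃ p₄ = fourSum q s A p₂ p₃ p₄ p₁ := by
  unfold fourSum
  congr 1; funext k
  rw [fourTerm_eq, fourTerm_eq]; ring

lemma tsum_sub_pred {g : ℤ → ℂ} (hg : Summable g) : ∑' k, (g k - g (k - 1)) = 0 := by
  rw [hg.tsum_sub (summable_int_pred hg), tsum_int_pred, sub_self]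

lemma norm_mul_q_lt_one (hq : ‖q‖ < 1) {w : ℂ} (hw : ‖w‖ < 1) : ‖w * q‖ < 1 := by
  rw [norm_mul]
  calc ‖w‖ * ‖q‖ ≤ 1 * ‖q‖ := by gcongr
    _ < 1 := by simpa using hq

/-- Contiguity of the four-parameter sum. -/
lemma fourSum_contiguous (hq0 : q ≠ 0) (hq : ‖q‖ < 1) {s A r₁ r₂ r₃ r₄ : ℂ} (hs : s ≠ 0)
    (hA : A ≠ 0) (h₁ : r₁ ≠ 0) (h₂ : r₂ ≠ 0) (h₃ : r₃ ≠ 0) (h₄ : r₄ ≠ 0)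
    (hw : ‖A ^ 2 / (r₁ * r₂ * r₃ * r₄)‖ < 1) :
    (1 - A ^ 2 / (r₁ * r₂ * r₃ * r₄)) * fourSum q s A (q * r₁) r₂ r₃ r₄ =
      (1 - A / (r₁ * r₂)) * (1 - A / (r₁ * r₃)) * (1 - A / (r₁ * r₄)) *
        fourSum q s A r₁ r₂ r₃ r₄ := by
  have hw1 : ‖A ^ 2 * q / (q * r₁ * r₂ * r₃ * r₄)‖ < 1 := by
    convert hw using 2; field_simp
  have hw2 : ‖A ^ 2 * q / (r₁ * r₂ * r₃ * r₄)‖ < 1 := by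
    convert norm_mul_q_lt_one hq hw using 2; ring
  have S1 := summable_fourTerm hq0 hq hs hA (mul_ne_zero hq0 h₁) h₂ h₃ h₄ hw1
  have S2 := summable_fourTerm hq0 hq hs hA h₁ h₂ h₃ h₄ hw2
  set g : ℤ → ℂ := fun k => pairTerm q (s * q / r₁) (A / (s * q * r₁)) k *
      pairTerm q (s * q / r₂) (A / (s * q * r₂)) k * pairTerm q (s * q / r₃) (A / (s * q * r₃)) k *
      pairTerm q (s * q / r₄) (A / (s * q * r₄)) k * (s ^ 4 * q ^ 4 / A ^ 2) ^ k with hg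
  have bd {r : ℂ} (hr : r ≠ 0) := geomBound_pairTerm hq0 hq (l := (⊤ : Filter Unit))
    (α := fun _ => s * q / r) (β := fun _ => A / (s * q * r)) tendsto_const_nhds tendsto_const_nhds
    (by simp [*]) (by simp [*])
  -- The telescoped sequence has rate A²/(r₁r₂r₃r₄) in both directions; it is summable, so no
  -- boundary term survives.
  have Sg : Summable g := by
    have hB := ((((bd h₁).mul (bd h₂)).mul (bd h₃)).mul (bd h₄)).mul
      (geomBound_zpow fun _ => s ^ 4 * q ^ 4 / A ^ 2)
    refine (hB.congr (Eventually.of_forall fun _ _ => rfl)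
      (u' := fun _ => A ^ 2 / (r₁ * r₂ * r₃ * r₄))
      (v' := fun _ => A ^ 2 / (r₁ * r₂ * r₃ * r₄)) ?_ ?_).summable hw hw
    · refine Eventually.of_forall fun _ => ?_
      field_simp
    · refine Eventually.of_forall fun _ => ?_
      field_simp
  have h0 := tsum_sub_pred Sg
  have pt := fun k => fourTerm_telescope hq0 hq hs hA h₁ h₂ h₃ h₄ k g fun _ => rfl
  simp only [pt] at h0
  rw [tsum_mul_left, (S1.mul_left _).tsum_sub (S2.mul_left _), tsum_mul_left, tsum_mul_left,
    mul_eq_zero] at h0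
  rcases h0 with h0 | h0
  · simp [hA, h₁, hs] at h0
  · exact sub_eq_zero.mp h0

/-- Carrying (A²q/(p₁p₂p₃p₄);q)_∞ along absorbs the coefficient of the raised sum, so the recursion
involves no division. -/
lemma fourSum_lower_first (hq0 : q ≠ 0) (hq : ‖q‖ < 1) {s A p₁ p₂ p₃ p₄ : ℂ} (hs : s ≠ 0)
    (hA : A ≠ 0) (h₁ : p₁ ≠ 0) (h₂ : p₂ ≠ 0) (h₃ : p₃ ≠ 0) (h₄ : p₄ ≠ 0)
    (hw : ‖A ^ 2 * q / (p₁ * p₂ * p₃ * p₄)‖ < 1) :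
    qPochInf q (A ^ 2 * q / (p₁ * p₂ * p₃ * p₄)) * fourSum q s A p₁ p₂ p₃ p₄ =
      (1 - A / (p₁ * p₂) * q) * (1 - A / (p₁ * p₃) * q) * (1 - A / (p₁ * p₄) * q) *
        (qPochInf q (A ^ 2 * q / (p₁ / q * p₂ * p₃ * p₄)) * fourSum q s A (p₁ / q) p₂ p₃ p₄) := by
  have e : A ^ 2 * q / (p₁ * p₂ * p₃ * p₄) = A ^ 2 / (p₁ / q * p₂ * p₃ * p₄) := by field_simp
  have h := fourSum_contiguous hq0 hq hs hA (div_ne_zero h₁ hq0) h₂ h₃ h₄ (by rwa [← e])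
  rw [mul_div_cancel₀ _ hq0] at h
  have e2 : A ^ 2 * q / (p₁ / q * p₂ * p₃ * p₄) = A ^ 2 / (p₁ / q * p₂ * p₃ * p₄) * q := by ring
  rw [qPochInf_eq_mul hq, e, mul_right_comm, h, e2]
  have e3 (p : ℂ) : A / (p₁ / q * p) = A / (p₁ * p) * q := by field_simp
  rw [e3, e3, e3]
  ring

/-- Each parameter is lowered once, with `fourSum_rotate` bringing the next one to the front. A pair
is affected twice, once through each member, which explains the two consecutive factors for every
pair. -/
lemma fourSum_lower_all (hq0 : q ≠ 0) (hq : ‖q‖ < 1) {s A p₁ p₂ p₃ p₄ : ℂ} (hs : s ≠ 0)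
    (hA : A ≠ 0) (h₁ : p₁ ≠ 0) (h₂ : p₂ ≠ 0) (h₃ : p₃ ≠ 0) (h₄ : p₄ ≠ 0)
    (hw : ‖A ^ 2 * q / (p₁ * p₂ * p₃ * p₄)‖ < 1) :
    qPochInf q (A ^ 2 * q / (p₁ * p₂ * p₃ * p₄)) * fourSum q s A p₁ p₂ p₃ p₄ =
      ((1 - A * q / (p₁ * p₂)) * (1 - A * q / (p₁ * p₂) * q)) *
      ((1 - A * q / (p₁ * p₃)) * (1 - A * q / (p₁ * p₃) * q)) *
      ((1 - A * q / (p₁ * p₄)) * (1 - A * q / (p₁ * p₄) * q)) *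
      ((1 - A * q / (p₂ * p₃)) * (1 - A * q / (p₂ * p₃) * q)) *
      ((1 - A * q / (p₂ * p₄)) * (1 - A * q / (p₂ * p₄) * q)) *
      ((1 - A * q / (p₃ * p₄)) * (1 - A * q / (p₃ * p₄) * q)) *
        (qPochInf q (A ^ 2 * q / (p₁ / q * (p₂ / q) * (p₃ / q) * (p₄ / q))) *
          fourSum q s A (p₁ / q) (p₂ / q) (p₃ / q) (p₄ / q)) := by
  have hw1 := norm_mul_q_lt_one hq hw
  have hw2 := norm_mul_q_lt_one hq hw1
  have hw3 := norm_mul_q_lt_one hq hw2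
  have e1 : A ^ 2 * q / (p₂ * p₃ * p₄ * (p₁ / q)) = A ^ 2 * q / (p₁ * p₂ * p₃ * p₄) * q := by
    field_simp
  have e1' : A ^ 2 * q / (p₁ / q * p₂ * p₃ * p₄) = A ^ 2 * q / (p₁ * p₂ * p₃ * p₄) * q := by
    field_simp
  have e2 : A ^ 2 * q / (p₃ * p₄ * (p₁ / q) * (p₂ / q)) =
      A ^ 2 * q / (p₁ * p₂ * p₃ * p₄) * q * q := by field_simp
  have e2' : A ^ 2 * q / (p₂ / q * p₃ * p₄ * (p₁ / q)) =
      A ^ 2 * q / (p₁ * p₂ * p₃ * p₄) * q * q := by field_simp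
  have e3 : A ^ 2 * q / (p₄ * (p₁ / q) * (p₂ / q) * (p₃ / q)) =
      A ^ 2 * q / (p₁ * p₂ * p₃ * p₄) * q * q * q := by field_simp
  have e3' : A ^ 2 * q / (p₃ / q * p₄ * (p₁ / q) * (p₂ / q)) =
      A ^ 2 * q / (p₁ * p₂ * p₃ * p₄) * q * q * q := by field_simp
  have e4 : p₄ / q * (p₁ / q) * (p₂ / q) * (p₃ / q) = p₁ / q * (p₂ / q) * (p₃ / q) * (p₄ / q) := by
    ring
  have k1 := fourSum_lower_first hq0 hq hs hA h₁ h₂ h₃ h₄ hw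
  have k2 := fourSum_lower_first hq0 hq hs hA h₂ h₃ h₄ (div_ne_zero h₁ hq0) (by rwa [e1])
  have k3 := fourSum_lower_first hq0 hq hs hA h₃ h₄ (div_ne_zero h₁ hq0) (div_ne_zero h₂ hq0)
    (by rwa [e2])
  have k4 := fourSum_lower_first hq0 hq hs hA h₄ (div_ne_zero h₁ hq0) (div_ne_zero h₂ hq0)
    (div_ne_zero h₃ hq0) (by rwa [e3])
  rw [e1, e2'] at k2
  rw [e2, e3'] at k3
  rw [e3, e4] at k4
  rw [k1, e1', fourSum_rotate, k2, fourSum_rotate, k3, fourSum_rotate, k4,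
    fourSum_rotate q s A (p₄ / q)]
  have f (x y : ℂ) : A / (x * (y / q)) * q = A * q / (x * y) * q := by field_simp
  have f' (x y : ℂ) : A / (x * y) * q = A * q / (x * y) := by ring
  simp only [f]
  rw [mul_comm p₂ p₁, mul_comm p₃ p₁, mul_comm p₃ p₂, mul_comm p₄ p₁, mul_comm p₄ p₂,
    mul_comm p₄ p₃]
  simp only [f' p₁ p₂, f' p₁ p₃, f' p₁ p₄, f' p₂ p₃, f' p₂ p₄, f' p₃ p₄]
  generalize 1 - A * q / (p₁ * p₂) * q = x1
  generalize 1 - A * q / (p₁ * p₂) = x2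
  generalize 1 - A * q / (p₁ * p₃) * q = x3
  generalize 1 - A * q / (p₁ * p₃) = x4
  generalize 1 - A * q / (p₁ * p₄) * q = x5
  generalize 1 - A * q / (p₁ * p₄) = x6
  generalize 1 - A * q / (p₂ * p₃) * q = x7
  generalize 1 - A * q / (p₂ * p₃) = x8
  generalize 1 - A * q / (p₂ * p₄) * q = x9
  generalize 1 - A * q / (p₂ * p₄) = x10
  generalize 1 - A * q / (p₃ * p₄) * q = x11
  generalize 1 - A * q / (p₃ * p₄) = x12
  ring

/-- In m rounds each product p_i p_j loses q^{2m} and the product of all four loses q^{4m}; hence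
the lengths of the finite products and the exponent 4m. -/
lemma fourSum_iterate (hq0 : q ≠ 0) (hq : ‖q‖ < 1) {s A p₁ p₂ p₃ p₄ : ℂ} (hs : s ≠ 0)
    (hA : A ≠ 0) (h₁ : p₁ ≠ 0) (h₂ : p₂ ≠ 0) (h₃ : p₃ ≠ 0) (h₄ : p₄ ≠ 0)
    (hw : ‖A ^ 2 * q / (p₁ * p₂ * p₃ * p₄)‖ < 1) (m : ℕ) :
    qPochInf q (A ^ 2 * q / (p₁ * p₂ * p₃ * p₄)) * fourSum q s A p₁ p₂ p₃ p₄ =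
      (∏ n ∈ Finset.range (2 * m), (1 - A * q / (p₁ * p₂) * q ^ n)) *
      (∏ n ∈ Finset.range (2 * m), (1 - A * q / (p₁ * p₃) * q ^ n)) *
      (∏ n ∈ Finset.range (2 * m), (1 - A * q / (p₁ * p₄) * q ^ n)) *
      (∏ n ∈ Finset.range (2 * m), (1 - A * q / (p₂ * p₃) * q ^ n)) *
      (∏ n ∈ Finset.range (2 * m), (1 - A * q / (p₂ * p₄) * q ^ n)) *
      (∏ n ∈ Finset.range (2 * m), (1 - A * q / (p₃ * p₄) * q ^ n)) *
        (qPochInf q (A ^ 2 * q / (p₁ * p₂ * p₃ * p₄) * q ^ (4 * m)) *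
          fourSum q s A (p₁ / q ^ m) (p₂ / q ^ m) (p₃ / q ^ m) (p₄ / q ^ m)) := by
  induction m with
  | zero => simp
  | succ m ih =>
    have hm : q ^ m ≠ 0 := pow_ne_zero _ hq0
    have e0 : A ^ 2 * q / (p₁ / q ^ m * (p₂ / q ^ m) * (p₃ / q ^ m) * (p₄ / q ^ m)) =
        A ^ 2 * q / (p₁ * p₂ * p₃ * p₄) * q ^ (4 * m) := by
      rw [mul_comm 4 m, pow_mul]; field_simp
    have e1 : A ^ 2 * q / (p₁ / q ^ m / q * (p₂ / q ^ m / q) * (p₃ / q ^ m / q) * (p₄ / q ^ m / q)) =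
        A ^ 2 * q / (p₁ * p₂ * p₃ * p₄) * q ^ (4 * (m + 1)) := by
      rw [mul_comm 4 (m + 1), pow_mul, pow_succ]; field_simp; ring
    have hlt : ‖A ^ 2 * q / (p₁ / q ^ m * (p₂ / q ^ m) * (p₃ / q ^ m) * (p₄ / q ^ m))‖ < 1 := by
      rw [e0, norm_mul, norm_pow]
      exact mul_lt_one_of_nonneg_of_lt_one_left (norm_nonneg _) hw
        (pow_le_one₀ (norm_nonneg _) hq.le)
    have h := fourSum_lower_all hq0 hq hs hA (div_ne_zero h₁ hm) (div_ne_zero h₂ hm)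
      (div_ne_zero h₃ hm) (div_ne_zero h₄ hm) hlt
    have f (x y : ℂ) : A * q / (x / q ^ m * (y / q ^ m)) = A * q / (x * y) * q ^ (2 * m) := by
      rw [mul_comm 2 m, pow_mul]; field_simp
    have f' (x : ℂ) : x * q ^ (2 * m) * q = x * q ^ (2 * m + 1) := by rw [pow_succ]; ring
    have d (x : ℂ) : x / q ^ m / q = x / q ^ (m + 1) := by rw [div_div, ← pow_succ]
    rw [e0, e1] at h
    simp only [f, f', d] at h
    rw [ih, h, show 2 * (m + 1) = 2 * m + 1 + 1 by ring]
    simp only [Finset.prod_range_succ _ (2 * m + 1), Finset.prod_range_succ _ (2 * m)]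
    generalize 1 - A * q / (p₁ * p₂) * q ^ (2 * m) = x1
    generalize 1 - A * q / (p₁ * p₂) * q ^ (2 * m + 1) = x2
    generalize 1 - A * q / (p₁ * p₃) * q ^ (2 * m) = x3
    generalize 1 - A * q / (p₁ * p₃) * q ^ (2 * m + 1) = x4
    generalize 1 - A * q / (p₁ * p₄) * q ^ (2 * m) = x5
    generalize 1 - A * q / (p₁ * p₄) * q ^ (2 * m + 1) = x6
    generalize 1 - A * q / (p₂ * p₃) * q ^ (2 * m) = x7
    generalize 1 - A * q / (p₂ * p₃) * q ^ (2 * m + 1) = x8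
    generalize 1 - A * q / (p₂ * p₄) * q ^ (2 * m) = x9
    generalize 1 - A * q / (p₂ * p₄) * q ^ (2 * m + 1) = x10
    generalize 1 - A * q / (p₃ * p₄) * q ^ (2 * m) = x11
    generalize 1 - A * q / (p₃ * p₄) * q ^ (2 * m + 1) = x12
    ring

lemma tendsto_pairTerm_degenerate (hq : ‖q‖ < 1) (α β : ℂ) (k : ℤ) :
    Tendsto (fun m : ℕ => pairTerm q (α * q ^ m) (β * q ^ m) k) atTop (𝓝 (gauss q k)) := by
  have := tendsto_pairTerm hq (tendsto_mul_pow_zero hq α) (tendsto_mul_pow_zero hq β) k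
  simpa [pairTerm] using this

/-- As the parameters go to infinity both arguments of every `pairTerm` go to 0, leaving only the
Gaussian weight. Their norms never exceed those at m = 0, so the bound at the initial radii
dominates the whole sequence. -/
lemma tendsto_fourSum (hq0 : q ≠ 0) (hq : ‖q‖ < 1) {s A p₁ p₂ p₃ p₄ : ℂ} (hs : s ≠ 0)
    (hA : A ≠ 0) (h₁ : p₁ ≠ 0) (h₂ : p₂ ≠ 0) (h₃ : p₃ ≠ 0) (h₄ : p₄ ≠ 0)
    (hw : ‖A ^ 2 * q / (p₁ * p₂ * p₃ * p₄)‖ < 1) :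
    Tendsto (fun m : ℕ => fourSum q s A (p₁ / q ^ m) (p₂ / q ^ m) (p₃ / q ^ m) (p₄ / q ^ m)) atTop
      (𝓝 (∑' k : ℤ, (1 - s ^ 2 / A * q ^ (2 * k)) * (gauss q k * gauss q k * gauss q k * gauss q k) *
        (s ^ 4 * q / A ^ 2) ^ k)) := by
  have d1 (p : ℂ) (m : ℕ) : s * q / (p / q ^ m) = s * q / p * q ^ m := by rw [div_div_eq_mul_div]; ring
  have d2 (p : ℂ) (m : ℕ) : A / (s * (p / q ^ m)) = A / (s * p) * q ^ m := by
    rw [mul_div_assoc', div_div_eq_mul_div]; ring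
  simp only [fourSum, fourTerm_eq, d1, d2]
  have bd {p : ℂ} (hp : p ≠ 0) : GeomBound (atTop : Filter ℕ)
      (fun m k => pairTerm q (s * q / p * q ^ m) (A / (s * p) * q ^ m) k)
      (fun _ => A / (s * p)) (fun _ => s * q / p) := by
    refine ⟨pairConst q ‖s * q / p‖ ‖A / (s * p)‖, (Real.exp_pos _).le,
      Eventually.of_forall fun m k => ?_⟩
    have hle (x : ℂ) : ‖x * q ^ m‖ ≤ ‖x‖ := by
      rw [norm_mul, norm_pow]
      exact mul_le_of_le_one_right (norm_nonneg _) (pow_le_one₀ (norm_nonneg _) hq.le)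
    exact norm_pairTerm_le hq0 hq (norm_pos_iff.mpr (by simp [*])) (norm_pos_iff.mpr (by simp [*]))
      (hle _) (hle _) k
  have hB := ((geomBound_one_sub hq0 hq (l := (atTop : Filter ℕ)) (c := fun _ => s ^ 2 / A)
    tendsto_const_nhds).mul ((((bd h₁).mul (bd h₂)).mul (bd h₃)).mul (bd h₄))).mul
    (geomBound_zpow fun _ => s ^ 4 * q / A ^ 2)
  refine (hB.congr (Eventually.of_forall fun _ _ => rfl)
    (u' := fun _ => A ^ 2 * q / (p₁ * p₂ * p₃ * p₄))
    (v' := fun _ => A ^ 2 * q / (p₁ * p₂ * p₃ * p₄)) ?_ ?_).tendsto_tsum tendsto_const_nhds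
      tendsto_const_nhds hw hw fun k => ?_
  · exact Eventually.of_forall fun _ => by field_simp
  · exact Eventually.of_forall fun _ => by field_simp
  · have t (p : ℂ) := tendsto_pairTerm_degenerate hq (s * q / p) (A / (s * p)) k
    exact ((((t p₁).mul (t p₂)).mul (t p₃)).mul (t p₄)).const_mul _ |>.mul_const _

/-- Splitting the integers by parity. -/
def intParity : ℤ ⊕ ℤ ≃ ℤ where
  toFun := Sum.elim (fun k => 2 * k) (fun k => 2 * k + 1)
  invFun n := if n % 2 = 0 then Sum.inl (n / 2) else Sum.inr (n / 2)
  left_inv := by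
    rintro (k | k)
    · have h : 2 * k % 2 = 0 := by omega
      simp only [Sum.elim_inl, h, if_true, Sum.inl.injEq]
      omega
    · have h : ¬ (2 * k + 1) % 2 = 0 := by omega
      simp only [Sum.elim_inr, h, if_false, Sum.inr.injEq]
      omega
  right_inv := by
    intro n
    by_cases h : n % 2 = 0
    · simp only [h, if_true, Sum.elim_inl]; omega
    · simp only [h, if_false, Sum.elim_inr]; omega

lemma gauss_two_mul (hq0 : q ≠ 0) (k : ℤ) :
    gauss q (2 * k) = gauss q k * gauss q k * gauss q k * gauss q k * q ^ k := by
  have h1 : 2 * k * (2 * k - 1) / 2 = k * (k - 1) / 2 * 2 + k * (k - 1) / 2 * 2 + k := by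
    obtain ⟨t, ht⟩ := (Int.even_mul_pred_self k).two_dvd
    rw [mul_assoc, Int.mul_ediv_cancel_left _ two_ne_zero, ht,
      Int.mul_ediv_cancel_left _ two_ne_zero]
    linarith
  have h2 : ((-1 : ℂ) ^ k) * ((-1 : ℂ) ^ k) = 1 := by rw [← mul_zpow]; simp
  have h3 : (-1 : ℂ) ^ (2 * k) = 1 := by rw [zpow_mul]; simp
  rw [gauss, gauss, h1, zpow_add₀ hq0, zpow_add₀ hq0, mul_two, zpow_add₀ hq0, h3]
  linear_combination -(((-1 : ℂ) ^ k) * ((-1 : ℂ) ^ k) + 1) * (q ^ (k * (k - 1) / 2)) ^ 4 *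
    q ^ k * h2

/-- The terms 2k and 2k + 1 of the Jacobi series add up to the k-th term here, because the Gaussian
weight at 2k is q^k times the fourth power of the weight at k. -/
lemma tsum_gauss_four (hq0 : q ≠ 0) (hq : ‖q‖ < 1) {v : ℂ} (hv : v ≠ 0) :
    ∑' k : ℤ, (1 - v * q ^ (2 * k)) * (gauss q k * gauss q k * gauss q k * gauss q k) *
        (v ^ 2 * q) ^ k = qPochInf q q * thetaProd q v := by
  have hs := (summable_gauss hq0 hq v hv).1
  have hs' := intParity.summable_iff.mpr hs
  have h1 := hs'.comp_injective Sum.inl_injective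
  have h2 := hs'.comp_injective Sum.inr_injective
  have h3 := Summable.tsum_sum h1 h2
  have h4 := intParity.tsum_eq fun k : ℤ => gauss q k * v ^ k
  simp only [Function.comp_def] at h1 h2 h3
  rw [← tsum_gauss_eq hq0 hq hv, ← h4, h3, ← h1.tsum_add h2]
  congr 1; funext k
  simp only [intParity, Equiv.coe_fn_mk, Sum.elim_inl, Sum.elim_inr]
  rw [gauss_succ hq0, gauss_two_mul hq0, zpow_add_one₀ hv, mul_zpow, ← zpow_natCast v 2,
    ← zpow_mul]
  push_cast
  ring

/-- Bailey's very-well-poised bilateral sum with four parameters. -/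
theorem fourSum_eq (hq0 : q ≠ 0) (hq : ‖q‖ < 1) {s A p₁ p₂ p₃ p₄ : ℂ} (hs : s ≠ 0)
    (hA : A ≠ 0) (h₁ : p₁ ≠ 0) (h₂ : p₂ ≠ 0) (h₃ : p₃ ≠ 0) (h₄ : p₄ ≠ 0)
    (hw : ‖A ^ 2 * q / (p₁ * p₂ * p₃ * p₄)‖ < 1) :
    qPochInf q (A ^ 2 * q / (p₁ * p₂ * p₃ * p₄)) * fourSum q s A p₁ p₂ p₃ p₄ =
      qPochInf q (A * q / (p₁ * p₂)) * qPochInf q (A * q / (p₁ * p₃)) *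
      qPochInf q (A * q / (p₁ * p₄)) * qPochInf q (A * q / (p₂ * p₃)) *
      qPochInf q (A * q / (p₂ * p₄)) * qPochInf q (A * q / (p₃ * p₄)) *
      (qPochInf q q * thetaProd q (s ^ 2 / A)) := by
  have h2m : Tendsto (fun m : ℕ => 2 * m) atTop atTop :=
    tendsto_id.const_mul_atTop' (r := 2) (by norm_num)
  have h4m : Tendsto (fun m : ℕ => 4 * m) atTop atTop :=
    tendsto_id.const_mul_atTop' (r := 4) (by norm_num)
  have t (x : ℂ) := (tendsto_prod_qPochInf hq x).comp h2m
  have t4 := (tendsto_qPochInf_mul_pow hq (A ^ 2 * q / (p₁ * p₂ * p₃ * p₄))).comp h4m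
  have T := tendsto_fourSum hq0 hq hs hA h₁ h₂ h₃ h₄ hw
  have key := ((((((t (A * q / (p₁ * p₂))).mul (t (A * q / (p₁ * p₃)))).mul
    (t (A * q / (p₁ * p₄)))).mul (t (A * q / (p₂ * p₃)))).mul (t (A * q / (p₂ * p₄)))).mul
    (t (A * q / (p₃ * p₄)))).mul (t4.mul T)
  have e : s ^ 4 * q / A ^ 2 = (s ^ 2 / A) ^ 2 * q := by ring
  rw [e, tsum_gauss_four hq0 hq (div_ne_zero (pow_ne_zero 2 hs) hA), one_mul] at key
  refine tendsto_nhds_unique (tendsto_const_nhds.congr fun m => ?_) key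
  exact fourSum_iterate hq0 hq hs hA h₁ h₂ h₃ h₄ hw m

/-! ### Contiguity of the balanced six-parameter sum -/

/-- The parameters r₁, …, r₄ enter only through their elementary symmetric functions. The first
three are free variables here, and the fourth is fixed by the balancing condition. -/
lemma balanced_bracket {z y r₅ r₆ : ℂ} (E₁ E₂ E₃ : ℂ) (hz : z ≠ 0) (h₅ : r₅ ≠ 0) (h₆ : r₆ ≠ 0) :
    r₅ * r₆ * (r₅ - r₆) *
      ((1 - E₁ * (y / z) + E₂ * (y / z) ^ 2 - E₃ * (y / z) ^ 3 +
          z ^ 3 / (r₅ * r₆) * (y / z) ^ 4) * (1 - y * r₅ / z) * (1 - y * r₆ / z) -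
        (1 + (-E₃ * y + E₂ * y ^ 2 - E₁ * y ^ 3 + y ^ 4) * (r₅ * r₆) / z ^ 3) *
          (1 - y / r₅) * (1 - y / r₆)) =
    y * (1 - y ^ 2 / z) *
      (r₅ ^ 2 * (1 - E₁ * (r₆ / z) + E₂ * (r₆ / z) ^ 2 - E₃ * (r₆ / z) ^ 3 +
          z ^ 3 / (r₅ * r₆) * (r₆ / z) ^ 4) * (1 - y / r₅) * (1 - y * r₅ / z) -
        r₆ ^ 2 * (1 - E₁ * (r₅ / z) + E₂ * (r₅ / z) ^ 2 - E₃ * (r₅ / z) ^ 3 +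
          z ^ 3 / (r₅ * r₆) * (r₅ / z) ^ 4) * (1 - y / r₆) * (1 - y * r₆ / z)) := by
  field_simp
  ring

/-- The difference of the two products has no constant term, and by balancing no term of degree 6;
it also vanishes at y² = z. Dividing by y(1 - y²/z) leaves a quadratic invariant under y ↦ z/y up to
its weight, hence a combination of the two quadratics belonging to r₅ and r₆. Evaluation at y = r₅
and y = r₆ gives the coefficients. -/
lemma balanced_six {z y r₁ r₂ r₃ r₄ r₅ r₆ : ℂ} (hz : z ≠ 0) (h₁ : r₁ ≠ 0) (h₂ : r₂ ≠ 0)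
    (h₃ : r₃ ≠ 0) (h₄ : r₄ ≠ 0) (h₅ : r₅ ≠ 0) (h₆ : r₆ ≠ 0)
    (h : r₁ * r₂ * r₃ * r₄ * r₅ * r₆ = z ^ 3) :
    r₅ * r₆ * (r₅ - r₆) *
      ((1 - y * r₁ / z) * (1 - y * r₂ / z) * (1 - y * r₃ / z) * (1 - y * r₄ / z) *
          (1 - y * r₅ / z) * (1 - y * r₆ / z) -
        (1 - y / r₁) * (1 - y / r₂) * (1 - y / r₃) * (1 - y / r₄) * (1 - y / r₅) * (1 - y / r₆)) =
    y * (1 - y ^ 2 / z) *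
      (r₅ ^ 2 * ((1 - r₆ * r₁ / z) * (1 - r₆ * r₂ / z) * (1 - r₆ * r₃ / z) * (1 - r₆ * r₄ / z)) *
          (1 - y / r₅) * (1 - y * r₅ / z) -
        r₆ ^ 2 * ((1 - r₅ * r₁ / z) * (1 - r₅ * r₂ / z) * (1 - r₅ * r₃ / z) * (1 - r₅ * r₄ / z)) *
          (1 - y / r₆) * (1 - y * r₆ / z)) := by
  have key := balanced_bracket (y := y) (r₁ + r₂ + r₃ + r₄)
    (r₁ * r₂ + r₁ * r₃ + r₁ * r₄ + r₂ * r₃ + r₂ * r₄ + r₃ * r₄)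
    (r₁ * r₂ * r₃ + r₁ * r₂ * r₄ + r₁ * r₃ * r₄ + r₂ * r₃ * r₄) hz h₅ h₆
  have e4 : z ^ 3 / (r₅ * r₆) = r₁ * r₂ * r₃ * r₄ := by
    rw [← h]; field_simp
  have e4' (X : ℂ) : X * (r₅ * r₆) / z ^ 3 = X / (r₁ * r₂ * r₃ * r₄) := by
    rw [← h]; field_simp
  have pol (x : ℂ) : (1 - x * r₁ / z) * (1 - x * r₂ / z) * (1 - x * r₃ / z) * (1 - x * r₄ / z) =
      1 - (r₁ + r₂ + r₃ + r₄) * (x / z) +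
      (r₁ * r₂ + r₁ * r₃ + r₁ * r₄ + r₂ * r₃ + r₂ * r₄ + r₃ * r₄) * (x / z) ^ 2 -
      (r₁ * r₂ * r₃ + r₁ * r₂ * r₄ + r₁ * r₃ * r₄ + r₂ * r₃ * r₄) * (x / z) ^ 3 +
      r₁ * r₂ * r₃ * r₄ * (x / z) ^ 4 := by ring
  have pol' : (1 - y / r₁) * (1 - y / r₂) * (1 - y / r₃) * (1 - y / r₄) =
      1 + (-(r₁ * r₂ * r₃ + r₁ * r₂ * r₄ + r₁ * r₃ * r₄ + r₂ * r₃ * r₄) * y +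
        (r₁ * r₂ + r₁ * r₃ + r₁ * r₄ + r₂ * r₃ + r₂ * r₄ + r₃ * r₄) * y ^ 2 -
        (r₁ + r₂ + r₃ + r₄) * y ^ 3 + y ^ 4) / (r₁ * r₂ * r₃ * r₄) := by
    field_simp
    ring
  rw [e4, e4', ← pol, ← pol, ← pol, ← pol'] at key
  exact key

/-- Two raised terms replace the raised and the unraised term of the four-parameter case: raising r₅
or r₆ multiplies the common factors by the corresponding quadratic of `balanced_six`. -/
lemma sixTerm_telescope (hq0 : q ≠ 0) (hq : ‖q‖ < 1) {s z r₁ r₂ r₃ r₄ r₅ r₆ : ℂ} (hs : s ≠ 0)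
    (hz : z ≠ 0) (h₁ : r₁ ≠ 0) (h₂ : r₂ ≠ 0) (h₃ : r₃ ≠ 0) (h₄ : r₄ ≠ 0) (h₅ : r₅ ≠ 0)
    (h₆ : r₆ ≠ 0) (h : r₁ * r₂ * r₃ * r₄ * r₅ * r₆ = z ^ 3) (k : ℤ)
    (g : ℤ → ℂ) (hg : ∀ k, g k = pairTerm q (s * q / r₁) (z / (s * q * r₁)) k *
      pairTerm q (s * q / r₂) (z / (s * q * r₂)) k * pairTerm q (s * q / r₃) (z / (s * q * r₃)) k *
      pairTerm q (s * q / r₄) (z / (s * q * r₄)) k * pairTerm q (s * q / r₅) (z / (s * q * r₅)) k *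
      pairTerm q (s * q / r₆) (z / (s * q * r₆)) k * (s ^ 6 * q ^ 6 / z ^ 3) ^ k) :
    -(s ^ 4 / z ^ 2 * (r₅ * r₆ * (r₅ - r₆)) * (g k - g (k - 1))) =
      r₅ ^ 3 * ((1 - r₆ * r₁ / z) * (1 - r₆ * r₂ / z) * (1 - r₆ * r₃ / z) * (1 - r₆ * r₄ / z)) *
        sixTerm q s z r₁ r₂ r₃ r₄ (q * r₅) r₆ k -
      r₆ ^ 3 * ((1 - r₅ * r₁ / z) * (1 - r₅ * r₂ / z) * (1 - r₅ * r₃ / z) * (1 - r₅ * r₄ / z)) *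
        sixTerm q s z r₁ r₂ r₃ r₄ r₅ (q * r₆) k := by
  have hQ := zpow_ne_zero k hq0
  rw [hg, hg, sixTerm_eq, sixTerm_eq, pairTerm_raise hq0 hq, pairTerm_raise hq0 hq]
  simp only [pairTerm_lower_right_pred hq0 hq]
  simp only [pairTerm_lower_right hq0 hq]
  generalize pairTerm q (s * q / r₁) (z / (s * r₁)) k = H₁
  generalize pairTerm q (s * q / r₂) (z / (s * r₂)) k = H₂
  generalize pairTerm q (s * q / r₃) (z / (s * r₃)) k = H₃
  generalize pairTerm q (s * q / r₄) (z / (s * r₄)) k = H₄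
  generalize pairTerm q (s * q / r₅) (z / (s * r₅)) k = H₅
  generalize pairTerm q (s * q / r₆) (z / (s * r₆)) k = H₆
  have hW0 : s ^ 6 * q ^ 6 / z ^ 3 ≠ 0 := by simp [*]
  have hW : (s ^ 6 * q ^ 6 / z ^ 3) ^ k = (s ^ 6 * q ^ 2 / z ^ 3) ^ k * (q ^ k) ^ 4 := by
    rw [show s ^ 6 * q ^ 6 / z ^ 3 = s ^ 6 * q ^ 2 / z ^ 3 * q ^ 4 by ring, mul_zpow]
    congr 1
    rw [← zpow_natCast (q ^ k), ← zpow_natCast q, ← zpow_mul, ← zpow_mul, mul_comm]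
  rw [zpow_sub₀ hW0, zpow_one, hW, two_mul, zpow_add₀ hq0]
  generalize (s ^ 6 * q ^ 2 / z ^ 3) ^ k = w
  generalize q ^ k = Q at *
  have hy : s * Q ≠ 0 := mul_ne_zero hs hQ
  have e : w * Q ^ 4 / (s ^ 6 * q ^ 6 / z ^ 3) = w * (z ^ 3 / (s ^ 6 * Q ^ 2)) * (Q / q) ^ 6 := by
    field_simp
  have e6 : (q / Q) ^ 6 * (Q / q) ^ 6 = 1 := by field_simp
  have e7 : 1 - s ^ 2 / z * (Q * Q) = 1 - (s * Q) ^ 2 / z := by ring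
  have key := balanced_six (y := s * Q) hz h₁ h₂ h₃ h₄ h₅ h₆ h
  have fl (r : ℂ) (hr : r ≠ 0) : s * Q * r / z * (1 - z / (s * Q * r)) = -(1 - s * Q * r / z) := by
    field_simp
    ring
  have f₁ := fl r₁ h₁
  have f₂ := fl r₂ h₂
  have f₃ := fl r₃ h₃
  have f₄ := fl r₄ h₄
  have f₅ := fl r₅ h₅
  have f₆ := fl r₆ h₆
  have pz : (s * Q * r₁ / z) * (s * Q * r₂ / z) * (s * Q * r₃ / z) * (s * Q * r₄ / z) *
      (s * Q * r₅ / z) * (s * Q * r₆ / z) * (z ^ 3 / (s ^ 6 * Q ^ 2)) = Q ^ 4 := by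
    field_simp
    linear_combination h
  have pz' : (1 - z / (s * Q * r₁)) * (1 - z / (s * Q * r₂)) * (1 - z / (s * Q * r₃)) *
      (1 - z / (s * Q * r₄)) * (1 - z / (s * Q * r₅)) * (1 - z / (s * Q * r₆)) * Q ^ 4 =
      z ^ 3 / (s ^ 6 * Q ^ 2) * ((1 - s * Q * r₁ / z) * (1 - s * Q * r₂ / z) * (1 - s * Q * r₃ / z) *
      (1 - s * Q * r₄ / z) * (1 - s * Q * r₅ / z) * (1 - s * Q * r₆ / z)) := by
    rw [← pz]
    generalize z ^ 3 / (s ^ 6 * Q ^ 2) = c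
    have := congrArg₂ (· * ·) (congrArg₂ (· * ·) f₁ f₂) (congrArg₂ (· * ·) (congrArg₂ (· * ·) f₃ f₄)
      (congrArg₂ (· * ·) f₅ f₆))
    generalize 1 - z / (s * Q * r₁) = a₁ at *
    generalize 1 - z / (s * Q * r₂) = a₂ at *
    generalize 1 - z / (s * Q * r₃) = a₃ at *
    generalize 1 - z / (s * Q * r₄) = a₄ at *
    generalize 1 - z / (s * Q * r₅) = a₅ at *
    generalize 1 - z / (s * Q * r₆) = a₆ at *
    generalize 1 - s * Q * r₁ / z = b₁ at *
    generalize 1 - s * Q * r₂ / z = b₂ at *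
    generalize 1 - s * Q * r₃ / z = b₃ at *
    generalize 1 - s * Q * r₄ / z = b₄ at *
    generalize 1 - s * Q * r₅ / z = b₅ at *
    generalize 1 - s * Q * r₆ / z = b₆ at *
    linear_combination c * this
  have n5 : s ^ 4 / z ^ 2 * (z ^ 3 / (s ^ 6 * Q ^ 2)) * (s * Q) * (s * Q * r₅ / z) = r₅ := by
    field_simp
  have n6 : s ^ 4 / z ^ 2 * (z ^ 3 / (s ^ 6 * Q ^ 2)) * (s * Q) * (s * Q * r₆ / z) = r₆ := by
    field_simp
  rw [e, e7]
  generalize z ^ 3 / (s ^ 6 * Q ^ 2) = Y at *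
  generalize s * Q * r₅ / z = y₅ at *
  generalize s * Q * r₆ / z = y₆ at *
  generalize s ^ 4 / z ^ 2 = X at *
  generalize q / Q = t at *
  generalize Q / q = t' at *
  generalize Q ^ 4 = Q4 at *
  generalize 1 - (s * Q) ^ 2 / z = v at *
  generalize 1 - z / (s * Q * r₁) = a₁ at *
  generalize 1 - z / (s * Q * r₂) = a₂ at *
  generalize 1 - z / (s * Q * r₃) = a₃ at *
  generalize 1 - z / (s * Q * r₄) = a₄ at *
  generalize 1 - z / (s * Q * r₅) = a₅ at *
  generalize 1 - z / (s * Q * r₆) = a₆ at *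
  generalize (1 - r₆ * r₁ / z) * (1 - r₆ * r₂ / z) * (1 - r₆ * r₃ / z) * (1 - r₆ * r₄ / z) = Lam at *
  generalize (1 - r₅ * r₁ / z) * (1 - r₅ * r₂ / z) * (1 - r₅ * r₃ / z) * (1 - r₅ * r₄ / z) = Mu at *
  generalize 1 - s * Q / r₁ = c₁ at *
  generalize 1 - s * Q / r₂ = c₂ at *
  generalize 1 - s * Q / r₃ = c₃ at *
  generalize 1 - s * Q / r₄ = c₄ at *
  generalize 1 - s * Q / r₅ = c₅ at *
  generalize 1 - s * Q / r₆ = c₆ at *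
  generalize (1 - s * Q * r₁ / z) * (1 - s * Q * r₂ / z) * (1 - s * Q * r₃ / z) *
      (1 - s * Q * r₄ / z) = D at *
  generalize s * Q = y at *
  generalize hH : H₁ * H₂ * H₃ * H₄ * H₅ * H₆ = HH
  have main : -(X * (r₅ * r₆ * (r₅ - r₆)) * (a₁ * a₂ * a₃ * a₄ * a₅ * a₆ * Q4 -
      Y * (c₁ * c₂ * c₃ * c₄ * c₅ * c₆))) = v * (r₅ ^ 3 * Lam * c₅ * a₅ - r₆ ^ 3 * Mu * c₆ * a₆) := by
    linear_combination (-(X * (r₅ * r₆ * (r₅ - r₆)))) * pz' - X * Y * key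
      + X * Y * y * v * r₆ ^ 2 * Mu * c₆ * f₆ - X * Y * y * v * r₅ ^ 2 * Lam * c₅ * f₅ +
      v * r₅ ^ 2 * Lam * c₅ * a₅ * n5 - v * r₆ ^ 2 * Mu * c₆ * a₆ * n6
  linear_combination (w * H₁ * H₂ * H₃ * H₄ * H₅ * H₆) * main +
    X * (r₅ * r₆ * (r₅ - r₆)) * w * Y * H₁ * H₂ * H₃ * H₄ * H₅ * H₆ *
      (c₁ * c₂ * c₃ * c₄ * c₅ * c₆) * e6

/-- Only the differences are summable here; g itself may have a nonzero limit at +∞, and that limit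
is the value of the sum. -/
lemma tsum_int_telescope {g : ℤ → ℂ} {G : ℂ} (hneg : ∀ k < 0, g k = 0)
    (hG : Tendsto (fun n : ℕ => g n) atTop (𝓝 G)) (hS : Summable fun k => g k - g (k - 1)) :
    ∑' k, (g k - g (k - 1)) = G := by
  have hsupp : Function.support (fun k => g k - g (k - 1)) ⊆ Set.range ((↑) : ℕ → ℤ) := by
    intro k hk
    by_contra hc
    have hk0 : k < 0 := by
      by_contra h0
      exact hc ⟨k.toNat, Int.toNat_of_nonneg (not_lt.mp h0)⟩
    exact hk (by simp [hneg k hk0, hneg (k - 1) (by omega)])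
  have h1 := (hS.comp_injective (Nat.cast_injective (R := ℤ))).hasSum.tendsto_sum_nat
  have h2 (n : ℕ) : ∑ i ∈ Finset.range (n + 1), (g i - g ((i : ℤ) - 1)) = g n := by
    induction n with
    | zero => simp [hneg (-1) (by norm_num)]
    | succ n ih => rw [Finset.sum_range_succ, ih]; push_cast; simp
  have h3 := h1.comp (tendsto_add_atTop_nat 1)
  rw [← (Nat.cast_injective (R := ℤ)).tsum_eq hsupp]
  refine tendsto_nhds_unique h3 (hG.congr fun n => ?_)
  exact (h2 n).symm

lemma sixSum_swap (q s A p₁ p₂ p₃ p₄ p₅ p₆ : ℂ) :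
    sixSum q s A p₁ p₂ p₃ p₄ p₅ p₆ = sixSum q s A p₁ p₂ p₃ p₄ p₆ p₅ := by
  refine tsum_congr fun k => ?_
  rw [sixTerm_eq, sixTerm_eq]; ring

lemma tsum_telescope_eq {g F F' : ℤ → ℂ} {G c a b : ℂ} (hc : c ≠ 0)
    (pt : ∀ k, -(c * (g k - g (k - 1))) = a * F k - b * F' k) (S : Summable F) (S' : Summable F')
    (hneg : ∀ k < 0, g k = 0) (hG : Tendsto (fun n : ℕ => g n) atTop (𝓝 G)) :
    -(c * G) = a * ∑' k, F k - b * ∑' k, F' k := by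
  have hS : Summable fun k => g k - g (k - 1) := by
    have := ((S.mul_left a).sub (S'.mul_left b)).congr fun k => (pt k).symm
    exact (summable_mul_left_iff hc).mp this.of_neg
  rw [← tsum_int_telescope hneg hG hS, ← tsum_mul_left, ← tsum_neg, ← tsum_mul_left,
    ← tsum_mul_left, ← (S.mul_left _).tsum_sub (S'.mul_left _)]
  congr 1; funext k
  exact pt k

/-- Contiguity of the balanced six-parameter sum over `r₁ q^ℤ`. -/
lemma sixSum_contiguous (hq0 : q ≠ 0) (hq : ‖q‖ < 1) {z r₁ r₂ r₃ r₄ r₅ r₆ : ℂ}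
    (hz : z ≠ 0) (h₁ : r₁ ≠ 0) (h₂ : r₂ ≠ 0) (h₃ : r₃ ≠ 0) (h₄ : r₄ ≠ 0) (h₅ : r₅ ≠ 0)
    (h₆ : r₆ ≠ 0) (h : r₁ * r₂ * r₃ * r₄ * r₅ * r₆ = z ^ 3) :
    -(r₁ ^ 4 / z ^ 2 * (r₅ * r₆ * (r₅ - r₆)) *
      (thetaProd q (r₁ * q * r₁ / z) * thetaProd q (r₁ * q * r₂ / z) *
        thetaProd q (r₁ * q * r₃ / z) * thetaProd q (r₁ * q * r₄ / z) *
        thetaProd q (r₁ * q * r₅ / z) * thetaProd q (r₁ * q * r₆ / z))) =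
      r₅ ^ 3 * ((1 - r₆ * r₁ / z) * (1 - r₆ * r₂ / z) * (1 - r₆ * r₃ / z) * (1 - r₆ * r₄ / z)) *
        sixSum q r₁ z r₁ r₂ r₃ r₄ (q * r₅) r₆ -
      r₆ ^ 3 * ((1 - r₅ * r₁ / z) * (1 - r₅ * r₂ / z) * (1 - r₅ * r₃ / z) * (1 - r₅ * r₄ / z)) *
        sixSum q r₁ z r₁ r₂ r₃ r₄ r₅ (q * r₆) := by
  obtain ⟨g, hg⟩ : ∃ g : ℤ → ℂ, ∀ k, g k = pairTerm q (r₁ * q / r₁) (z / (r₁ * q * r₁)) k *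
      pairTerm q (r₁ * q / r₂) (z / (r₁ * q * r₂)) k * pairTerm q (r₁ * q / r₃) (z / (r₁ * q * r₃)) k *
      pairTerm q (r₁ * q / r₄) (z / (r₁ * q * r₄)) k * pairTerm q (r₁ * q / r₅) (z / (r₁ * q * r₅)) k *
      pairTerm q (r₁ * q / r₆) (z / (r₁ * q * r₆)) k * (r₁ ^ 6 * q ^ 6 / z ^ 3) ^ k :=
    ⟨_, fun _ => rfl⟩
  have pt := fun k => sixTerm_telescope hq0 hq h₁ hz h₁ h₂ h₃ h₄ h₅ h₆ h k g hg
  have hw1 : ‖z ^ 3 * q ^ 2 / (r₁ * r₂ * r₃ * r₄ * (q * r₅) * r₆)‖ < 1 := by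
    convert hq using 2
    rw [← h]; field_simp
  have hw2 : ‖z ^ 3 * q ^ 2 / (r₁ * r₂ * r₃ * r₄ * r₅ * (q * r₆))‖ < 1 := by
    convert hq using 2
    rw [← h]; field_simp
  have S1 := summable_sixTerm hq0 hq h₁ hz h₁ h₂ h₃ h₄ (mul_ne_zero hq0 h₅) h₆ hw1
  have S2 := summable_sixTerm hq0 hq h₁ hz h₁ h₂ h₃ h₄ h₅ (mul_ne_zero hq0 h₆) hw2
  -- The base point equals the parameter r₁, so one factor is (q^{1+k};q)_∞.
  have hneg : ∀ k < 0, g k = 0 := by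
    intro k hk
    have : qPochInf q (r₁ * q / r₁ * q ^ k) = 0 := by
      rw [mul_div_cancel_left₀ _ h₁, ← zpow_one_add₀ hq0]
      exact qPochInf_zpow_eq_zero hq0 (by omega)
    simp [hg, pairTerm, this]
  have lim {r : ℂ} (hr : r ≠ 0) := tendsto_pairTerm_mul_zpow hq0 hq (r₁ * q / r)
    (x := r₁ * q * r / z) (by simp [*])
  have hG : Tendsto (fun n : ℕ => g n) atTop (𝓝 (thetaProd q (r₁ * q * r₁ / z) *
        thetaProd q (r₁ * q * r₂ / z) *
        thetaProd q (r₁ * q * r₃ / z) * thetaProd q (r₁ * q * r₄ / z) *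
        thetaProd q (r₁ * q * r₅ / z) * thetaProd q (r₁ * q * r₆ / z))) := by
    refine ((((((lim h₁).mul (lim h₂)).mul (lim h₃)).mul (lim h₄)).mul (lim h₅)).mul
      (lim h₆)).congr fun n => ?_
    -- By balancing, the geometric weight is exactly the product of the six ratios that normalise
    -- the factors of g; so g has a finite limit, a product of six theta functions.
    have e : r₁ ^ 6 * q ^ 6 / z ^ 3 = r₁ * q * r₁ / z * (r₁ * q * r₂ / z) * (r₁ * q * r₃ / z) *
        (r₁ * q * r₄ / z) * (r₁ * q * r₅ / z) * (r₁ * q * r₆ / z) := by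
      field_simp
      linear_combination -h
    rw [hg, e]
    simp only [one_div_div, zpow_natCast]
    ring
  -- If r₅ = r₆ the telescoping relation carries no information, but both sides vanish by symmetry.
  by_cases hr : r₅ * r₆ * (r₅ - r₆) = 0
  · have e : r₅ = r₆ := by
      have : r₅ - r₆ = 0 := by
        rcases mul_eq_zero.mp hr with h' | h'
        · simp [h₅, h₆] at h'
        · exact h'
      exact sub_eq_zero.mp this
    subst e
    rw [sixSum_swap q r₁ z r₁ r₂ r₃ r₄ (q * r₅) r₅, sub_self, sub_self]
    ring
  · have hc : r₁ ^ 4 / z ^ 2 * (r₅ * r₆ * (r₅ - r₆)) ≠ 0 := mul_ne_zero (by simp [*]) hr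
    exact tsum_telescope_eq hc pt S1 S2 hneg hG

/-! ### A degenerate limit of the six-parameter sum -/

lemma gauss_add (hq0 : q ≠ 0) (k m : ℤ) :
    gauss q (k + m) = gauss q k * gauss q m * q ^ (k * m) := by
  have h : (k + m) * (k + m - 1) / 2 = k * (k - 1) / 2 + m * (m - 1) / 2 + k * m := by
    obtain ⟨t, ht⟩ := (Int.even_mul_pred_self k).two_dvd
    obtain ⟨u, hu⟩ := (Int.even_mul_pred_self m).two_dvd
    have : (k + m) * (k + m - 1) = 2 * (t + u + k * m) := by linear_combination ht + hu
    rw [this, ht, hu]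
    simp only [Int.mul_ediv_cancel_left _ two_ne_zero]
  rw [gauss, gauss, gauss, h, zpow_add₀ hq0, zpow_add₀ hq0, zpow_add₀ (by norm_num)]
  ring

lemma gauss_sub_mul_gauss_add (hq0 : q ≠ 0) (k m : ℤ) :
    gauss q (k - m) * gauss q (k + m) = gauss q k ^ 2 * gauss q m ^ 2 * q ^ m := by
  have h : q ^ (k * m) ≠ 0 := zpow_ne_zero _ hq0
  rw [sub_eq_add_neg, gauss_add hq0, gauss_add hq0, gauss_neg hq0, mul_neg, zpow_neg]
  field_simp

/-- Moving `q ^ m` from one parameter to another inside a pair of factors. -/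
lemma pairTerm_mul_pairTerm_shift (hq0 : q ≠ 0) (α β γ δ : ℂ) (k : ℤ) (m : ℕ) :
    pairTerm q (α / q ^ m) (β / q ^ m) k * pairTerm q (γ * q ^ m) (δ * q ^ m) k *
      (gauss q m ^ 2 * q ^ m) = pairTerm q α δ (k - m) * pairTerm q γ β (k + m) := by
  have h := gauss_sub_mul_gauss_add hq0 k m
  have hm : q ^ m ≠ 0 := pow_ne_zero _ hq0
  have e1 : α / q ^ m * q ^ k = α * q ^ (k - m) := by
    rw [zpow_sub₀ hq0, zpow_natCast]; ring
  have e2 : β / q ^ m * q ^ (1 - k) = β * q ^ (1 - (k + m)) := by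
    rw [show 1 - (k + (m : ℤ)) = 1 - k - m by ring, zpow_sub₀ hq0 (1 - k), zpow_natCast]; ring
  have e3 : γ * q ^ m * q ^ k = γ * q ^ (k + m) := by
    rw [zpow_add₀ hq0, zpow_natCast]; ring
  have e4 : δ * q ^ m * q ^ (1 - k) = δ * q ^ (1 - (k - m)) := by
    rw [show 1 - (k - (m : ℤ)) = 1 - k + m by ring, zpow_add₀ hq0, zpow_natCast]; ring
  rw [zpow_natCast] at h
  simp only [pairTerm, e1, e2, e3, e4]
  linear_combination -(qPochInf q (α * q ^ (k - m)) * qPochInf q (β * q ^ (1 - (k + m))) *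
    qPochInf q (γ * q ^ (k + m)) * qPochInf q (δ * q ^ (1 - (k - m)))) * h

lemma tendsto_pairTerm_atTop (hq0 : q ≠ 0) (hq : ‖q‖ < 1) (γ : ℂ) {β : ℂ} (hβ : β ≠ 0) (k : ℤ) :
    Tendsto (fun m : ℕ => pairTerm q γ β (k + m) * β⁻¹ ^ (k + m)) atTop
      (𝓝 (thetaProd q (1 / β))) := by
  have h := tendsto_pairTerm_mul_zpow hq0 hq γ (x := 1 / β) (by simp [hβ])
  have h' : Tendsto (fun j : ℤ => pairTerm q γ β j * β⁻¹ ^ j) atTop (𝓝 (thetaProd q (1 / β))) := by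
    rw [← Nat.map_cast_int_atTop, tendsto_map'_iff]
    refine h.congr fun n => ?_
    simp
  exact h'.comp (tendsto_atTop_add_const_left _ k tendsto_natCast_atTop_atTop)

lemma tendsto_pairTerm_atBot (hq0 : q ≠ 0) (hq : ‖q‖ < 1) {α : ℂ} (hα : α ≠ 0) (δ : ℂ) (k : ℤ) :
    Tendsto (fun m : ℕ => pairTerm q α δ (k - m) * α ^ (k - m)) atTop
      (𝓝 (thetaProd q α)) := by
  have h := tendsto_pairTerm_atTop hq0 hq (δ * q) (div_ne_zero hα hq0) (-k)
  rw [one_div_div, thetaProd_q_div hq0] at h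
  refine h.congr fun m => ?_
  rw [show k - (m : ℤ) = -(-k + m) by ring, pairTerm_neg hq0, inv_div, zpow_neg, div_zpow]
  ring

/-- A shift to the left can only reduce the exponent on the side of rate κ or move to the side of
rate 1. Replacing κ by K ≥ max 1 κ therefore gives a bound uniform in the shift. -/
lemma twoSided_sub_natCast_le {κ K : ℝ} (hκ : 0 ≤ κ) (hκK : κ ≤ K) (hK : 1 ≤ K) (k : ℤ) (m : ℕ) :
    twoSided κ 1 (k - m) ≤ twoSided K 1 k := by
  have hn (n : ℕ) : (1 : ℝ) ≤ twoSided K 1 n ∧ (1 : ℝ) ≤ twoSided K 1 (-n) := by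
    simp [one_le_pow₀ hK]
  by_cases h : 0 ≤ k - m
  · obtain ⟨n, hn⟩ := Int.eq_ofNat_of_zero_le h
    obtain rfl : k = ((n + m : ℕ) : ℤ) := by push_cast; omega
    rw [hn, twoSided_natCast, twoSided_natCast]
    calc κ ^ n ≤ K ^ n := by gcongr
      _ ≤ K ^ (n + m) := pow_le_pow_right₀ hK (by omega)
  · obtain ⟨n, hn'⟩ := Int.eq_ofNat_of_zero_le (a := -(k - m)) (by omega)
    rw [show k - m = -(n : ℤ) by omega, twoSided_neg_natCast, one_pow]
    obtain ⟨j, rfl | rfl⟩ := k.eq_nat_or_neg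
    exacts [(hn j).1, (hn j).2]

lemma twoSided_neg (u v : ℝ) (k : ℤ) : twoSided u v (-k) = twoSided v u k := by
  revert k
  simp [forall_int_iff]

lemma twoSided_add_natCast_le {κ K : ℝ} (hκ : 0 ≤ κ) (hκK : κ ≤ K) (hK : 1 ≤ K) (k : ℤ) (m : ℕ) :
    twoSided 1 κ (k + m) ≤ twoSided 1 K k := by
  have := twoSided_sub_natCast_le hκ hκK hK (-k) m
  rwa [twoSided_neg, show -k - (m : ℤ) = -(k + m) by ring, twoSided_neg] at this

/-- Each normalisation makes one of the two rates equal to 1, so the normalised factor stays bounded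
in the direction in which it is going to be shifted. -/
lemma exists_norm_pairTerm_le (hq0 : q ≠ 0) (hq : ‖q‖ < 1) {α δ : ℂ} (hα : α ≠ 0) (hδ : δ ≠ 0) :
    ∃ C : ℝ, 0 ≤ C ∧ ∀ j, ‖pairTerm q α δ j * α ^ j‖ ≤ C * twoSided ‖α * δ‖ 1 j ∧
      ‖pairTerm q α δ j * δ⁻¹ ^ j‖ ≤ C * twoSided 1 ‖α * δ‖ j := by
  refine ⟨pairConst q ‖α‖ ‖δ‖, Real.exp_nonneg _, fun j => ?_⟩
  have h := norm_pairTerm_le hq0 hq (norm_pos_iff.mpr hα) (norm_pos_iff.mpr hδ) le_rfl le_rfl j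
  have ha : ‖α‖ ≠ 0 := norm_ne_zero_iff.mpr hα
  have hd : ‖δ‖ ≠ 0 := norm_ne_zero_iff.mpr hδ
  constructor
  · calc _ = ‖pairTerm q α δ j‖ * twoSided ‖α‖ ‖α⁻¹‖ j := by
          rw [norm_mul, norm_zpow_eq_twoSided]
      _ ≤ (pairConst q ‖α‖ ‖δ‖ * twoSided ‖δ‖ ‖α‖ j) * twoSided ‖α‖ ‖α⁻¹‖ j := by
          gcongr
          exact twoSided_nonneg (norm_nonneg _) (norm_nonneg _) _
      _ = _ := by
          rw [mul_assoc, twoSided_mul, norm_inv, mul_inv_cancel₀ ha, norm_mul, mul_comm ‖δ‖]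
  · calc _ = ‖pairTerm q α δ j‖ * twoSided ‖δ⁻¹‖ ‖δ‖ j := by
          rw [norm_mul, norm_zpow_eq_twoSided, inv_inv]
      _ ≤ (pairConst q ‖α‖ ‖δ‖ * twoSided ‖δ‖ ‖α‖ j) * twoSided ‖δ⁻¹‖ ‖δ‖ j := by
          gcongr
          exact twoSided_nonneg (norm_nonneg _) (norm_nonneg _) _
      _ = _ := by
          rw [mul_assoc, twoSided_mul, norm_inv, mul_inv_cancel₀ hd, norm_mul]

/-- The infinite products of the two moved parameters are paired anew: one pair depends on k - m and
the other on k + m. In the limit they go to the two ends of the lattice, where each has a theta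
function as limit, and the four other parameters form a `fourTerm`. -/
lemma sixTerm_shift (hq0 : q ≠ 0) {s z p₄ p₅ : ℂ} (p₁ p₂ p₃ p₆ : ℂ) (hs : s ≠ 0) (hz : z ≠ 0)
    (h₄ : p₄ ≠ 0) (k : ℤ) (m : ℕ) :
    sixTerm q s z p₁ p₂ p₃ (p₄ * q ^ m) (p₅ / q ^ m) p₆ k * (gauss q m ^ 2 * (p₄ ^ 2 / z) ^ m) =
      fourTerm q s z p₁ p₂ p₃ p₆ k *
        (pairTerm q (s * q / p₄) (z / (s * p₅)) (k - m) * (s * q / p₄) ^ (k - m)) *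
        (pairTerm q (s * q / p₅) (z / (s * p₄)) (k + m) * (z / (s * p₄))⁻¹ ^ (k + m)) := by
  have hm : q ^ m ≠ 0 := pow_ne_zero _ hq0
  have hα : s * q / p₄ ≠ 0 := by simp [*]
  have hβ : (z / (s * p₄))⁻¹ ≠ 0 := by simp [*]
  have e1 : s * q / (p₄ * q ^ m) = s * q / p₄ / q ^ m := by rw [div_div]
  have e2 : z / (s * (p₄ * q ^ m)) = z / (s * p₄) / q ^ m := by rw [div_div, mul_assoc]
  have e3 : s * q / (p₅ / q ^ m) = s * q / p₅ * q ^ m := by rw [div_div_eq_mul_div]; ring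
  have e4 : z / (s * (p₅ / q ^ m)) = z / (s * p₅) * q ^ m := by
    rw [mul_div_assoc', div_div_eq_mul_div]; ring
  have key := pairTerm_mul_pairTerm_shift hq0 (s * q / p₄) (z / (s * p₄)) (s * q / p₅)
    (z / (s * p₅)) k m
  rw [sixTerm_eq, fourTerm_eq, e1, e2, e3, e4]
  have w1 : (s * q / p₄) ^ (k - m) * (z / (s * p₄))⁻¹ ^ (k + m) =
      (s ^ 2 * q / z) ^ k * (p₄ ^ 2 / (z * q)) ^ m := by
    rw [zpow_sub₀ hα, zpow_add₀ hβ, zpow_natCast, zpow_natCast, div_eq_mul_inv _ ((s * q / p₄) ^ m),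
      ← inv_pow, mul_mul_mul_comm, ← mul_zpow, ← mul_pow]
    congr 2 <;> field_simp
  have w2 : (s ^ 6 * q ^ 2 / z ^ 3) ^ k = (s ^ 4 * q / z ^ 2) ^ k * (s ^ 2 * q / z) ^ k := by
    rw [← mul_zpow]; congr 1; field_simp
  have w3 : (p₄ ^ 2 / z) ^ m = q ^ m * (p₄ ^ 2 / (z * q)) ^ m := by
    rw [← mul_pow]; congr 1; field_simp
  rw [w2, w3]
  generalize (s ^ 4 * q / z ^ 2) ^ k = w at *
  generalize (s ^ 2 * q / z) ^ k = w' at *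
  generalize (p₄ ^ 2 / (z * q)) ^ m = t at *
  generalize (s * q / p₄) ^ (k - m) = u at *
  generalize (z / (s * p₄))⁻¹ ^ (k + m) = v at *
  generalize pairTerm q (s * q / p₁) (z / (s * p₁)) k = H₁
  generalize pairTerm q (s * q / p₂) (z / (s * p₂)) k = H₂
  generalize pairTerm q (s * q / p₃) (z / (s * p₃)) k = H₃
  generalize pairTerm q (s * q / p₆) (z / (s * p₆)) k = H₆
  generalize pairTerm q (s * q / p₄ / q ^ m) (z / (s * p₄) / q ^ m) k = H₄ at *
  generalize pairTerm q (s * q / p₅ * q ^ m) (z / (s * p₅) * q ^ m) k = H₅ at *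
  generalize pairTerm q (s * q / p₄) (z / (s * p₅)) (k - m) = K₄ at *
  generalize pairTerm q (s * q / p₅) (z / (s * p₄)) (k + m) = K₅ at *
  generalize 1 - s ^ 2 / z * q ^ (2 * k) = y
  linear_combination y * (H₁ * H₂ * H₃ * H₆) * w * w' * t * key -
    y * (H₁ * H₂ * H₃ * H₆) * w * K₄ * K₅ * w1

lemma tendsto_sixSum_shift (hq0 : q ≠ 0) (hq : ‖q‖ < 1) {s z p₁ p₂ p₃ p₄ p₅ p₆ : ℂ} (hs : s ≠ 0)
    (hz : z ≠ 0) (h₁ : p₁ ≠ 0) (h₂ : p₂ ≠ 0) (h₃ : p₃ ≠ 0) (h₄ : p₄ ≠ 0) (h₅ : p₅ ≠ 0)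
    (h₆ : p₆ ≠ 0) (hw : ‖z ^ 2 * q / (p₁ * p₂ * p₃ * p₆)‖ < 1)
    (hw' : ‖z ^ 3 * q ^ 2 / (p₁ * p₂ * p₃ * p₄ * p₅ * p₆)‖ < 1) :
    Tendsto (fun m : ℕ => sixSum q s z p₁ p₂ p₃ (p₄ * q ^ m) (p₅ / q ^ m) p₆ *
        (gauss q m ^ 2 * (p₄ ^ 2 / z) ^ m)) atTop
      (𝓝 (fourSum q s z p₁ p₂ p₃ p₆ * thetaProd q (s * q / p₄) * thetaProd q (s * p₄ / z))) := by
  have hα : s * q / p₄ ≠ 0 := by simp [*]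
  have hβ : z / (s * p₄) ≠ 0 := by simp [*]
  have hγ : s * q / p₅ ≠ 0 := by simp [*]
  have hδ : z / (s * p₅) ≠ 0 := by simp [*]
  obtain ⟨C, hC, hCb⟩ := exists_norm_pairTerm_le hq0 hq hα hδ
  obtain ⟨D, hD, hDb⟩ := exists_norm_pairTerm_le hq0 hq hγ hβ
  have e1 : s * q / p₄ * (z / (s * p₅)) = z * q / (p₄ * p₅) := by field_simp
  have e2 : s * q / p₅ * (z / (s * p₄)) = z * q / (p₄ * p₅) := by field_simp
  rw [e1] at hCb
  rw [e2] at hDb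
  set κ := ‖z * q / (p₄ * p₅)‖ with hκ
  set K := max 1 κ with hK
  have hK1 : 1 ≤ K := le_max_left _ _
  have hκK : κ ≤ K := le_max_right _ _
  have hκ0 : 0 ≤ κ := norm_nonneg _
  set w := ‖z ^ 2 * q / (p₁ * p₂ * p₃ * p₆)‖ with hwd
  have hw0 : 0 ≤ w := norm_nonneg _
  obtain ⟨B, hB, hBb⟩ : ∃ B : ℝ, 0 ≤ B ∧ ∀ k, ‖fourTerm q s z p₁ p₂ p₃ p₆ k‖ ≤
      B * twoSided w w k := by
    have hB := geomBound_vwpTerm (l := (⊤ : Filter Unit)) (r := 4) hq0 hq (s := fun _ => s)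
      (A := fun _ => z) (W := fun _ => s ^ 4 * q / z ^ 2) (p := fun _ => ![p₁, p₂, p₃, p₆])
      tendsto_const_nhds tendsto_const_nhds (fun j => tendsto_const_nhds) hs hz
      (by simp [Fin.forall_fin_succ, h₁, h₂, h₃, h₆])
    obtain ⟨B, hB0, hB⟩ := hB.congr (Eventually.of_forall fun _ _ => rfl)
      (u' := fun _ => z ^ 2 * q / (p₁ * p₂ * p₃ * p₆))
      (v' := fun _ => z ^ 2 * q / (p₁ * p₂ * p₃ * p₆))
      (Eventually.of_forall fun _ => by
        simp only [Fin.prod_univ_four, Matrix.cons_val]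
        field_simp)
      (Eventually.of_forall fun _ => by
        simp only [Fin.prod_univ_four, Matrix.cons_val]
        field_simp)
    obtain ⟨_, h⟩ := hB.exists
    exact ⟨B, hB0, h⟩
  -- The two size hypotheses correspond to the two values of the maximum: K = 1 gives the ₆ψ₆
  -- condition, K = κ that of the six-parameter sum.
  have hwK : w * K < 1 := by
    rcases le_total 1 κ with h | h
    · rw [hK, max_eq_right h, hwd, hκ, ← norm_mul]
      convert hw' using 2
      field_simp
    · rw [hK, max_eq_left h, mul_one]; exact hw
  have hsum : Summable fun k => B * C * D * twoSided (w * K) (w * K) k :=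
    (summable_twoSided (by positivity) (by positivity) hwK hwK).mul_left _
  have hlim (k : ℤ) := ((tendsto_pairTerm_atBot hq0 hq hα (z / (s * p₅)) k).const_mul
    (fourTerm q s z p₁ p₂ p₃ p₆ k)).mul (tendsto_pairTerm_atTop hq0 hq (s * q / p₅) hβ k)
  have main := tendsto_tsum_of_dominated_convergence hsum hlim
    (Eventually.of_forall fun m k => ?_)
  · rw [one_div_div, tsum_mul_right, tsum_mul_right] at main
    refine main.congr fun m => ?_
    rw [sixSum, ← tsum_mul_right]
    exact tsum_congr fun k => (sixTerm_shift hq0 p₁ p₂ p₃ p₆ hs hz h₄ k m).symm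
  · have t1 := twoSided_nonneg hw0 hw0 k
    have t2 := twoSided_nonneg (zero_le_one.trans hK1) zero_le_one k
    have c1 : ‖pairTerm q (s * q / p₄) (z / (s * p₅)) (k - m) * (s * q / p₄) ^ (k - (m : ℤ))‖ ≤
        C * twoSided K 1 k :=
      ((hCb _).1).trans (by gcongr; exact twoSided_sub_natCast_le hκ0 hκK hK1 k m)
    have c2 : ‖pairTerm q (s * q / p₅) (z / (s * p₄)) (k + m) * (z / (s * p₄))⁻¹ ^ (k + (m : ℤ))‖ ≤
        D * twoSided 1 K k :=
      ((hDb _).2).trans (by gcongr; exact twoSided_add_natCast_le hκ0 hκK hK1 k m)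
    rw [norm_mul, norm_mul]
    calc _ ≤ (B * twoSided w w k) * (C * twoSided K 1 k) * (D * twoSided 1 K k) :=
          mul_le_mul (mul_le_mul (hBb k) c1 (norm_nonneg _) (by positivity)) c2 (norm_nonneg _)
            (by positivity)
      _ = B * C * D * (twoSided w w k * twoSided K 1 k * twoSided 1 K k) := by ring
      _ = _ := by rw [twoSided_mul, twoSided_mul, mul_one, mul_one]

/-! ### The two-term relation for balanced six-parameter sums -/

/-- The combination of the sums over `p₁ q^ℤ` and `p₆ q^ℤ` that has a product evaluation. -/
def sixCross (q z p₁ p₂ p₃ p₄ p₅ p₆ : ℂ) : ℂ :=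
  p₁ * (thetaProd q (p₆ * p₆ / z) * thetaProd q (p₆ * p₂ / z) * thetaProd q (p₆ * p₃ / z) *
      thetaProd q (p₆ * p₄ / z) * thetaProd q (p₆ * p₅ / z)) * sixSum q p₁ z p₁ p₂ p₃ p₄ p₅ p₆ -
    p₆ * (thetaProd q (p₁ * p₁ / z) * thetaProd q (p₁ * p₂ / z) * thetaProd q (p₁ * p₃ / z) *
      thetaProd q (p₁ * p₄ / z) * thetaProd q (p₁ * p₅ / z)) * sixSum q p₆ z p₁ p₂ p₃ p₄ p₅ p₆

/-- The product evaluating `sixCross`. -/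
def sixCrossValue (q z p₁ p₂ p₃ p₄ p₅ p₆ : ℂ) : ℂ :=
  -(p₆ * qPochInf q q * thetaProd q (p₁ / p₆) * thetaProd q (p₁ * p₁ / z) *
      thetaProd q (p₆ * p₆ / z)) *
    (qPochInf q (z * q / (p₁ * p₂)) * qPochInf q (z * q / (p₁ * p₃)) *
      qPochInf q (z * q / (p₁ * p₆)) * qPochInf q (z * q / (p₂ * p₃)) *
      qPochInf q (z * q / (p₂ * p₆)) * qPochInf q (z * q / (p₃ * p₆))) *
    qPochInf q (z * q / (p₄ * p₅)) *
    (qPochInf q (z * q / (p₁ * p₄)) * qPochInf q (z * q / (p₂ * p₄)) *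
      qPochInf q (z * q / (p₃ * p₄)) * qPochInf q (z * q / (p₆ * p₄))) *
    (qPochInf q (z * q / (p₁ * p₅)) * qPochInf q (z * q / (p₂ * p₅)) *
      qPochInf q (z * q / (p₃ * p₅)) * qPochInf q (z * q / (p₆ * p₅)))

lemma sixSum_reorder_first (q s A p₁ p₂ p₃ p₄ p₅ p₆ : ℂ) :
    sixSum q s A p₁ p₂ p₃ p₆ p₅ p₄ = sixSum q s A p₁ p₂ p₃ p₄ p₅ p₆ := by
  refine tsum_congr fun k => ?_
  rw [sixTerm_eq, sixTerm_eq]; ring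

lemma sixSum_reorder_last (q s A p₁ p₂ p₃ p₄ p₅ p₆ : ℂ) :
    sixSum q s A p₆ p₂ p₃ p₁ p₅ p₄ = sixSum q s A p₁ p₂ p₃ p₄ p₅ p₆ := by
  refine tsum_congr fun k => ?_
  rw [sixTerm_eq, sixTerm_eq]; ring

/-- `sixSum_contiguous` with the theta functions brought to the unshifted arguments. -/
lemma sixSum_contiguous_theta (hq0 : q ≠ 0) (hq : ‖q‖ < 1) {z r₁ r₂ r₃ r₄ r₅ r₆ : ℂ}
    (hz : z ≠ 0) (h₁ : r₁ ≠ 0) (h₂ : r₂ ≠ 0) (h₃ : r₃ ≠ 0) (h₄ : r₄ ≠ 0) (h₅ : r₅ ≠ 0)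
    (h₆ : r₆ ≠ 0) (h : r₁ * r₂ * r₃ * r₄ * r₅ * r₆ = z ^ 3) :
    -(z / r₁ ^ 2 * (r₅ * r₆ * (r₅ - r₆)) *
      (thetaProd q (r₁ * r₁ / z) * thetaProd q (r₁ * r₂ / z) *
        thetaProd q (r₁ * r₃ / z) * thetaProd q (r₁ * r₄ / z) *
        thetaProd q (r₁ * r₅ / z) * thetaProd q (r₁ * r₆ / z))) =
      r₅ ^ 3 * ((1 - r₆ * r₁ / z) * (1 - r₆ * r₂ / z) * (1 - r₆ * r₃ / z) * (1 - r₆ * r₄ / z)) *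
        sixSum q r₁ z r₁ r₂ r₃ r₄ (q * r₅) r₆ -
      r₆ ^ 3 * ((1 - r₅ * r₁ / z) * (1 - r₅ * r₂ / z) * (1 - r₅ * r₃ / z) * (1 - r₅ * r₄ / z)) *
        sixSum q r₁ z r₁ r₂ r₃ r₄ r₅ (q * r₆) := by
  rw [← sixSum_contiguous hq0 hq hz h₁ h₂ h₃ h₄ h₅ h₆ h]
  have e (r : ℂ) (hr : r ≠ 0) :
      thetaProd q (r₁ * q * r / z) = -(thetaProd q (r₁ * r / z) * (z / (r₁ * r))) := by
    rw [show r₁ * q * r / z = r₁ * r / z * q by ring, thetaProd_mul_q hq0 hq (by simp [*])]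
    field_simp
  rw [e _ h₁, e _ h₂, e _ h₃, e _ h₄, e _ h₅, e _ h₆]
  generalize thetaProd q (r₁ * r₁ / z) = t₁
  generalize thetaProd q (r₁ * r₂ / z) = t₂
  generalize thetaProd q (r₁ * r₃ / z) = t₃
  generalize thetaProd q (r₁ * r₄ / z) = t₄
  generalize thetaProd q (r₁ * r₅ / z) = t₅
  generalize thetaProd q (r₁ * r₆ / z) = t₆
  have c : z / r₁ ^ 2 = r₁ ^ 4 / z ^ 2 * (z / (r₁ * r₁) * (z / (r₁ * r₂)) * (z / (r₁ * r₃)) *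
      (z / (r₁ * r₄)) * (z / (r₁ * r₅)) * (z / (r₁ * r₆))) := by
    field_simp
    linear_combination h
  rw [c]; ring

lemma one_sub_div_mul {z p r : ℂ} (hz : z ≠ 0) (hp : p ≠ 0) (hr : r ≠ 0) :
    1 - z / (p * r) = -(z / (p * r)) * (1 - r * p / z) := by
  field_simp
  ring

/-- The contiguous relations over p₁ q^ℤ and p₆ q^ℤ have boundary terms that differ only in their
theta factors. The weights in `sixCross` are cross-multiplied theta products chosen so that these
boundary terms cancel. -/
lemma sixCross_shift (hq0 : q ≠ 0) (hq : ‖q‖ < 1) {z p₁ p₂ p₃ r₄ r₅ p₆ : ℂ}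
    (hz : z ≠ 0) (h₁ : p₁ ≠ 0) (h₂ : p₂ ≠ 0) (h₃ : p₃ ≠ 0) (h₄ : r₄ ≠ 0) (h₅ : r₅ ≠ 0)
    (h₆ : p₆ ≠ 0) (h : p₁ * p₂ * p₃ * r₄ * r₅ * p₆ = z ^ 3) :
    (1 - z / (p₁ * r₅)) * (1 - z / (p₂ * r₅)) * (1 - z / (p₃ * r₅)) * (1 - z / (p₆ * r₅)) *
        sixCross q z p₁ p₂ p₃ (q * r₄) r₅ p₆ =
      (1 - z / (p₁ * r₄)) * (1 - z / (p₂ * r₄)) * (1 - z / (p₃ * r₄)) * (1 - z / (p₆ * r₄)) *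
        sixCross q z p₁ p₂ p₃ r₄ (q * r₅) p₆ := by
  have k1 := sixSum_contiguous_theta hq0 hq hz h₁ h₂ h₃ h₆ h₅ h₄ (by rw [← h]; ring)
  have k6 := sixSum_contiguous_theta hq0 hq hz h₆ h₂ h₃ h₁ h₅ h₄ (by rw [← h]; ring)
  rw [sixSum_reorder_first q p₁ z p₁ p₂ p₃ r₄ (q * r₅) p₆,
    sixSum_reorder_first q p₁ z p₁ p₂ p₃ (q * r₄) r₅ p₆] at k1
  rw [sixSum_reorder_last q p₆ z p₁ p₂ p₃ r₄ (q * r₅) p₆,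
    sixSum_reorder_last q p₆ z p₁ p₂ p₃ (q * r₄) r₅ p₆] at k6
  have e (x r : ℂ) (hx : x ≠ 0) (hr : r ≠ 0) :
      thetaProd q (x * (q * r) / z) = -(thetaProd q (x * r / z) * (z / (x * r))) := by
    rw [show x * (q * r) / z = x * r / z * q by ring, thetaProd_mul_q hq0 hq (by simp [*])]
    field_simp
  rw [sixCross, sixCross, e _ _ h₁ h₄, e _ _ h₁ h₅, e _ _ h₆ h₄, e _ _ h₆ h₅,
    one_sub_div_mul hz h₁ h₅, one_sub_div_mul hz h₂ h₅, one_sub_div_mul hz h₃ h₅,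
    one_sub_div_mul hz h₆ h₅, one_sub_div_mul hz h₁ h₄, one_sub_div_mul hz h₂ h₄,
    one_sub_div_mul hz h₃ h₄, one_sub_div_mul hz h₆ h₄]
  rw [mul_comm p₁ p₆] at k1
  generalize thetaProd q (p₁ * p₁ / z) = t₁₁ at *
  generalize thetaProd q (p₁ * p₂ / z) = t₁₂ at *
  generalize thetaProd q (p₁ * p₃ / z) = t₁₃ at *
  generalize thetaProd q (p₆ * p₁ / z) = t₁₆ at *
  generalize thetaProd q (p₁ * r₅ / z) = t₁₅ at *
  generalize thetaProd q (p₁ * r₄ / z) = t₁₄ at *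
  generalize thetaProd q (p₆ * p₆ / z) = t₆₆ at *
  generalize thetaProd q (p₆ * p₂ / z) = t₆₂ at *
  generalize thetaProd q (p₆ * p₃ / z) = t₆₃ at *
  generalize thetaProd q (p₆ * r₅ / z) = t₆₅ at *
  generalize thetaProd q (p₆ * r₄ / z) = t₆₄ at *
  generalize sixSum q p₁ z p₁ p₂ p₃ r₄ (q * r₅) p₆ = S₁ at *
  generalize sixSum q p₁ z p₁ p₂ p₃ (q * r₄) r₅ p₆ = S₁' at *
  generalize sixSum q p₆ z p₁ p₂ p₃ r₄ (q * r₅) p₆ = S₆ at *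
  generalize sixSum q p₆ z p₁ p₂ p₃ (q * r₄) r₅ p₆ = S₆' at *
  generalize 1 - r₄ * p₁ / z = l₁ at *
  generalize 1 - r₄ * p₂ / z = l₂ at *
  generalize 1 - r₄ * p₃ / z = l₃ at *
  generalize 1 - r₄ * p₆ / z = l₆ at *
  generalize 1 - r₅ * p₁ / z = m₁ at *
  generalize 1 - r₅ * p₂ / z = m₂ at *
  generalize 1 - r₅ * p₃ / z = m₃ at *
  generalize 1 - r₅ * p₆ / z = m₆ at *
  clear e
  field_simp at k1 k6 ⊢
  linear_combination -(t₆₆ * t₆₂ * t₆₃ * t₆₅ * t₆₄) * k1 + (t₁₁ * t₁₂ * t₁₃ * t₁₅ * t₁₄) * k6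

/-- The proposed product obeys the same recursion as `sixCross`, so their difference can be iterated
as one quantity. -/
lemma sixCrossValue_shift (hq0 : q ≠ 0) (hq : ‖q‖ < 1) {z p₁ p₂ p₃ r₄ r₅ p₆ : ℂ} :
    (1 - z / (p₁ * r₅)) * (1 - z / (p₂ * r₅)) * (1 - z / (p₃ * r₅)) * (1 - z / (p₆ * r₅)) *
        sixCrossValue q z p₁ p₂ p₃ (q * r₄) r₅ p₆ =
      (1 - z / (p₁ * r₄)) * (1 - z / (p₂ * r₄)) * (1 - z / (p₃ * r₄)) * (1 - z / (p₆ * r₄)) *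
        sixCrossValue q z p₁ p₂ p₃ r₄ (q * r₅) p₆ := by
  have e (x r : ℂ) : qPochInf q (z * q / (x * (q * r))) =
      (1 - z / (x * r)) * qPochInf q (z * q / (x * r)) := by
    rw [show x * (q * r) = x * r * q by ring, mul_div_mul_right _ _ hq0, qPochInf_eq_mul hq]
    congr 2
    ring
  rw [sixCrossValue, sixCrossValue, e p₁ r₄, e p₂ r₄, e p₃ r₄, e p₆ r₄, e p₁ r₅, e p₂ r₅, e p₃ r₅,
    e p₆ r₅, show q * r₄ * r₅ = r₄ * (q * r₅) by ring]
  generalize 1 - z / (p₁ * r₄) = l₁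
  generalize 1 - z / (p₂ * r₄) = l₂
  generalize 1 - z / (p₃ * r₄) = l₃
  generalize 1 - z / (p₆ * r₄) = l₆
  generalize 1 - z / (p₁ * r₅) = m₁
  generalize 1 - z / (p₂ * r₅) = m₂
  generalize 1 - z / (p₃ * r₅) = m₃
  generalize 1 - z / (p₆ * r₅) = m₆
  ring

/-- The difference of `sixCross` and its evaluation. -/
def sixDefect (q z p₁ p₂ p₃ p₄ p₅ p₆ : ℂ) : ℂ :=
  sixCross q z p₁ p₂ p₃ p₄ p₅ p₆ - sixCrossValue q z p₁ p₂ p₃ p₄ p₅ p₆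

lemma sixDefect_shift (hq0 : q ≠ 0) (hq : ‖q‖ < 1) {z p₁ p₂ p₃ r₄ r₅ p₆ : ℂ}
    (hz : z ≠ 0) (h₁ : p₁ ≠ 0) (h₂ : p₂ ≠ 0) (h₃ : p₃ ≠ 0) (h₄ : r₄ ≠ 0) (h₅ : r₅ ≠ 0)
    (h₆ : p₆ ≠ 0) (h : p₁ * p₂ * p₃ * r₄ * r₅ * p₆ = z ^ 3) :
    (1 - z / (p₁ * r₅)) * (1 - z / (p₂ * r₅)) * (1 - z / (p₃ * r₅)) * (1 - z / (p₆ * r₅)) *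
        sixDefect q z p₁ p₂ p₃ (q * r₄) r₅ p₆ =
      (1 - z / (p₁ * r₄)) * (1 - z / (p₂ * r₄)) * (1 - z / (p₃ * r₄)) * (1 - z / (p₆ * r₄)) *
        sixDefect q z p₁ p₂ p₃ r₄ (q * r₅) p₆ := by
  rw [sixDefect, sixDefect, mul_sub _ (sixCross q z p₁ p₂ p₃ (q * r₄) r₅ p₆),
    mul_sub _ (sixCross q z p₁ p₂ p₃ r₄ (q * r₅) p₆), sixCross_shift hq0 hq hz h₁ h₂ h₃ h₄ h₅ h₆ h,
    sixCrossValue_shift hq0 hq]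

lemma qPochInf_div_pow_succ (hq0 : q ≠ 0) (hq : ‖q‖ < 1) (x : ℂ) (m : ℕ) :
    qPochInf q (x / q ^ (m + 1)) = (1 - x / q ^ (m + 1)) * qPochInf q (x / q ^ m) := by
  have hm : q ^ m ≠ 0 := pow_ne_zero _ hq0
  rw [qPochInf_eq_mul hq]
  congr 2
  rw [pow_succ]; field_simp

/-- The factors from p₄ are collected on the left as infinite products with receding argument, those
from p₅ on the right as partial products; no factor is divided out, so nothing has to be nonzero
yet. -/
lemma sixDefect_iterate (hq0 : q ≠ 0) (hq : ‖q‖ < 1) {z p₁ p₂ p₃ p₄ p₅ p₆ : ℂ}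
    (hz : z ≠ 0) (h₁ : p₁ ≠ 0) (h₂ : p₂ ≠ 0) (h₃ : p₃ ≠ 0) (h₄ : p₄ ≠ 0) (h₅ : p₅ ≠ 0)
    (h₆ : p₆ ≠ 0) (h : p₁ * p₂ * p₃ * p₄ * p₅ * p₆ = q * z ^ 3) (m : ℕ) :
    qPochInf q (z * q / (p₁ * p₄) / q ^ m) * qPochInf q (z * q / (p₂ * p₄) / q ^ m) *
      qPochInf q (z * q / (p₃ * p₄) / q ^ m) * qPochInf q (z * q / (p₆ * p₄) / q ^ m) *
        sixDefect q z p₁ p₂ p₃ p₄ p₅ p₆ =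
      qPochInf q (z * q / (p₁ * p₄)) * qPochInf q (z * q / (p₂ * p₄)) *
      qPochInf q (z * q / (p₃ * p₄)) * qPochInf q (z * q / (p₆ * p₄)) *
        ((∏ j ∈ Finset.range m, (1 - z * q / (p₁ * p₅) * q ^ j)) *
         (∏ j ∈ Finset.range m, (1 - z * q / (p₂ * p₅) * q ^ j)) *
         (∏ j ∈ Finset.range m, (1 - z * q / (p₃ * p₅) * q ^ j)) *
         (∏ j ∈ Finset.range m, (1 - z * q / (p₆ * p₅) * q ^ j))) *
        sixDefect q z p₁ p₂ p₃ (p₄ * q ^ m) (p₅ / q ^ m) p₆ := by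
  induction m with
  | zero => simp
  | succ m ih =>
    have hm : q ^ m ≠ 0 := pow_ne_zero _ hq0
    have hm' : q ^ (m + 1) ≠ 0 := pow_ne_zero _ hq0
    have key := sixDefect_shift hq0 hq hz h₁ h₂ h₃ (r₄ := p₄ * q ^ m) (r₅ := p₅ / q ^ (m + 1))
      (mul_ne_zero h₄ hm) (div_ne_zero h₅ hm') h₆
      (by rw [pow_succ]; field_simp; linear_combination h)
    have d1 : q * (p₄ * q ^ m) = p₄ * q ^ (m + 1) := by rw [pow_succ]; ring
    have d2 : q * (p₅ / q ^ (m + 1)) = p₅ / q ^ m := by rw [pow_succ]; field_simp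
    have d3 (p : ℂ) : z / (p * (p₅ / q ^ (m + 1))) = z * q / (p * p₅) * q ^ m := by
      rw [pow_succ]; field_simp
    have d4 (p : ℂ) : z / (p * (p₄ * q ^ m)) = z * q / (p * p₄) / q ^ (m + 1) := by
      rw [pow_succ]; field_simp
    simp only [d1, d2, d3, d4] at key
    simp only [qPochInf_div_pow_succ hq0 hq, Finset.prod_range_succ]
    generalize sixDefect q z p₁ p₂ p₃ (p₄ * q ^ (m + 1)) (p₅ / q ^ (m + 1)) p₆ = E' at *
    generalize sixDefect q z p₁ p₂ p₃ (p₄ * q ^ m) (p₅ / q ^ m) p₆ = E at *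
    generalize sixDefect q z p₁ p₂ p₃ p₄ p₅ p₆ = E₀ at *
    generalize 1 - z * q / (p₁ * p₅) * q ^ m = m₁ at *
    generalize 1 - z * q / (p₂ * p₅) * q ^ m = m₂ at *
    generalize 1 - z * q / (p₃ * p₅) * q ^ m = m₃ at *
    generalize 1 - z * q / (p₆ * p₅) * q ^ m = m₆ at *
    generalize 1 - z * q / (p₁ * p₄) / q ^ (m + 1) = l₁ at *
    generalize 1 - z * q / (p₂ * p₄) / q ^ (m + 1) = l₂ at *
    generalize 1 - z * q / (p₃ * p₄) / q ^ (m + 1) = l₃ at *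
    generalize 1 - z * q / (p₆ * p₄) / q ^ (m + 1) = l₆ at *
    generalize (∏ j ∈ Finset.range m, (1 - z * q / (p₁ * p₅) * q ^ j)) = a₁ at *
    generalize (∏ j ∈ Finset.range m, (1 - z * q / (p₂ * p₅) * q ^ j)) = a₂ at *
    generalize (∏ j ∈ Finset.range m, (1 - z * q / (p₃ * p₅) * q ^ j)) = a₃ at *
    generalize (∏ j ∈ Finset.range m, (1 - z * q / (p₆ * p₅) * q ^ j)) = a₆ at *
    generalize qPochInf q (z * q / (p₁ * p₄)) * qPochInf q (z * q / (p₂ * p₄)) *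
      qPochInf q (z * q / (p₃ * p₄)) * qPochInf q (z * q / (p₆ * p₄)) = B at *
    linear_combination l₁ * l₂ * l₃ * l₆ * ih - B * (a₁ * a₂ * a₃ * a₆) * key

lemma tendsto_qPochInf_div_pow (hq0 : q ≠ 0) (hq : ‖q‖ < 1) {x : ℂ} (hx : x ≠ 0) :
    Tendsto (fun m : ℕ => qPochInf q (x / q ^ m) * (gauss q m * (q / x) ^ m)) atTop
      (𝓝 (thetaProd q x)) := by
  have h := tendsto_pairTerm_mul_zpow hq0 hq 0 (x := q / x) (div_ne_zero hq0 hx)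
  rw [thetaProd_q_div hq0] at h
  refine h.congr fun m => ?_
  have e : 1 / (q / x) * q ^ (1 - (m : ℤ)) = x / q ^ m := by
    rw [zpow_sub₀ hq0, zpow_one, zpow_natCast]; field_simp
  rw [pairTerm, e, zero_mul, qPochInf_zero]
  ring

lemma thetaProd_mul_thetaProd_shift (hq0 : q ≠ 0) (hq : ‖q‖ < 1) {x y : ℂ} (hx : x ≠ 0)
    (hy : y ≠ 0) (m : ℕ) :
    thetaProd q (x * q ^ m) * thetaProd q (y / q ^ m) * (gauss q m ^ 2 * (q * x / y) ^ m) =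
      thetaProd q x * thetaProd q y := by
  rw [← thetaProd_mul_zpow hq0 hq hx m, ← thetaProd_mul_zpow hq0 hq hy (-m), gauss_neg hq0,
    zpow_neg, zpow_neg, zpow_natCast, zpow_natCast, zpow_natCast, ← div_eq_mul_inv, mul_div_assoc,
    mul_pow, div_pow]
  ring

/-- The normalising factor has two sources: the theta functions containing p₄ and p₅ contribute one
square of the Gaussian weight, the degeneration of the sums the other. It is the same for both base
points. -/
lemma tendsto_sixCross (hq0 : q ≠ 0) (hq : ‖q‖ < 1) {z p₁ p₂ p₃ p₄ p₅ p₆ : ℂ}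
    (hz : z ≠ 0) (h₁ : p₁ ≠ 0) (h₂ : p₂ ≠ 0) (h₃ : p₃ ≠ 0) (h₄ : p₄ ≠ 0) (h₅ : p₅ ≠ 0)
    (h₆ : p₆ ≠ 0) (hw : ‖z ^ 2 * q / (p₁ * p₂ * p₃ * p₆)‖ < 1)
    (hw' : ‖z ^ 3 * q ^ 2 / (p₁ * p₂ * p₃ * p₄ * p₅ * p₆)‖ < 1) :
    Tendsto (fun m : ℕ => sixCross q z p₁ p₂ p₃ (p₄ * q ^ m) (p₅ / q ^ m) p₆ *
        (gauss q m ^ 4 * (q * p₄ ^ 3 / (z * p₅)) ^ m)) atTop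
      (𝓝 (p₁ * (thetaProd q (p₆ * p₆ / z) * thetaProd q (p₆ * p₂ / z) * thetaProd q (p₆ * p₃ / z) *
          thetaProd q (p₆ * p₄ / z) * thetaProd q (p₆ * p₅ / z)) *
          (fourSum q p₁ z p₁ p₂ p₃ p₆ * thetaProd q (p₁ * q / p₄) * thetaProd q (p₁ * p₄ / z)) -
        p₆ * (thetaProd q (p₁ * p₁ / z) * thetaProd q (p₁ * p₂ / z) * thetaProd q (p₁ * p₃ / z) *
          thetaProd q (p₁ * p₄ / z) * thetaProd q (p₁ * p₅ / z)) *
          (fourSum q p₆ z p₁ p₂ p₃ p₆ * thetaProd q (p₆ * q / p₄) *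
            thetaProd q (p₆ * p₄ / z)))) := by
  have l1 := tendsto_sixSum_shift hq0 hq h₁ hz h₁ h₂ h₃ h₄ h₅ h₆ hw hw'
  have l6 := tendsto_sixSum_shift hq0 hq h₆ hz h₁ h₂ h₃ h₄ h₅ h₆ hw hw'
  refine ((l1.const_mul _).sub (l6.const_mul _)).congr fun m => ?_
  have e (x : ℂ) (hx : x ≠ 0) : thetaProd q (x * (p₄ * q ^ m) / z) *
      thetaProd q (x * (p₅ / q ^ m) / z) * (gauss q m ^ 2 * (q * p₄ / p₅) ^ m) =
      thetaProd q (x * p₄ / z) * thetaProd q (x * p₅ / z) := by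
    rw [← thetaProd_mul_thetaProd_shift hq0 hq (x := x * p₄ / z) (y := x * p₅ / z) (by simp [*])
      (by simp [*]) m, show x * (p₄ * q ^ m) / z = x * p₄ / z * q ^ m by ring,
      show x * (p₅ / q ^ m) / z = x * p₅ / z / q ^ m by ring,
      show q * (x * p₄ / z) / (x * p₅ / z) = q * p₄ / p₅ by field_simp]
  have e1 := e p₁ h₁
  have e6 := e p₆ h₆
  have c : (q * p₄ ^ 3 / (z * p₅)) ^ m = (q * p₄ / p₅) ^ m * (p₄ ^ 2 / z) ^ m := by
    rw [← mul_pow]; congr 1; field_simp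
  rw [sixCross, c]
  generalize (q * p₄ / p₅) ^ m = c₁ at *
  generalize (p₄ ^ 2 / z) ^ m = c₂ at *
  generalize gauss q m = G at *
  generalize thetaProd q (p₆ * p₆ / z) * thetaProd q (p₆ * p₂ / z) * thetaProd q (p₆ * p₃ / z) = T at *
  generalize thetaProd q (p₁ * p₁ / z) * thetaProd q (p₁ * p₂ / z) * thetaProd q (p₁ * p₃ / z) = U at *
  generalize sixSum q p₁ z p₁ p₂ p₃ (p₄ * q ^ m) (p₅ / q ^ m) p₆ = S₁
  generalize sixSum q p₆ z p₁ p₂ p₃ (p₄ * q ^ m) (p₅ / q ^ m) p₆ = S₆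
  linear_combination p₆ * U * S₆ * G ^ 2 * c₂ * e1 - p₁ * T * S₁ * G ^ 2 * c₂ * e6

lemma tendsto_prod_qPochInf_div_pow (hq0 : q ≠ 0) (hq : ‖q‖ < 1) {z p₁ p₂ p₃ p₄ p₅ p₆ : ℂ}
    (hz : z ≠ 0) (h₁ : p₁ ≠ 0) (h₂ : p₂ ≠ 0) (h₃ : p₃ ≠ 0) (h₄ : p₄ ≠ 0) (h₅ : p₅ ≠ 0)
    (h₆ : p₆ ≠ 0) (h : p₁ * p₂ * p₃ * p₄ * p₅ * p₆ = q * z ^ 3) :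
    Tendsto (fun m : ℕ => qPochInf q (z * q / (p₁ * p₄) / q ^ m) *
        qPochInf q (z * q / (p₂ * p₄) / q ^ m) * qPochInf q (z * q / (p₃ * p₄) / q ^ m) *
        qPochInf q (z * q / (p₆ * p₄) / q ^ m) *
        (gauss q m ^ 4 * (q * p₄ ^ 3 / (z * p₅)) ^ m)) atTop
      (𝓝 (thetaProd q (z * q / (p₁ * p₄)) * thetaProd q (z * q / (p₂ * p₄)) *
          thetaProd q (z * q / (p₃ * p₄)) * thetaProd q (z * q / (p₆ * p₄)))) := by
  have a (p : ℂ) (hp : p ≠ 0) := tendsto_qPochInf_div_pow hq0 hq (x := z * q / (p * p₄)) (by simp [*])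
  refine ((((a p₁ h₁).mul (a p₂ h₂)).mul (a p₃ h₃)).mul (a p₆ h₆)).congr fun m => ?_
  have c : (q * p₄ ^ 3 / (z * p₅)) ^ m = (q / (z * q / (p₁ * p₄))) ^ m *
      (q / (z * q / (p₂ * p₄))) ^ m * (q / (z * q / (p₃ * p₄))) ^ m *
      (q / (z * q / (p₆ * p₄))) ^ m := by
    rw [← mul_pow, ← mul_pow, ← mul_pow]; congr 1; field_simp
    linear_combination -h
  rw [c]
  ring

lemma tendsto_sixCrossValue (hq0 : q ≠ 0) (hq : ‖q‖ < 1) {z p₁ p₂ p₃ p₄ p₅ p₆ : ℂ}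
    (hz : z ≠ 0) (h₁ : p₁ ≠ 0) (h₂ : p₂ ≠ 0) (h₃ : p₃ ≠ 0) (h₄ : p₄ ≠ 0) (h₅ : p₅ ≠ 0)
    (h₆ : p₆ ≠ 0) (h : p₁ * p₂ * p₃ * p₄ * p₅ * p₆ = q * z ^ 3) :
    Tendsto (fun m : ℕ => sixCrossValue q z p₁ p₂ p₃ (p₄ * q ^ m) (p₅ / q ^ m) p₆ *
        (gauss q m ^ 4 * (q * p₄ ^ 3 / (z * p₅)) ^ m)) atTop
      (𝓝 (-(p₆ * qPochInf q q * thetaProd q (p₁ / p₆) * thetaProd q (p₁ * p₁ / z) *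
          thetaProd q (p₆ * p₆ / z)) *
        (qPochInf q (z * q / (p₁ * p₂)) * qPochInf q (z * q / (p₁ * p₃)) *
          qPochInf q (z * q / (p₁ * p₆)) * qPochInf q (z * q / (p₂ * p₃)) *
          qPochInf q (z * q / (p₂ * p₆)) * qPochInf q (z * q / (p₃ * p₆))) *
        qPochInf q (z * q / (p₄ * p₅)) *
        (thetaProd q (z * q / (p₁ * p₄)) * thetaProd q (z * q / (p₂ * p₄)) *
          thetaProd q (z * q / (p₃ * p₄)) * thetaProd q (z * q / (p₆ * p₄))) * (1 * 1 * 1 * 1))) := by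
  have a := tendsto_prod_qPochInf_div_pow hq0 hq hz h₁ h₂ h₃ h₄ h₅ h₆ h
  have b (p : ℂ) := tendsto_qPochInf_mul_pow hq (z * q / (p * p₅))
  refine (a.const_mul _ |>.mul
    ((((b p₁).mul (b p₂)).mul (b p₃)).mul (b p₆))).congr fun m => ?_
  have hm : q ^ m ≠ 0 := pow_ne_zero _ hq0
  have d1 (p : ℂ) : z * q / (p * (p₄ * q ^ m)) = z * q / (p * p₄) / q ^ m := by
    rw [div_div, mul_assoc]
  have d2 (p : ℂ) : z * q / (p * (p₅ / q ^ m)) = z * q / (p * p₅) * q ^ m := by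
    rw [mul_div_assoc', div_div_eq_mul_div]; ring
  have d3 : p₄ * q ^ m * (p₅ / q ^ m) = p₄ * p₅ := by field_simp
  rw [sixCrossValue, d3]
  simp only [d1, d2]
  ring

/-- The limit of the normalised shifted defect involves only ₆ψ₆ sums, known from `fourSum_eq`, and
vanishes by `thetaProd_balanced`. On the other side of the iteration the original defect stands
multiplied by theta functions that are nonzero. -/
lemma sixDefect_eq_zero_of_norm_lt (hq0 : q ≠ 0) (hq : ‖q‖ < 1) {z p₁ p₂ p₃ p₄ p₅ p₆ : ℂ}
    (hz : z ≠ 0) (h₁ : p₁ ≠ 0) (h₂ : p₂ ≠ 0) (h₃ : p₃ ≠ 0) (h₄ : p₄ ≠ 0) (h₅ : p₅ ≠ 0)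
    (h₆ : p₆ ≠ 0) (h : p₁ * p₂ * p₃ * p₄ * p₅ * p₆ = q * z ^ 3) (hlt : ‖p₄ * p₅ / z‖ < 1)
    (hw : ∀ k : ℤ, p₄ * p₅ / z ≠ q ^ k)
    (g₁ : thetaProd q (z * q / (p₁ * p₄)) ≠ 0) (g₂ : thetaProd q (z * q / (p₂ * p₄)) ≠ 0)
    (g₃ : thetaProd q (z * q / (p₃ * p₄)) ≠ 0) (g₆ : thetaProd q (z * q / (p₆ * p₄)) ≠ 0) :
    sixDefect q z p₁ p₂ p₃ p₄ p₅ p₆ = 0 := by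
  have ew : z ^ 2 * q / (p₁ * p₂ * p₃ * p₆) = p₄ * p₅ / z := by
    field_simp
    linear_combination -h
  have lt1 : ‖z ^ 2 * q / (p₁ * p₂ * p₃ * p₆)‖ < 1 := by rwa [ew]
  have lt2 : ‖z ^ 3 * q ^ 2 / (p₁ * p₂ * p₃ * p₄ * p₅ * p₆)‖ < 1 := by
    rw [h]; convert hq using 2; field_simp
  have lC := tendsto_sixCross hq0 hq hz h₁ h₂ h₃ h₄ h₅ h₆ lt1 lt2
  have lV := tendsto_sixCrossValue hq0 hq hz h₁ h₂ h₃ h₄ h₅ h₆ h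
  have f1 := fourSum_eq hq0 hq h₁ hz h₁ h₂ h₃ h₆ lt1
  have f6 := fourSum_eq hq0 hq h₆ hz h₁ h₂ h₃ h₆ lt1
  have bal := thetaProd_balanced hq0 hq hz h₁ h₂ h₃ h₄ h₆ (p₅ := p₅) (by linear_combination h)
  rw [ew] at f1 f6
  have hP : qPochInf q (p₄ * p₅ / z) ≠ 0 := qPochInf_ne_zero_of_forall_zpow hq0 hq hw
  have tq (p : ℂ) (hp : p ≠ 0) : thetaProd q (z * q / (p * p₄)) = thetaProd q (p * p₄ / z) := by
    rw [← thetaProd_q_div hq0 (p * p₄ / z), div_div_eq_mul_div, mul_comm q z]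
  have tw : thetaProd q (p₄ * p₅ / z) = qPochInf q (p₄ * p₅ / z) * qPochInf q (z * q / (p₄ * p₅)) := by
    rw [thetaProd, div_div_eq_mul_div, mul_comm q z]
  have lim0 := lC.sub lV
  have hL : (p₁ * (thetaProd q (p₆ * p₆ / z) * thetaProd q (p₆ * p₂ / z) * thetaProd q (p₆ * p₃ / z) *
          thetaProd q (p₆ * p₄ / z) * thetaProd q (p₆ * p₅ / z)) *
          (fourSum q p₁ z p₁ p₂ p₃ p₆ * thetaProd q (p₁ * q / p₄) * thetaProd q (p₁ * p₄ / z)) -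
        p₆ * (thetaProd q (p₁ * p₁ / z) * thetaProd q (p₁ * p₂ / z) * thetaProd q (p₁ * p₃ / z) *
          thetaProd q (p₁ * p₄ / z) * thetaProd q (p₁ * p₅ / z)) *
          (fourSum q p₆ z p₁ p₂ p₃ p₆ * thetaProd q (p₆ * q / p₄) *
            thetaProd q (p₆ * p₄ / z))) -
      (-(p₆ * qPochInf q q * thetaProd q (p₁ / p₆) * thetaProd q (p₁ * p₁ / z) *
          thetaProd q (p₆ * p₆ / z)) *
        (qPochInf q (z * q / (p₁ * p₂)) * qPochInf q (z * q / (p₁ * p₃)) *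
          qPochInf q (z * q / (p₁ * p₆)) * qPochInf q (z * q / (p₂ * p₃)) *
          qPochInf q (z * q / (p₂ * p₆)) * qPochInf q (z * q / (p₃ * p₆))) *
        qPochInf q (z * q / (p₄ * p₅)) *
        (thetaProd q (z * q / (p₁ * p₄)) * thetaProd q (z * q / (p₂ * p₄)) *
          thetaProd q (z * q / (p₃ * p₄)) * thetaProd q (z * q / (p₆ * p₄))) * (1 * 1 * 1 * 1)) = 0 := by
    rw [tq _ h₁, tq _ h₂, tq _ h₃, tq _ h₆]
    rw [tw, mul_comm p₄ p₂, mul_comm p₄ p₃] at bal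
    rw [sq p₁] at f1
    rw [sq p₆] at f6
    -- The ₆ψ₆ evaluations are available only after multiplication by this infinite product.
    refine (mul_eq_zero_iff_left hP).mp ?_
    generalize qPochInf q (z * q / (p₁ * p₂)) * qPochInf q (z * q / (p₁ * p₃)) *
          qPochInf q (z * q / (p₁ * p₆)) * qPochInf q (z * q / (p₂ * p₃)) *
          qPochInf q (z * q / (p₂ * p₆)) * qPochInf q (z * q / (p₃ * p₆)) = C at *
    linear_combination p₁ * (thetaProd q (p₆ * p₆ / z) * thetaProd q (p₆ * p₂ / z) *
        thetaProd q (p₆ * p₃ / z) * thetaProd q (p₆ * p₄ / z) * thetaProd q (p₆ * p₅ / z)) *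
        (thetaProd q (p₁ * q / p₄) * thetaProd q (p₁ * p₄ / z)) * f1 -
      p₆ * (thetaProd q (p₁ * p₁ / z) * thetaProd q (p₁ * p₂ / z) * thetaProd q (p₁ * p₃ / z) *
          thetaProd q (p₁ * p₄ / z) * thetaProd q (p₁ * p₅ / z)) *
          (thetaProd q (p₆ * q / p₄) * thetaProd q (p₆ * p₄ / z)) * f6 +
      C * qPochInf q q * thetaProd q (p₁ * p₁ / z) * thetaProd q (p₆ * p₆ / z) *
        thetaProd q (p₁ * p₄ / z) * thetaProd q (p₆ * p₄ / z) * bal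
  rw [hL] at lim0
  have a := (tendsto_prod_qPochInf_div_pow hq0 hq hz h₁ h₂ h₃ h₄ h₅ h₆ h).mul_const
    (sixDefect q z p₁ p₂ p₃ p₄ p₅ p₆)
  have b (p : ℂ) := tendsto_prod_qPochInf hq (z * q / (p * p₅))
  have c := ((((b p₁).mul (b p₂)).mul (b p₃)).mul (b p₆)).const_mul
    (qPochInf q (z * q / (p₁ * p₄)) * qPochInf q (z * q / (p₂ * p₄)) *
      qPochInf q (z * q / (p₃ * p₄)) * qPochInf q (z * q / (p₆ * p₄))) |>.mul lim0
  rw [mul_zero] at c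
  -- The iterated relation identifies two sequences; one tends to the theta product times the
  -- defect, the other to 0.
  have key := tendsto_nhds_unique a (c.congr fun m => ?_)
  · simpa [g₁, g₂, g₃, g₆] using key
  · have := sixDefect_iterate hq0 hq hz h₁ h₂ h₃ h₄ h₅ h₆ h m
    rw [← sub_mul, ← sixDefect, ← mul_assoc, ← this]
    ring

lemma sixDefect_reorder (q z p₁ p₂ p₃ p₄ p₅ p₆ : ℂ) :
    sixDefect q z p₁ p₂ p₃ p₄ p₅ p₆ = sixDefect q z p₁ p₂ p₅ p₄ p₃ p₆ := by
  have e (s : ℂ) : sixSum q s z p₁ p₂ p₃ p₄ p₅ p₆ = sixSum q s z p₁ p₂ p₅ p₄ p₃ p₆ := by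
    refine tsum_congr fun k => ?_
    rw [sixTerm_eq, sixTerm_eq]; ring
  rw [sixDefect, sixDefect, sixCross, sixCross, sixCrossValue, sixCrossValue, e, e,
    mul_comm p₅ p₄, mul_comm p₃ p₄, mul_comm p₃ p₅, mul_comm p₆ p₃, mul_comm p₆ p₅]
  ring

lemma thetaProd_z_ne_zero (hq0 : q ≠ 0) (hq : ‖q‖ < 1) {z x : ℂ}
    (h : ∀ k : ℤ, x / z ≠ q ^ k) : thetaProd q (z * q / x) ≠ 0 := by
  rw [mul_comm, ← div_div_eq_mul_div, thetaProd_q_div hq0]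
  exact thetaProd_ne_zero hq0 hq h

/-- The two-term relation for balanced six-parameter sums. -/
theorem sixCross_eq (hq0 : q ≠ 0) (hq : ‖q‖ < 1) {z p₁ p₂ p₃ p₄ p₅ p₆ : ℂ}
    (hz : z ≠ 0) (h₁ : p₁ ≠ 0) (h₂ : p₂ ≠ 0) (h₃ : p₃ ≠ 0) (h₄ : p₄ ≠ 0) (h₅ : p₅ ≠ 0)
    (h₆ : p₆ ≠ 0) (h : p₁ * p₂ * p₃ * p₄ * p₅ * p₆ = q * z ^ 3)
    (g₁ : ∀ k : ℤ, p₁ * p₄ / z ≠ q ^ k) (g₂ : ∀ k : ℤ, p₂ * p₄ / z ≠ q ^ k)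
    (g₃ : ∀ k : ℤ, p₃ * p₄ / z ≠ q ^ k) (g₅ : ∀ k : ℤ, p₅ * p₄ / z ≠ q ^ k)
    (g₆ : ∀ k : ℤ, p₆ * p₄ / z ≠ q ^ k) :
    sixCross q z p₁ p₂ p₃ p₄ p₅ p₆ = sixCrossValue q z p₁ p₂ p₃ p₄ p₅ p₆ := by
  -- Moving q^m from p₃ to p₄ makes p₄p₅/z small while preserving the balancing condition; the
  -- avoidance conditions are invariant under such shifts.
  obtain ⟨m, hm⟩ : ∃ m : ℕ, ‖p₄ * p₅ / z * q ^ m‖ < 1 := by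
    have := (tendsto_mul_pow_zero hq (p₄ * p₅ / z)).norm
    rw [norm_zero] at this
    exact (this.eventually_lt_const zero_lt_one).exists
  have hqm : q ^ m ≠ 0 := pow_ne_zero _ hq0
  have shift {x : ℂ} (hx : ∀ k : ℤ, x ≠ q ^ k) (k : ℤ) : x * q ^ m ≠ q ^ k := by
    intro he
    refine hx (k - m) ?_
    rw [zpow_sub₀ hq0, zpow_natCast, eq_div_iff hqm, he]
  have hE : sixDefect q z p₁ p₂ (p₃ / q ^ m) (p₄ * q ^ m) p₅ p₆ = 0 := by
    have s1 (p : ℂ) : p * (p₄ * q ^ m) / z = p * p₄ / z * q ^ m := by ring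
    refine sixDefect_eq_zero_of_norm_lt hq0 hq hz h₁ h₂ (div_ne_zero h₃ hqm) (mul_ne_zero h₄ hqm)
      h₅ h₆ (by field_simp; linear_combination h) ?_ ?_ (thetaProd_z_ne_zero hq0 hq ?_)
      (thetaProd_z_ne_zero hq0 hq ?_) (thetaProd_z_ne_zero hq0 hq ?_)
      (thetaProd_z_ne_zero hq0 hq ?_)
    · convert hm using 2; ring
    · rw [mul_comm, s1]; exact shift g₅
    · rw [s1]; exact shift g₁
    · rw [s1]; exact shift g₂
    · rw [show p₃ / q ^ m * (p₄ * q ^ m) = p₃ * p₄ by field_simp]; exact g₃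
    · rw [s1]; exact shift g₆
  -- The iteration with p₃ and p₅ exchanged carries the vanishing back to the original parameters.
  have it := sixDefect_iterate hq0 hq hz h₁ h₂ h₅ h₄ h₃ h₆ (by linear_combination h) m
  rw [← sixDefect_reorder q z p₁ p₂ p₃ p₄ p₅ p₆,
    ← sixDefect_reorder q z p₁ p₂ (p₃ / q ^ m) (p₄ * q ^ m) p₅ p₆, hE, mul_zero] at it
  have nz {p : ℂ} (hp : p ≠ 0) (g : ∀ k : ℤ, p * p₄ / z ≠ q ^ k) :
      qPochInf q (z * q / (p * p₄) / q ^ m) ≠ 0 := by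
    refine qPochInf_ne_zero_of_forall_zpow hq0 hq fun k hk => g (1 - k - m) ?_
    rw [zpow_sub₀ hq0, zpow_sub₀ hq0, zpow_one, zpow_natCast, ← hk]
    field_simp
  have := (mul_eq_zero_iff_left (mul_ne_zero (mul_ne_zero (mul_ne_zero (nz h₁ g₁) (nz h₂ g₂))
    (nz h₅ g₅)) (nz h₆ g₆))).mp it
  exact sub_eq_zero.mp this

/-! ### A bilateral Bailey transform -/

/-- A point of the quadrant is a combination of (1,1) and one of the axis directions, so only the
ratios along these three rays matter. If they are at most μ², the term is at most μ to the power 2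
max(N, K), hence at most μ^{N+K}. -/
lemma octant_bound {u₁ u₂ u₃ v₃ u₄ μ : ℝ} (h₁ : 0 ≤ u₁) (h₂ : 0 ≤ u₂) (h₃ : 0 ≤ u₃) (h₃' : 0 ≤ v₃)
    (h₄ : 0 ≤ u₄) (hμ0 : 0 ≤ μ) (hμ1 : μ ≤ 1) (b₁ : u₁ * u₃ * u₄ ≤ μ ^ 2)
    (b₂ : u₁ * u₂ * u₄ ^ 2 ≤ μ ^ 2) (b₃ : u₂ * v₃ * u₄ ≤ μ ^ 2) (N K : ℕ) :
    u₁ ^ N * u₂ ^ K * twoSided u₃ v₃ ((N : ℤ) - K) * u₄ ^ (N + K) ≤ μ ^ N * μ ^ K := by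
  have hμ (j M : ℕ) : (μ ^ 2) ^ j * (μ ^ 2) ^ M ≤ μ ^ (j + M) * μ ^ j := by
    have : μ ^ M ≤ 1 := pow_le_one₀ hμ0 hμ1
    calc (μ ^ 2) ^ j * (μ ^ 2) ^ M = (μ ^ j * μ ^ j * μ ^ M) * μ ^ M := by ring
      _ ≤ (μ ^ j * μ ^ j * μ ^ M) * 1 := by gcongr
      _ = _ := by ring
  rcases le_total K N with h | h
  · obtain ⟨M, rfl⟩ := Nat.exists_eq_add_of_le h
    rw [show ((K + M : ℕ) : ℤ) - K = (M : ℤ) by push_cast; ring, twoSided_natCast]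
    calc _ = (u₁ * u₂ * u₄ ^ 2) ^ K * (u₁ * u₃ * u₄) ^ M := by ring
      _ ≤ (μ ^ 2) ^ K * (μ ^ 2) ^ M := by gcongr
      _ ≤ _ := hμ K M
  · obtain ⟨M, rfl⟩ := Nat.exists_eq_add_of_le h
    rw [show (N : ℤ) - ((N + M : ℕ) : ℤ) = -(M : ℤ) by push_cast; ring, twoSided_neg_natCast]
    calc _ = (u₁ * u₂ * u₄ ^ 2) ^ N * (u₂ * v₃ * u₄) ^ M := by ring
      _ ≤ (μ ^ 2) ^ N * (μ ^ 2) ^ M := by gcongr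
      _ ≤ μ ^ (N + M) * μ ^ N := hμ N M
      _ = _ := mul_comm _ _

/-- The hypotheses are the ratios along the eight rays formed by the axes and the diagonals; each
quadrant is an instance of `octant_bound` after reflection. -/
lemma lattice_bound {u₁ v₁ u₂ v₂ u₃ v₃ u₄ v₄ μ : ℝ} (h₁ : 0 ≤ u₁) (h₁' : 0 ≤ v₁) (h₂ : 0 ≤ u₂)
    (h₂' : 0 ≤ v₂) (h₃ : 0 ≤ u₃) (h₃' : 0 ≤ v₃) (h₄ : 0 ≤ u₄) (h₄' : 0 ≤ v₄) (hμ0 : 0 ≤ μ)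
    (hμ1 : μ ≤ 1) (b₁ : u₁ * u₃ * u₄ ≤ μ ^ 2) (b₂ : v₁ * v₃ * v₄ ≤ μ ^ 2)
    (c₁ : u₁ * u₂ * u₄ ^ 2 ≤ μ ^ 2) (c₂ : u₁ * v₂ * u₃ ^ 2 ≤ μ ^ 2)
    (c₃ : v₁ * u₂ * v₃ ^ 2 ≤ μ ^ 2) (c₄ : v₁ * v₂ * v₄ ^ 2 ≤ μ ^ 2)
    (d₁ : u₂ * v₃ * u₄ ≤ μ ^ 2) (d₂ : v₂ * u₃ * v₄ ≤ μ ^ 2) (n k : ℤ) :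
    twoSided u₁ v₁ n * twoSided u₂ v₂ k * twoSided u₃ v₃ (n - k) * twoSided u₄ v₄ (n + k) ≤
      twoSided μ μ n * twoSided μ μ k := by
  obtain ⟨N, rfl | rfl⟩ := n.eq_nat_or_neg <;> obtain ⟨K, rfl | rfl⟩ := k.eq_nat_or_neg
  · rw [show (N : ℤ) + K = ((N + K : ℕ) : ℤ) by push_cast; ring]
    simp only [twoSided_natCast]
    exact octant_bound h₁ h₂ h₃ h₃' h₄ hμ0 hμ1 b₁ c₁ d₁ N K
  · rw [show (N : ℤ) - -K = ((N + K : ℕ) : ℤ) by push_cast; ring,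
      show (N : ℤ) + -K = N - K by ring, mul_right_comm]
    simp only [twoSided_natCast, twoSided_neg_natCast]
    exact octant_bound h₁ h₂' h₄ h₄' h₃ hμ0 hμ1 (by linarith) c₂ (by linarith) N K
  · rw [show -(N : ℤ) - K = -((N + K : ℕ) : ℤ) by push_cast; ring,
      show -(N : ℤ) + K = -(N - K) by ring, mul_right_comm, twoSided_neg _ _ ((N : ℤ) - K)]
    simp only [twoSided_natCast, twoSided_neg_natCast]
    exact octant_bound h₁' h₂ h₄' h₄ h₃' hμ0 hμ1 (by linarith) c₃ (by linarith) N K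
  · rw [show -(N : ℤ) + -K = -((N + K : ℕ) : ℤ) by push_cast; ring,
      show -(N : ℤ) - -K = -(N - K) by ring, twoSided_neg _ _ ((N : ℤ) - K)]
    simp only [twoSided_neg_natCast]
    exact octant_bound h₁' h₂' h₃' h₃ h₄' hμ0 hμ1 b₂ c₄ d₂ N K

/-- The part of the double series depending on the first index only. -/
def baileyLeft (q t a f g : ℂ) (n : ℤ) : ℂ :=
  (1 - t ^ 2 / a * q ^ (2 * n)) * (pairTerm q (t * q / f) (a / (t * f)) n *
    pairTerm q (t * q / g) (a / (t * g)) n) * (t ^ 4 * q / a ^ 2) ^ n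

/-- The part of the double series depending on the second index only. -/
def baileyRight (q s z b c d e : ℂ) (k : ℤ) : ℂ :=
  (1 - s ^ 2 / z * q ^ (2 * k)) * (pairTerm q (s * q / b) (z / (s * b)) k *
    pairTerm q (s * q / c) (z / (s * c)) k * pairTerm q (s * q / d) (z / (s * d)) k *
    pairTerm q (s * q / e) (z / (s * e)) k) * (s ^ 6 * q ^ 2 / z ^ 3) ^ k

/-- The double series behind the transform. -/
def baileyTerm (q t s a z b c d e f g : ℂ) (n k : ℤ) : ℂ :=
  baileyLeft q t a f g n * baileyRight q s z b c d e k *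
    (pairTerm q (t * q / s) (a * s / (t * z)) (n - k) *
      pairTerm q (t * s * q / z) (a / (t * s)) (n + k)) / q ^ k

lemma pairTerm_cross (hq0 : q ≠ 0) (t s a z : ℂ) (n k : ℤ) :
    pairTerm q (t * q / s) (a * s / (t * z)) (n - k) *
      pairTerm q (t * s * q / z) (a / (t * s)) (n + k) =
    qPochInf q (t * q / s * q ^ (n - k)) * qPochInf q (a * s / (t * z) * q ^ (1 - (n - k))) *
      (qPochInf q (t * s * q / z * q ^ (n + k)) * qPochInf q (a / (t * s) * q ^ (1 - (n + k)))) *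
      (gauss q n ^ 2 * gauss q k ^ 2 * q ^ k) := by
  rw [← gauss_sub_mul_gauss_add hq0, pairTerm, pairTerm]
  ring

/-- For fixed k the four coupled infinite products regroup into the factors of the two parameters
z/(s q^k) and s q^k, over the base point t with modulus a. -/
lemma baileyTerm_eq_fourTerm (hq0 : q ≠ 0) {t s a z : ℂ} (b c d e f g : ℂ) (ht : t ≠ 0)
    (hs : s ≠ 0) (hz : z ≠ 0) (n k : ℤ) :
    baileyTerm q t s a z b c d e f g n k = baileyRight q s z b c d e k * gauss q k ^ 2 *
      fourTerm q t a f g (z / (s * q ^ k)) (s * q ^ k) n := by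
  have hk : q ^ k ≠ 0 := zpow_ne_zero _ hq0
  have hn : q ^ n ≠ 0 := zpow_ne_zero _ hq0
  have e1 : t * q / (z / (s * q ^ k)) * q ^ n = t * s * q / z * q ^ (n + k) := by
    rw [zpow_add₀ hq0]; field_simp
  have e2 : a / (t * (z / (s * q ^ k))) * q ^ (1 - n) = a * s / (t * z) * q ^ (1 - (n - k)) := by
    rw [zpow_sub₀ hq0, zpow_sub₀ hq0, zpow_sub₀ hq0]; field_simp
  have e3 : t * q / (s * q ^ k) * q ^ n = t * q / s * q ^ (n - k) := by
    rw [zpow_sub₀ hq0]; field_simp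
  have e4 : a / (t * (s * q ^ k)) * q ^ (1 - n) = a / (t * s) * q ^ (1 - (n + k)) := by
    rw [zpow_sub₀ hq0, zpow_sub₀ hq0, zpow_add₀ hq0]; field_simp
  have E1 : pairTerm q (t * q / (z / (s * q ^ k))) (a / (t * (z / (s * q ^ k)))) n =
      qPochInf q (t * s * q / z * q ^ (n + k)) * qPochInf q (a * s / (t * z) * q ^ (1 - (n - k))) *
        gauss q n := by rw [pairTerm, e1, e2]
  have E2 : pairTerm q (t * q / (s * q ^ k)) (a / (t * (s * q ^ k))) n =
      qPochInf q (t * q / s * q ^ (n - k)) * qPochInf q (a / (t * s) * q ^ (1 - (n + k))) *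
        gauss q n := by rw [pairTerm, e3, e4]
  rw [baileyTerm, pairTerm_cross hq0, fourTerm_eq, E1, E2, baileyLeft, div_eq_iff hk]
  generalize qPochInf q (a * s / (t * z) * q ^ (1 - (n - k))) = A₁
  generalize qPochInf q (t * q / s * q ^ (n - k)) = A₂
  generalize qPochInf q (t * s * q / z * q ^ (n + k)) = A₃
  generalize qPochInf q (a / (t * s) * q ^ (1 - (n + k))) = A₄
  generalize 1 - t ^ 2 / a * q ^ (2 * n) = y
  generalize (t ^ 4 * q / a ^ 2) ^ n = w
  ring

/-- The same four products, paired differently, are the factors of two parameters over the base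
point s with modulus z. Their product z²/a is independent of n, which keeps the inner sum balanced.
-/
lemma baileyTerm_eq_sixTerm (hq0 : q ≠ 0) {t s a z : ℂ} (b c d e f g : ℂ) (ht : t ≠ 0)
    (hs : s ≠ 0) (hz : z ≠ 0) (ha : a ≠ 0) (n k : ℤ) :
    baileyTerm q t s a z b c d e f g n k = baileyLeft q t a f g n * gauss q n ^ 2 *
      sixTerm q s z b c d e (t * q ^ n * z / a) (z / (t * q ^ n)) k := by
  have hk : q ^ k ≠ 0 := zpow_ne_zero _ hq0
  have hn : q ^ n ≠ 0 := zpow_ne_zero _ hq0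
  have e1 : s * q / (z / (t * q ^ n)) * q ^ k = t * s * q / z * q ^ (n + k) := by
    rw [zpow_add₀ hq0]; field_simp
  have e2 : z / (s * (z / (t * q ^ n))) * q ^ (1 - k) = t * q / s * q ^ (n - k) := by
    rw [zpow_sub₀ hq0, zpow_sub₀ hq0, zpow_one]; field_simp
  have e3 : s * q / (t * q ^ n * z / a) * q ^ k = a * s / (t * z) * q ^ (1 - (n - k)) := by
    rw [zpow_sub₀ hq0, zpow_sub₀ hq0, zpow_one]; field_simp
  have e4 : z / (s * (t * q ^ n * z / a)) * q ^ (1 - k) = a / (t * s) * q ^ (1 - (n + k)) := by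
    rw [zpow_sub₀ hq0, zpow_sub₀ hq0, zpow_add₀ hq0]; field_simp
  have E1 : pairTerm q (s * q / (z / (t * q ^ n))) (z / (s * (z / (t * q ^ n)))) k =
      qPochInf q (t * s * q / z * q ^ (n + k)) * qPochInf q (t * q / s * q ^ (n - k)) *
        gauss q k := by rw [pairTerm, e1, e2]
  have E2 : pairTerm q (s * q / (t * q ^ n * z / a)) (z / (s * (t * q ^ n * z / a))) k =
      qPochInf q (a * s / (t * z) * q ^ (1 - (n - k))) *
        qPochInf q (a / (t * s) * q ^ (1 - (n + k))) * gauss q k := by rw [pairTerm, e3, e4]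
  rw [baileyTerm, pairTerm_cross hq0, sixTerm_eq, E1, E2, baileyRight, div_eq_iff hk]
  generalize qPochInf q (a * s / (t * z) * q ^ (1 - (n - k))) = A₁
  generalize qPochInf q (t * q / s * q ^ (n - k)) = A₂
  generalize qPochInf q (t * s * q / z * q ^ (n + k)) = A₃
  generalize qPochInf q (a / (t * s) * q ^ (1 - (n + k))) = A₄
  generalize 1 - s ^ 2 / z * q ^ (2 * k) = y
  generalize (s ^ 6 * q ^ 2 / z ^ 3) ^ k = w
  ring

lemma exists_norm_baileyLeft_le (hq0 : q ≠ 0) (hq : ‖q‖ < 1) {t a f g : ℂ} (ht : t ≠ 0)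
    (ha : a ≠ 0) (hf : f ≠ 0) (hg : g ≠ 0) :
    ∃ C : ℝ, 0 ≤ C ∧ ∀ n, ‖baileyLeft q t a f g n‖ ≤
      C * twoSided ‖t ^ 2 * q / (f * g)‖ ‖a ^ 2 / (t ^ 2 * f * g * q)‖ n := by
  have bd {p : ℂ} (hp : p ≠ 0) := geomBound_pairTerm hq0 hq (l := (⊤ : Filter Unit))
    (α := fun _ => t * q / p) (β := fun _ => a / (t * p)) tendsto_const_nhds tendsto_const_nhds
    (by simp [*]) (by simp [*])
  have hB := ((geomBound_one_sub hq0 hq (l := (⊤ : Filter Unit)) (c := fun _ => t ^ 2 / a)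
    tendsto_const_nhds).mul ((bd hf).mul (bd hg))).mul (geomBound_zpow fun _ => t ^ 4 * q / a ^ 2)
  obtain ⟨C, hC, h⟩ := hB.congr (Eventually.of_forall fun _ _ => rfl)
    (u' := fun _ => t ^ 2 * q / (f * g)) (v' := fun _ => a ^ 2 / (t ^ 2 * f * g * q))
    (Eventually.of_forall fun _ => by field_simp) (Eventually.of_forall fun _ => by field_simp)
  obtain ⟨_, h⟩ := h.exists
  exact ⟨C, hC, h⟩

lemma exists_norm_baileyRight_le (hq0 : q ≠ 0) (hq : ‖q‖ < 1) {s a z b c d e : ℂ} (hs : s ≠ 0)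
    (ha : a ≠ 0) (hz : z ≠ 0) (hb : b ≠ 0) (hc : c ≠ 0) (hd : d ≠ 0) (he : e ≠ 0)
    (h : b * c * d * e = a * q * z) :
    ∃ C : ℝ, 0 ≤ C ∧ ∀ k, ‖baileyRight q s z b c d e k / q ^ k‖ ≤
      C * twoSided ‖s ^ 2 / a‖ ‖z ^ 2 / (s ^ 2 * a)‖ k := by
  have bd {p : ℂ} (hp : p ≠ 0) := geomBound_pairTerm hq0 hq (l := (⊤ : Filter Unit))
    (α := fun _ => s * q / p) (β := fun _ => z / (s * p)) tendsto_const_nhds tendsto_const_nhds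
    (by simp [*]) (by simp [*])
  have hB := (((geomBound_one_sub hq0 hq (l := (⊤ : Filter Unit)) (c := fun _ => s ^ 2 / z)
    tendsto_const_nhds).mul ((((bd hb).mul (bd hc)).mul (bd hd)).mul (bd he))).mul
    (geomBound_zpow fun _ => s ^ 6 * q ^ 2 / z ^ 3)).mul (geomBound_zpow fun _ => q⁻¹)
  obtain ⟨C, hC, h⟩ := hB.congr (G := fun _ k => baileyRight q s z b c d e k / q ^ k)
    (Eventually.of_forall fun _ k => by rw [inv_zpow, ← div_eq_mul_inv]; rfl)
    (u' := fun _ => s ^ 2 / a) (v' := fun _ => z ^ 2 / (s ^ 2 * a))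
    (Eventually.of_forall fun _ => by
      field_simp
      linear_combination -h)
    (Eventually.of_forall fun _ => by
      field_simp
      linear_combination -h)
  obtain ⟨_, h⟩ := h.exists
  exact ⟨C, hC, h⟩

lemma summable_baileyTerm (hq0 : q ≠ 0) (hq : ‖q‖ < 1) {t s a z b c d e f g : ℂ} (ht : t ≠ 0)
    (hs : s ≠ 0) (ha : a ≠ 0) (hz : z ≠ 0) (hb : b ≠ 0) (hc : c ≠ 0) (hd : d ≠ 0) (he : e ≠ 0)
    (hf : f ≠ 0) (hg : g ≠ 0) (h : b * c * d * e = a * q * z)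
    (hρ : ‖a ^ 2 * q / (f * g * z)‖ < 1) (hρσ : ‖a * q / (f * g)‖ < 1) :
    Summable (Function.uncurry (baileyTerm q t s a z b c d e f g)) := by
  obtain ⟨C₁, hC₁, B₁⟩ := exists_norm_baileyLeft_le hq0 hq ht ha hf hg
  obtain ⟨C₂, hC₂, B₂⟩ := exists_norm_baileyRight_le hq0 hq hs ha hz hb hc hd he h
  have n₃ : t * q / s ≠ 0 := by simp [*]
  have n₃' : a * s / (t * z) ≠ 0 := by simp [*]
  have n₄ : t * s * q / z ≠ 0 := by simp [*]
  have n₄' : a / (t * s) ≠ 0 := by simp [*]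
  have B₃ := fun j => norm_pairTerm_le hq0 hq (norm_pos_iff.mpr n₃) (norm_pos_iff.mpr n₃') le_rfl
    le_rfl j
  have B₄ := fun j => norm_pairTerm_le hq0 hq (norm_pos_iff.mpr n₄) (norm_pos_iff.mpr n₄') le_rfl
    le_rfl j
  obtain ⟨C₃, hC₃⟩ : ∃ C₃, C₃ = pairConst q ‖t * q / s‖ ‖a * s / (t * z)‖ := ⟨_, rfl⟩
  obtain ⟨C₄, hC₄⟩ : ∃ C₄, C₄ = pairConst q ‖t * s * q / z‖ ‖a / (t * s)‖ := ⟨_, rfl⟩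
  rw [← hC₃] at B₃
  rw [← hC₄] at B₄
  have hC₃0 : 0 ≤ C₃ := hC₃ ▸ Real.exp_nonneg _
  have hC₄0 : 0 ≤ C₄ := hC₄ ▸ Real.exp_nonneg _
  -- L dominates the ratios along all rays: a²q/(fgz) on the n-axis, aq/(fg) on the diagonals and q
  -- on the k-axis. Thus the hypotheses of the theorem are what the double series needs.
  obtain ⟨L, hL⟩ : ∃ L, L = max (max ‖a ^ 2 * q / (f * g * z)‖ ‖a * q / (f * g)‖) ‖q‖ := ⟨_, rfl⟩
  have hL0 : 0 ≤ L := hL ▸ (norm_nonneg q).trans (le_max_right _ _)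
  have hL1 : L < 1 := hL ▸ max_lt (max_lt hρ hρσ) hq
  have l1 : ‖a ^ 2 * q / (f * g * z)‖ ≤ L := hL ▸ (le_max_left _ _).trans (le_max_left _ _)
  have l2 : ‖a * q / (f * g)‖ ≤ L := hL ▸ (le_max_right _ _).trans (le_max_left _ _)
  have l3 : ‖q‖ ≤ L := hL ▸ le_max_right _ _
  have hμ0 := Real.sqrt_nonneg L
  have hμ1 : √L < 1 := by rwa [Real.sqrt_lt' one_pos, one_pow]
  have hμ2 : √L ^ 2 = L := Real.sq_sqrt hL0
  have S := ((summable_twoSided hμ0 hμ0 hμ1 hμ1).mul_of_nonneg (summable_twoSided hμ0 hμ0 hμ1 hμ1)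
    (fun n => twoSided_nonneg hμ0 hμ0 n) (fun n => twoSided_nonneg hμ0 hμ0 n)).mul_left
    (C₁ * C₂ * C₃ * C₄)
  refine Summable.of_norm_bounded S ?_
  rintro ⟨n, k⟩
  have key := lattice_bound (u₁ := ‖t ^ 2 * q / (f * g)‖) (v₁ := ‖a ^ 2 / (t ^ 2 * f * g * q)‖)
    (u₂ := ‖s ^ 2 / a‖) (v₂ := ‖z ^ 2 / (s ^ 2 * a)‖) (u₃ := ‖a * s / (t * z)‖)
    (v₃ := ‖t * q / s‖) (u₄ := ‖a / (t * s)‖) (v₄ := ‖t * s * q / z‖) (norm_nonneg _) (norm_nonneg _)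
    (norm_nonneg _) (norm_nonneg _) (norm_nonneg _) (norm_nonneg _) (norm_nonneg _) (norm_nonneg _)
    hμ0 hμ1.le
    (by rw [hμ2, ← norm_mul, ← norm_mul]; convert l1 using 2; field_simp)
    (by rw [hμ2, ← norm_mul, ← norm_mul]; convert l1 using 2; field_simp)
    (by rw [hμ2, ← norm_pow, ← norm_mul, ← norm_mul]; convert l2 using 2; field_simp)
    (by rw [hμ2, ← norm_pow, ← norm_mul, ← norm_mul]; convert l2 using 2; field_simp)
    (by rw [hμ2, ← norm_pow, ← norm_mul, ← norm_mul]; convert l2 using 2; field_simp)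
    (by rw [hμ2, ← norm_pow, ← norm_mul, ← norm_mul]; convert l2 using 2; field_simp)
    (by rw [hμ2, ← norm_mul, ← norm_mul]; convert l3 using 2; field_simp)
    (by rw [hμ2, ← norm_mul, ← norm_mul]; convert l3 using 2; field_simp) n k
  have e : Function.uncurry (baileyTerm q t s a z b c d e f g) (n, k) =
      baileyLeft q t a f g n * (baileyRight q s z b c d e k / q ^ k) *
      pairTerm q (t * q / s) (a * s / (t * z)) (n - k) *
      pairTerm q (t * s * q / z) (a / (t * s)) (n + k) := by
    rw [Function.uncurry_apply_pair, baileyTerm]; ring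
  have p₁ := twoSided_nonneg (norm_nonneg (t ^ 2 * q / (f * g)))
    (norm_nonneg (a ^ 2 / (t ^ 2 * f * g * q))) n
  have p₂ := twoSided_nonneg (norm_nonneg (s ^ 2 / a)) (norm_nonneg (z ^ 2 / (s ^ 2 * a))) k
  have p₃ := twoSided_nonneg (norm_nonneg (a * s / (t * z))) (norm_nonneg (t * q / s)) (n - k)
  rw [e, norm_mul, norm_mul, norm_mul]
  refine (mul_le_mul (mul_le_mul (mul_le_mul (B₁ n) (B₂ k) (norm_nonneg _) (by positivity))
    (B₃ (n - k)) (norm_nonneg _) (by positivity)) (B₄ (n + k)) (norm_nonneg _)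
    (by positivity)).trans ?_
  refine le_trans (le_of_eq ?_) (mul_le_mul_of_nonneg_left key (by positivity :
    0 ≤ C₁ * C₂ * C₃ * C₄))
  ring

/-- Since the last two parameters of the ₆ψ₆ have product z, two of the six products in its value
are independent of k; the other four rebuild the factors of fz/a and gz/a. -/
lemma tsum_baileyTerm_left (hq0 : q ≠ 0) (hq : ‖q‖ < 1) {t s a z b c d e f g : ℂ} (ht : t ≠ 0)
    (hs : s ≠ 0) (ha : a ≠ 0) (hz : z ≠ 0) (hf : f ≠ 0) (hg : g ≠ 0)
    (hρ : ‖a ^ 2 * q / (f * g * z)‖ < 1) (k : ℤ) :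
    qPochInf q (a ^ 2 * q / (f * g * z)) * ∑' n, baileyTerm q t s a z b c d e f g n k =
      qPochInf q (a * q / (f * g)) * qPochInf q (a * q / z) *
        (qPochInf q q * thetaProd q (t ^ 2 / a)) *
        sixTerm q s z b c d e (f * z / a) (g * z / a) k := by
  have hk : q ^ k ≠ 0 := zpow_ne_zero _ hq0
  have hy : s * q ^ k ≠ 0 := mul_ne_zero hs hk
  have e0 : a ^ 2 * q / (f * g * (z / (s * q ^ k)) * (s * q ^ k)) = a ^ 2 * q / (f * g * z) := by
    field_simp
  have h4 := fourSum_eq hq0 hq ht ha hf hg (div_ne_zero hz hy) hy (by rwa [e0])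
  have e1 : z / (s * q ^ k) * (s * q ^ k) = z := by field_simp
  rw [e0, e1] at h4
  simp only [baileyTerm_eq_fourTerm hq0 b c d e f g ht hs hz]
  rw [tsum_mul_left, ← fourSum, mul_left_comm, h4]
  have d1 (p : ℂ) (hp : p ≠ 0) : pairTerm q (s * q / (p * z / a)) (z / (s * (p * z / a))) k =
      qPochInf q (a * q / (p * (z / (s * q ^ k)))) * qPochInf q (a * q / (p * (s * q ^ k))) *
        gauss q k := by
    rw [pairTerm]
    congr 3
    · field_simp
    · rw [zpow_sub₀ hq0, zpow_one]; field_simp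
  rw [sixTerm_eq, d1 f hf, d1 g hg, baileyRight]
  generalize (s ^ 6 * q ^ 2 / z ^ 3) ^ k = w
  generalize 1 - s ^ 2 / z * q ^ (2 * k) = y
  ring

/-- The bilateral Bailey transform: evaluate the double series in both orders. -/
theorem bailey_transform (hq0 : q ≠ 0) (hq : ‖q‖ < 1) {t s a z b c d e f g : ℂ} (ht : t ≠ 0)
    (hs : s ≠ 0) (ha : a ≠ 0) (hz : z ≠ 0) (hb : b ≠ 0) (hc : c ≠ 0) (hd : d ≠ 0) (he : e ≠ 0)
    (hf : f ≠ 0) (hg : g ≠ 0) (h : b * c * d * e = a * q * z)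
    (hρ : ‖a ^ 2 * q / (f * g * z)‖ < 1) (hρσ : ‖a * q / (f * g)‖ < 1) :
    (Summable fun n => baileyLeft q t a f g n * (gauss q n ^ 2 *
      sixSum q s z b c d e (t * q ^ n * z / a) (z / (t * q ^ n)))) ∧
    qPochInf q (a ^ 2 * q / (f * g * z)) * ∑' n, baileyLeft q t a f g n * (gauss q n ^ 2 *
      sixSum q s z b c d e (t * q ^ n * z / a) (z / (t * q ^ n))) =
      qPochInf q (a * q / (f * g)) * qPochInf q (a * q / z) *
        (qPochInf q q * thetaProd q (t ^ 2 / a)) *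
        sixSum q s z b c d e (f * z / a) (g * z / a) := by
  have S := summable_baileyTerm hq0 hq ht hs ha hz hb hc hd he hf hg h hρ hρσ
  have e1 (n : ℤ) : ∑' k, baileyTerm q t s a z b c d e f g n k = baileyLeft q t a f g n *
      (gauss q n ^ 2 * sixSum q s z b c d e (t * q ^ n * z / a) (z / (t * q ^ n))) := by
    simp only [baileyTerm_eq_sixTerm hq0 b c d e f g ht hs hz ha]
    rw [tsum_mul_left, ← sixSum, mul_assoc]
  have e2 := S.tsum_comm
  simp only [e1] at e2
  have S1 := S.prod
  simp only [Function.uncurry_apply_pair, e1] at S1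
  refine ⟨S1, ?_⟩
  rw [← e2, ← tsum_mul_left, sixSum, ← tsum_mul_left]
  exact tsum_congr fun k => tsum_baileyTerm_left hq0 hq ht hs ha hz hf hg hρ k

/-! ### Inner sums of the transform -/

lemma baileyLeft_mul {t a : ℂ} (b c d e f g : ℂ) (ha : a ≠ 0) (n : ℤ) :
    baileyLeft q t a f g n * (pairTerm q (t * q / b) (a / (t * b)) n *
      pairTerm q (t * q / c) (a / (t * c)) n * pairTerm q (t * q / d) (a / (t * d)) n *
      pairTerm q (t * q / e) (a / (t * e)) n * (t ^ 2 * q / a) ^ n) =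
      sixTerm q t a b c d e f g n := by
  have w : (t ^ 6 * q ^ 2 / a ^ 3) ^ n = (t ^ 4 * q / a ^ 2) ^ n * (t ^ 2 * q / a) ^ n := by
    rw [← mul_zpow]; congr 1; field_simp
  rw [sixTerm_eq, baileyLeft, w]
  generalize 1 - t ^ 2 / a * q ^ (2 * n) = y
  generalize (t ^ 4 * q / a ^ 2) ^ n = w₁
  generalize (t ^ 2 * q / a) ^ n = w₂
  ring

lemma pairTerm_succ (hq0 : q ≠ 0) (hq : ‖q‖ < 1) (α β : ℂ) (n : ℤ) :
    (1 - α * q ^ n) * pairTerm q α β (n + 1) = -((q ^ n - β) * pairTerm q α β n) := by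
  have hn : q ^ n ≠ 0 := zpow_ne_zero _ hq0
  have e1 : qPochInf q (α * q ^ n) = (1 - α * q ^ n) * qPochInf q (α * q ^ (n + 1)) := by
    rw [qPochInf_eq_mul hq, zpow_add_one₀ hq0, mul_assoc]
  have e2 : qPochInf q (β * q ^ (1 - (n + 1))) =
      (1 - β / q ^ n) * qPochInf q (β * q ^ (1 - n)) := by
    rw [qPochInf_eq_mul hq, show 1 - (n + 1) = -n by ring, zpow_neg, ← div_eq_mul_inv,
      zpow_sub₀ hq0, zpow_one]
    congr 2; ring
  rw [pairTerm, pairTerm, e1, e2, gauss_succ hq0]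
  generalize qPochInf q (α * q ^ (n + 1)) = A
  generalize qPochInf q (β * q ^ (1 - n)) = B
  field_simp

/-- The parameter b kills the terms with k < 0 and the last parameter those with k > n; for negative
n nothing remains. -/
lemma sixSum_eq_zero_of_neg (hq0 : q ≠ 0) {b z : ℂ} (c d e p : ℂ) (hb : b ≠ 0) (hz : z ≠ 0) {n : ℤ}
    (hn : n < 0) : sixSum q b z b c d e p (z / (b * q ^ n)) = 0 := by
  have hQ : q ^ n ≠ 0 := zpow_ne_zero _ hq0
  rw [sixSum]
  convert tsum_zero with k
  rw [sixTerm_eq]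
  rcases lt_or_ge k 0 with hk | hk
  · have : pairTerm q (b * q / b) (z / (b * b)) k = 0 := by
      rw [pairTerm, mul_div_cancel_left₀ _ hb, ← zpow_one_add₀ hq0,
        qPochInf_zpow_eq_zero hq0 (by omega)]
      ring
    rw [this]; ring
  · have : pairTerm q (b * q / (z / (b * q ^ n))) (z / (b * (z / (b * q ^ n)))) k = 0 := by
      have e : z / (b * (z / (b * q ^ n))) * q ^ (1 - k) = q ^ (n + (1 - k)) := by
        rw [zpow_add₀ hq0]; field_simp
      rw [pairTerm, e, qPochInf_zpow_eq_zero hq0 (by omega)]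
      ring
    rw [this]; ring

lemma sixSum_eq_single (hq0 : q ≠ 0) {b z : ℂ} (c d e p : ℂ) (hb : b ≠ 0) (hz : z ≠ 0) :
    sixSum q b z b c d e p (z / b) = sixTerm q b z b c d e p (z / b) 0 := by
  rw [sixSum]
  refine tsum_eq_single 0 fun k hk => ?_
  rw [sixTerm_eq]
  rcases lt_or_gt_of_ne hk with hk | hk
  · have : pairTerm q (b * q / b) (z / (b * b)) k = 0 := by
      rw [pairTerm, mul_div_cancel_left₀ _ hb, ← zpow_one_add₀ hq0,
        qPochInf_zpow_eq_zero hq0 (by omega)]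
      ring
    rw [this]; ring
  · have : pairTerm q (b * q / (z / b)) (z / (b * (z / b))) k = 0 := by
      have e : z / (b * (z / b)) * q ^ (1 - k) = q ^ (1 - k) := by field_simp
      rw [pairTerm, e, qPochInf_zpow_eq_zero hq0 (by omega)]
      ring
    rw [this]; ring

/-- In the contiguous relation for these parameters the boundary term contains the theta function at
q^{-n}, which is 0; two consecutive terminating sums are thus proportional. -/
lemma sixSum_terminating_succ (hq0 : q ≠ 0) (hq : ‖q‖ < 1) {a z b c d e : ℂ} (ha : a ≠ 0)
    (hz : z ≠ 0) (hb : b ≠ 0) (hc : c ≠ 0) (hd : d ≠ 0) (he : e ≠ 0)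
    (h : b * c * d * e = a * q * z) (n : ℕ) :
    (1 - b / (b * q ^ (n + 1))) * (1 - c / (b * q ^ (n + 1))) * (1 - d / (b * q ^ (n + 1))) *
        (1 - e / (b * q ^ (n + 1))) *
        sixSum q b z b c d e (b * q ^ (n + 1) * z / a) (z / (b * q ^ (n + 1))) =
      (a / (b ^ 2 * (q ^ n) ^ 2 * q)) ^ 3 * ((1 - b * q ^ n * b / a) * (1 - b * q ^ n * c / a) *
        (1 - b * q ^ n * d / a) * (1 - b * q ^ n * e / a)) *
        sixSum q b z b c d e (b * q ^ n * z / a) (z / (b * q ^ n)) := by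
  have hQ : q ^ n ≠ 0 := pow_ne_zero _ hq0
  have hQ' : q ^ (n + 1) ≠ 0 := pow_ne_zero _ hq0
  have key := sixSum_contiguous hq0 hq (r₁ := b) (r₂ := c) (r₃ := d) (r₄ := e)
    (r₅ := b * q ^ n * z / a) (r₆ := z / (b * q ^ (n + 1))) hz hb hc hd he (by simp [*])
    (by simp [*]) (by rw [h, pow_succ]; field_simp)
  have e0 : b * q * (z / (b * q ^ (n + 1))) / z = q ^ (-(n : ℤ)) := by
    rw [zpow_neg, zpow_natCast, pow_succ]; field_simp
  have e1 : q * (b * q ^ n * z / a) = b * q ^ (n + 1) * z / a := by rw [pow_succ]; ring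
  have e2 : q * (z / (b * q ^ (n + 1))) = z / (b * q ^ n) := by rw [pow_succ]; field_simp
  have e3 (p : ℂ) : z / (b * q ^ (n + 1)) * p / z = p / (b * q ^ (n + 1)) := by field_simp
  have e4 (p : ℂ) : b * q ^ n * z / a * p / z = b * q ^ n * p / a := by field_simp
  rw [e0, thetaProd_zpow_eq_zero hq0, mul_zero, mul_zero, neg_zero, e1, e2] at key
  simp only [e3, e4] at key
  have e5 : (a / (b ^ 2 * (q ^ n) ^ 2 * q)) ^ 3 * (b * q ^ n * z / a) ^ 3 =
      (z / (b * q ^ (n + 1))) ^ 3 := by rw [pow_succ q n]; field_simp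
  have hne : (b * q ^ n * z / a) ^ 3 ≠ 0 := by simp [ha, hb, hz, hq0]
  refine mul_left_cancel₀ hne ?_
  generalize (z / (b * q ^ (n + 1))) ^ 3 = X at *
  generalize (b * q ^ n * z / a) ^ 3 = Y at *
  generalize (a / (b ^ 2 * (q ^ n) ^ 2 * q)) ^ 3 = V at *
  generalize 1 - b / (b * q ^ (n + 1)) = l₁ at *
  generalize 1 - c / (b * q ^ (n + 1)) = l₂ at *
  generalize 1 - d / (b * q ^ (n + 1)) = l₃ at *
  generalize 1 - e / (b * q ^ (n + 1)) = l₄ at *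
  generalize 1 - b * q ^ n * b / a = m₁ at *
  generalize 1 - b * q ^ n * c / a = m₂ at *
  generalize 1 - b * q ^ n * d / a = m₃ at *
  generalize 1 - b * q ^ n * e / a = m₄ at *
  linear_combination -key - (m₁ * m₂ * m₃ * m₄ *
    sixSum q b z b c d e (b * q ^ n * z / a) (z / (b * q ^ n))) * e5

lemma pairTerm_step (hq0 : q ≠ 0) (hq : ‖q‖ < 1) {a b p : ℂ} (ha : a ≠ 0) (hb : b ≠ 0) (hp : p ≠ 0)
    (n : ℕ) :
    (1 - p / (b * q ^ (n + 1))) * pairTerm q (b * q / p) (a / (b * p)) ((n : ℤ) + 1) =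
      -(a / (b ^ 2 * q ^ n * q)) * ((1 - b * q ^ n * p / a) *
        pairTerm q (b * q / p) (a / (b * p)) n) := by
  have hQ : q ^ n ≠ 0 := pow_ne_zero _ hq0
  have := pairTerm_succ hq0 hq (b * q / p) (a / (b * p)) n
  rw [zpow_natCast] at this
  generalize pairTerm q (b * q / p) (a / (b * p)) ((n : ℤ) + 1) = H' at *
  generalize pairTerm q (b * q / p) (a / (b * p)) n = H at *
  rw [pow_succ]
  field_simp at this ⊢
  linear_combination -this

/-- The inner sum over `b q^ℤ` terminates and is a product. -/
lemma inner_sum_terminating (hq0 : q ≠ 0) (hq : ‖q‖ < 1) {a z b c d e : ℂ} (ha : a ≠ 0)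
    (hz : z ≠ 0) (hb : b ≠ 0) (hc : c ≠ 0) (hd : d ≠ 0) (he : e ≠ 0)
    (h : b * c * d * e = a * q * z) (gc : ∀ k : ℤ, c / b ≠ q ^ k) (gd : ∀ k : ℤ, d / b ≠ q ^ k)
    (ge : ∀ k : ℤ, e / b ≠ q ^ k) (n : ℤ) :
    qPochInf q (a * q / (b * c)) * qPochInf q (a * q / (b * d)) * qPochInf q (a * q / (b * e)) *
      (gauss q n ^ 2 * sixSum q b z b c d e (b * q ^ n * z / a) (z / (b * q ^ n))) =
    thetaProd q (b ^ 2 / z) * qPochInf q (a * q / z) * qPochInf q q *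
      (qPochInf q (z * q / (b * c)) * qPochInf q (z * q / (b * d)) * qPochInf q (z * q / (b * e))) *
      (pairTerm q (b * q / b) (a / (b * b)) n *
      pairTerm q (b * q / c) (a / (b * c)) n * pairTerm q (b * q / d) (a / (b * d)) n *
      pairTerm q (b * q / e) (a / (b * e)) n * (b ^ 2 * q / a) ^ n) := by
  rcases lt_or_ge n 0 with hn | hn
  · have h0 : pairTerm q (b * q / b) (a / (b * b)) n = 0 := by
      rw [pairTerm, mul_div_cancel_left₀ _ hb, ← zpow_one_add₀ hq0,
        qPochInf_zpow_eq_zero hq0 (by omega)]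
      ring
    rw [sixSum_eq_zero_of_neg hq0 c d e _ hb hz hn, h0]
    ring
  obtain ⟨m, rfl⟩ := Int.eq_ofNat_of_zero_le hn
  clear hn
  rw [zpow_natCast, zpow_natCast]
  induction m with
  | zero =>
    simp only [pow_zero, mul_one]
    rw [sixSum_eq_single hq0 c d e _ hb hz, sixTerm_eq]
    simp only [pairTerm, Nat.cast_zero, mul_zero, zpow_zero, mul_one, sub_zero, zpow_one, gauss_zero,
      one_pow, one_mul]
    have t : thetaProd q (b ^ 2 / z) =
        (1 - b ^ 2 / z) * qPochInf q (b ^ 2 / z * q) * qPochInf q (z / (b * b) * q) := by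
      rw [thetaProd, qPochInf_eq_mul hq]
      congr 2
      field_simp
    have a1 : b * q / (z / b) = b ^ 2 / z * q := by field_simp
    have a2 : z / (b * (z / b)) * q = q := by field_simp
    have a3 : b * q / (b * z / a) = a * q / z := by field_simp
    have a4 : z / (b * (b * z / a)) * q = a / (b * b) * q := by field_simp
    have a5 (p : ℂ) : z / (b * p) * q = z * q / (b * p) := by ring
    have a6 (p : ℂ) : a / (b * p) * q = a * q / (b * p) := by ring
    rw [t, a1, a2, a3, a4, a5 c, a5 d, a5 e, a6 c, a6 d, a6 e]
    generalize 1 - b ^ 2 / z = y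
    ring
  | succ m ih =>
    have hQ : q ^ m ≠ 0 := pow_ne_zero _ hq0
    -- Genericity is used only to cancel these coefficients of the recursion.
    have nz {p : ℂ} (gp : ∀ k : ℤ, p / b ≠ q ^ k) : 1 - p / (b * q ^ (m + 1)) ≠ 0 := by
      intro h0
      refine gp ((m + 1 : ℕ) : ℤ) ?_
      rw [zpow_natCast]
      have hQ' : q ^ (m + 1) ≠ 0 := pow_ne_zero _ hq0
      rw [sub_eq_zero, eq_div_iff (by simp [*])] at h0
      rw [div_eq_iff hb]
      linear_combination -h0
    have nb : 1 - b / (b * q ^ (m + 1)) ≠ 0 := by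
      have h1 := zpow_ne_one_of_norm_lt_one hq0 hq (m := ((m + 1 : ℕ) : ℤ)) (by positivity)
      rw [zpow_natCast] at h1
      have hQ' : q ^ (m + 1) ≠ 0 := pow_ne_zero _ hq0
      intro h0
      refine h1 ?_
      field_simp at h0
      linear_combination h0
    have hne := mul_ne_zero (mul_ne_zero (mul_ne_zero nb (nz gc)) (nz gd)) (nz ge)
    have s0 := sixSum_terminating_succ hq0 hq ha hz hb hc hd he h m
    have sb := pairTerm_step hq0 hq ha hb hb m
    have sc := pairTerm_step hq0 hq ha hb hc m
    have sd := pairTerm_step hq0 hq ha hb hd m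
    have se := pairTerm_step hq0 hq ha hb he m
    have hG : gauss q ((m : ℤ) + 1) = -(q ^ m * gauss q m) := by rw [gauss_succ hq0, zpow_natCast]
    refine mul_left_cancel₀ hne ?_
    push_cast
    rw [hG, pow_succ (b ^ 2 * q / a) m]
    generalize thetaProd q (b ^ 2 / z) * qPochInf q (a * q / z) * qPochInf q q *
      (qPochInf q (z * q / (b * c)) * qPochInf q (z * q / (b * d)) * qPochInf q (z * q / (b * e))) =
        κ₂ at *
    generalize qPochInf q (a * q / (b * c)) * qPochInf q (a * q / (b * d)) *
      qPochInf q (a * q / (b * e)) = κ₁ at *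
    have cst : (a / (b ^ 2 * (q ^ m) ^ 2 * q)) ^ 3 * (q ^ m) ^ 2 =
        (a / (b ^ 2 * q ^ m * q)) ^ 4 * (b ^ 2 * q / a) := by field_simp
    clear nb nz hne gc gd ge hG
    generalize sixSum q b z b c d e (b * q ^ (m + 1) * z / a) (z / (b * q ^ (m + 1))) = S' at *
    generalize sixSum q b z b c d e (b * q ^ m * z / a) (z / (b * q ^ m)) = S at *
    generalize 1 - b / (b * q ^ (m + 1)) = l₁ at *
    generalize 1 - c / (b * q ^ (m + 1)) = l₂ at *
    generalize 1 - d / (b * q ^ (m + 1)) = l₃ at *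
    generalize 1 - e / (b * q ^ (m + 1)) = l₄ at *
    generalize 1 - b * q ^ m * b / a = m₁ at *
    generalize 1 - b * q ^ m * c / a = m₂ at *
    generalize 1 - b * q ^ m * d / a = m₃ at *
    generalize 1 - b * q ^ m * e / a = m₄ at *
    generalize pairTerm q (b * q / b) (a / (b * b)) ((m : ℤ) + 1) = H₁' at *
    generalize pairTerm q (b * q / c) (a / (b * c)) ((m : ℤ) + 1) = H₂' at *
    generalize pairTerm q (b * q / d) (a / (b * d)) ((m : ℤ) + 1) = H₃' at *
    generalize pairTerm q (b * q / e) (a / (b * e)) ((m : ℤ) + 1) = H₄' at *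
    generalize pairTerm q (b * q / b) (a / (b * b)) m = H₁ at *
    generalize pairTerm q (b * q / c) (a / (b * c)) m = H₂ at *
    generalize pairTerm q (b * q / d) (a / (b * d)) m = H₃ at *
    generalize pairTerm q (b * q / e) (a / (b * e)) m = H₄ at *
    generalize (b ^ 2 * q / a) ^ m = v at *
    generalize b ^ 2 * q / a = v₁ at *
    generalize (a / (b ^ 2 * (q ^ m) ^ 2 * q)) ^ 3 = V at *
    generalize a / (b ^ 2 * q ^ m * q) = w at *
    generalize gauss q m = G at *
    have prod : l₁ * l₂ * l₃ * l₄ * (H₁' * H₂' * H₃' * H₄') =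
        w ^ 4 * (m₁ * m₂ * m₃ * m₄ * (H₁ * H₂ * H₃ * H₄)) := by
      calc _ = (l₁ * H₁') * (l₂ * H₂') * (l₃ * H₃') * (l₄ * H₄') := by ring
        _ = _ := by rw [sb, sc, sd, se]; ring
    linear_combination κ₁ * (q ^ m) ^ 2 * G ^ 2 * s0 + V * (q ^ m) ^ 2 * (m₁ * m₂ * m₃ * m₄) * ih -
      κ₂ * v * v₁ * prod + κ₂ * v * (m₁ * m₂ * m₃ * m₄) * (H₁ * H₂ * H₃ * H₄) * cst

lemma zpow_pow_comm (x : ℂ) (k : ℤ) (m : ℕ) : (x ^ k) ^ m = (x ^ m) ^ k := by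
  rw [← zpow_natCast (x ^ k), ← zpow_mul, mul_comm, zpow_mul, zpow_natCast]

/-- Inverting the base point of a six-parameter sum. -/
lemma sixSum_base_inv (hq0 : q ≠ 0) {s A : ℂ} (p₁ p₂ p₃ p₄ p₅ p₆ : ℂ) (hs : s ≠ 0) (hA : A ≠ 0) :
    sixSum q s A p₁ p₂ p₃ p₄ p₅ p₆ = -(s ^ 2 / A) * sixSum q (A / s) A p₁ p₂ p₃ p₄ p₅ p₆ := by
  rw [sixSum, sixSum, ← tsum_mul_left, ← (Equiv.neg ℤ).tsum_eq]
  refine tsum_congr fun k => ?_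
  have hQ : q ^ k ≠ 0 := zpow_ne_zero _ hq0
  have e (p : ℂ) : pairTerm q (s * q / p) (A / (s * p)) (-k) =
      q ^ k * pairTerm q (A / s * q / p) (A / (A / s * p)) k := by
    rw [pairTerm_neg hq0]
    congr 2
    · field_simp
    · field_simp
  have e2 : q ^ (2 * k) = q ^ k * q ^ k := by rw [two_mul, zpow_add₀ hq0]
  have e3 : q ^ (2 * -k) = (q ^ k * q ^ k)⁻¹ := by rw [mul_neg, zpow_neg, e2]
  have e4 : (s ^ 6 * q ^ 2 / A ^ 3) ^ (-k) * (q ^ k) ^ 4 = ((A / s) ^ 6 * q ^ 2 / A ^ 3) ^ k := by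
    rw [zpow_neg, ← inv_zpow, zpow_pow_comm, ← mul_zpow]
    congr 1
    field_simp
  simp only [Equiv.neg_apply, sixTerm_eq, e, e2, e3, ← e4]
  generalize (s ^ 6 * q ^ 2 / A ^ 3) ^ (-k) = w
  generalize pairTerm q (A / s * q / p₁) (A / (A / s * p₁)) k = H₁
  generalize pairTerm q (A / s * q / p₂) (A / (A / s * p₂)) k = H₂
  generalize pairTerm q (A / s * q / p₃) (A / (A / s * p₃)) k = H₃
  generalize pairTerm q (A / s * q / p₄) (A / (A / s * p₄)) k = H₄
  generalize pairTerm q (A / s * q / p₅) (A / (A / s * p₅)) k = H₅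
  generalize pairTerm q (A / s * q / p₆) (A / (A / s * p₆)) k = H₆
  generalize q ^ k = Q at *
  have c : (1 - s ^ 2 / A * (Q * Q)⁻¹) * Q ^ 2 = -(s ^ 2 / A) * (1 - (A / s) ^ 2 / A * (Q * Q)) := by
    field_simp
    ring
  linear_combination (H₁ * H₂ * H₃ * H₄ * H₅ * H₆ * w * Q ^ 4) * c

/-- Shifting the base point of a six-parameter sum by a power of `q`. -/
lemma sixSum_base_shift (hq0 : q ≠ 0) {s A : ℂ} (p₁ p₂ p₃ p₄ p₅ p₆ : ℂ) (hs : s ≠ 0) (hA : A ≠ 0)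
    (n : ℤ) :
    gauss q n ^ 6 * (s ^ 6 * q ^ 2 / A ^ 3) ^ n * sixSum q (s * q ^ n) A p₁ p₂ p₃ p₄ p₅ p₆ =
      sixSum q s A p₁ p₂ p₃ p₄ p₅ p₆ := by
  rw [sixSum, sixSum, ← tsum_mul_left, ← (Equiv.addRight n).tsum_eq (sixTerm q s A p₁ p₂ p₃ p₄ p₅ p₆)]
  refine tsum_congr fun k => ?_
  have hQ : q ^ n ≠ 0 := zpow_ne_zero _ hq0
  have hW : s ^ 6 * q ^ 2 / A ^ 3 ≠ 0 := by simp [*]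
  have e (p : ℂ) : pairTerm q (s * q / p) (A / (s * p)) (k + n) =
      gauss q n * q ^ (k * n) * pairTerm q (s * q ^ n * q / p) (A / (s * q ^ n * p)) k := by
    have e1 : s * q / p * q ^ (k + n) = s * q ^ n * q / p * q ^ k := by rw [zpow_add₀ hq0]; ring
    have e2 : A / (s * p) * q ^ (1 - (k + n)) = A / (s * q ^ n * p) * q ^ (1 - k) := by
      rw [show 1 - (k + n) = 1 - k - n by ring, zpow_sub₀ hq0 (1 - k)]; field_simp
    rw [pairTerm, pairTerm, e1, e2, gauss_add hq0]
    ring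
  have e4 : ((s * q ^ n) ^ 6 * q ^ 2 / A ^ 3) ^ k = (s ^ 6 * q ^ 2 / A ^ 3) ^ k * (q ^ (k * n)) ^ 6 := by
    rw [mul_comm k n, zpow_mul, zpow_pow_comm _ k 6, ← mul_zpow]
    congr 1
    ring
  have e5 : q ^ (2 * (k + n)) = (q ^ n) ^ 2 * q ^ (2 * k) := by
    rw [mul_add, zpow_add₀ hq0, two_mul n, zpow_add₀ hq0]; ring
  simp only [Equiv.coe_addRight, sixTerm_eq, e, e4, e5, zpow_add₀ hW]
  ring

/-- The field identity behind `inner_sum_cross`, with G the Gaussian weight and Q, Z the n-th powers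
of q and z. All quasi-periodicity multipliers combine to the single factor Q⁶G⁹Z⁵/(cde), common to
both sums. -/
lemma cross_algebra {G Q Z c d e a z b B₁ B₂ B₃ B₄ A₁ A₂ A₃ A₄ S₁ S₆ T₀ T₂ T₃ T₄ U V T₅ U₁ U₂ U₃ U₄
      C₁ C₂ C₃ C₄ C₅ C₆ C₇ P : ℂ} (hG : G ≠ 0) (hQ : Q ≠ 0) (hZ : Z ≠ 0) (hc : c ≠ 0) (hd : d ≠ 0)
    (he : e ≠ 0) (ha : a ≠ 0) (hz : z ≠ 0)
    (key : b * (T₀ * T₂ * T₃ * T₄ * T₅) * S₁ - Q⁻¹ * (U₁ * U₂ * U₃ * U₄ * U) * (-(Q⁻¹ ^ 2 / z) * S₆) =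
      -(Q⁻¹ * P * V * U₁ * T₀) * (C₁ * C₂ * B₁ * C₄ * B₂ * B₃) * A₄ * (C₃ * C₅ * C₆ * B₄) *
        (A₁ * A₂ * A₃ * C₇)) :
    b * (T₀ * (Q * G * (Q * G) * (Q * G) * (Q * G) * Q⁻¹ * (Z * Z)) * (T₂ * (Q * G * (c / Z)⁻¹)) *
        (T₃ * (Q * G * (d / Z)⁻¹)) * (T₄ * (Q * G * (e / Z)⁻¹)) * T₅) * (G ^ 2 * S₁) +
      1 / z * (U₁ * U₂ * U₃ * U₄ * (U * (G * (a * Q * Z / (c * d * e) * (Z / a))))) *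
        (G ^ 2 * (G ^ 6 * (Z ^ 3 * Q ^ 2) * S₆)) =
    -(P * (V * (G * (a * Q * Z / (c * d * e)))) * U₁ *
        (T₀ * (Q * G * (Q * G) * (Q * G) * (Q * G) * Q⁻¹ * (Z * Z))) * C₇ *
        (C₁ * C₂ * C₃ * C₄ * C₅ * C₆)) *
      (B₁ * A₁ * G * (B₂ * A₂ * G) * (B₃ * A₃ * G) * (B₄ * A₄ * G) * (Z ^ 2 * Q / a)) := by
  have e₁ : b * (T₀ * (Q * G * (Q * G) * (Q * G) * (Q * G) * Q⁻¹ * (Z * Z)) * (T₂ * (Q * G * (c / Z)⁻¹)) *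
        (T₃ * (Q * G * (d / Z)⁻¹)) * (T₄ * (Q * G * (e / Z)⁻¹)) * T₅) * (G ^ 2 * S₁) =
      Q ^ 6 * G ^ 9 * Z ^ 5 / (c * d * e) * (b * (T₀ * T₂ * T₃ * T₄ * T₅) * S₁) := by
    field_simp
  have e₂ : 1 / z * (U₁ * U₂ * U₃ * U₄ * (U * (G * (a * Q * Z / (c * d * e) * (Z / a))))) *
        (G ^ 2 * (G ^ 6 * (Z ^ 3 * Q ^ 2) * S₆)) = Q ^ 6 * G ^ 9 * Z ^ 5 / (c * d * e) *
      -(Q⁻¹ * (U₁ * U₂ * U₃ * U₄ * U) * (-(Q⁻¹ ^ 2 / z) * S₆)) := by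
    field_simp
  have e₃ : Q ^ 6 * G ^ 9 * Z ^ 5 / (c * d * e) * Q⁻¹ = G * (a * Q * Z / (c * d * e)) *
      (Q * G * (Q * G) * (Q * G) * (Q * G) * Q⁻¹ * (Z * Z)) * G ^ 4 * (Z ^ 2 * Q / a) := by
    field_simp
  rw [e₁, e₂, ← mul_add, ← sub_eq_add_neg, key]
  generalize Q ^ 6 * G ^ 9 * Z ^ 5 / (c * d * e) = x at *
  generalize Q * G * (Q * G) * (Q * G) * (Q * G) * Q⁻¹ * (Z * Z) = y at *
  generalize a * Q * Z / (c * d * e) = u at *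
  generalize Z ^ 2 * Q / a = v at *
  generalize Q⁻¹ = w at *
  linear_combination -(P * V * U₁ * T₀ * (C₁ * C₂ * C₃ * C₄ * C₅ * C₆ * C₇) * (B₁ * B₂ * B₃ * B₄) *
    (A₁ * A₂ * A₃ * A₄)) * e₃

/-- The inner sums over `b q^ℤ` and `z q^ℤ` combine to a product. -/
lemma inner_sum_cross (hq0 : q ≠ 0) (hq : ‖q‖ < 1) {a z b c d e : ℂ} (ha : a ≠ 0)
    (hz : z ≠ 0) (hb : b ≠ 0) (hc : c ≠ 0) (hd : d ≠ 0) (he : e ≠ 0)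
    (h : b * c * d * e = a * q * z) (g₁ : ∀ k : ℤ, b * e / z ≠ q ^ k)
    (g₂ : ∀ k : ℤ, c * e / z ≠ q ^ k) (g₃ : ∀ k : ℤ, d * e / z ≠ q ^ k)
    (g₄ : ∀ k : ℤ, e * z / a ≠ q ^ k) (g₅ : ∀ k : ℤ, e / z ≠ q ^ k) (n : ℤ) :
    b * (thetaProd q (1 / z) * thetaProd q (c / z) * thetaProd q (d / z) * thetaProd q (e / z) *
        thetaProd q (z / a)) *
      (gauss q n ^ 2 * sixSum q b z b c d e (z * q ^ n * z / a) (z / (z * q ^ n))) +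
    1 / z * (thetaProd q (b ^ 2 / z) * thetaProd q (b * c / z) * thetaProd q (b * d / z) *
        thetaProd q (b * e / z) * thetaProd q (b * z / a)) *
      (gauss q n ^ 2 * sixSum q z z b c d e (z * q ^ n * z / a) (z / (z * q ^ n))) =
    -(qPochInf q q * thetaProd q b * thetaProd q (b ^ 2 / z) * thetaProd q (1 / z) *
      qPochInf q (a * q / z) *
      (qPochInf q (z * q / (b * c)) * qPochInf q (z * q / (b * d)) * qPochInf q (z * q / (b * e)) *
       qPochInf q (z * q / (c * d)) * qPochInf q (z * q / (c * e)) * qPochInf q (z * q / (d * e)))) *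
      (pairTerm q (z * q / b) (a / (z * b)) n *
      pairTerm q (z * q / c) (a / (z * c)) n * pairTerm q (z * q / d) (a / (z * d)) n *
      pairTerm q (z * q / e) (a / (z * e)) n * (z ^ 2 * q / a) ^ n) := by
  have hQ : q ^ n ≠ 0 := zpow_ne_zero _ hq0
  have hG : gauss q n ≠ 0 := gauss_ne_zero hq0 n
  have h6 : z / (z * q ^ n) ≠ 0 := by simp [*]
  have h5 : z * q ^ n * z / a ≠ 0 := by simp [*]
  have shift {x : ℂ} (hx : ∀ k : ℤ, x ≠ q ^ k) (j k : ℤ) : x * q ^ j ≠ q ^ k := by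
    intro he
    refine hx (k - j) ?_
    rw [zpow_sub₀ hq0, eq_div_iff (zpow_ne_zero _ hq0), he]
  -- The last parameter z/(z q^n) is q^{-n}. The second lattice of the two-term relation is
  -- therefore q^ℤ, which inversion of the base point and a shift by q^n carry to z q^ℤ.
  have key := sixCross_eq hq0 hq hz hb hc hd he h5 h6
    (by field_simp; linear_combination h) g₁ g₂ g₃
    (fun k hk => shift g₄ n k (by rw [← hk]; field_simp))
    (fun k hk => shift g₅ (-n) k (by rw [← hk, zpow_neg]; field_simp))
  -- theta functions at shifted arguments
  have z0 := thetaProd_mul_zpow hq0 hq (x := 1 / z) (by simp [hz]) (2 * -n)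
  have zp (p : ℂ) (hp : p ≠ 0) := thetaProd_mul_zpow hq0 hq (x := p / z) (by simp [hz, hp]) (-n)
  have z5 := thetaProd_mul_zpow hq0 hq (x := b * z / a) (by simp [*]) n
  have zb := thetaProd_mul_zpow hq0 hq hb n
  have zc := zp c hc
  have zd := zp d hd
  have ze := zp e he
  rw [gauss_two_mul hq0, gauss_neg hq0, show 2 * -n = -n + -n by ring, zpow_add₀ hq0,
    zpow_add₀ (one_div_ne_zero hz), zpow_neg, zpow_neg, div_zpow, one_zpow, inv_div, div_one] at z0
  rw [gauss_neg hq0, zpow_neg, zpow_neg, div_zpow] at zc zd ze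
  rw [mul_div_assoc, mul_zpow, div_zpow] at z5
  have t0 : z / (z * q ^ n) * (z / (z * q ^ n)) / z = 1 / z * ((q ^ n)⁻¹ * (q ^ n)⁻¹) := by field_simp
  have tp (p : ℂ) : z / (z * q ^ n) * p / z = p / z * (q ^ n)⁻¹ := by field_simp
  have t5 : z / (z * q ^ n) * (z * q ^ n * z / a) / z = z / a := by field_simp
  have tb5 : b * (z * q ^ n * z / a) / z = b * (z / a) * q ^ n := by field_simp
  have tb6 : b / (z / (z * q ^ n)) = b * q ^ n := by field_simp
  -- the sum over the last parameter
  have inv := sixSum_base_inv hq0 b c d e (z * q ^ n * z / a) (z / (z * q ^ n)) h6 hz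
  have shf := sixSum_base_shift hq0 b c d e (z * q ^ n * z / a) (z / (z * q ^ n)) hz hz n
  have tz : z / (z / (z * q ^ n)) = z * q ^ n := by field_simp
  have tw : z ^ 6 * q ^ 2 / z ^ 3 = z ^ 3 * q ^ 2 := by field_simp
  rw [tz] at inv
  rw [tw, mul_zpow, ← zpow_pow_comm, ← zpow_pow_comm] at shf
  -- the products
  have ph (p : ℂ) (hp : p ≠ 0) : pairTerm q (z * q / p) (a / (z * p)) n =
      qPochInf q (z * q / (p * (z / (z * q ^ n)))) * qPochInf q (z * q / (p * (z * q ^ n * z / a))) *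
        gauss q n := by
    rw [pairTerm]
    congr 3
    · field_simp
    · rw [zpow_sub₀ hq0, zpow_one]; field_simp
  have pe : qPochInf q (z * q / (z / (z * q ^ n) * (z * q ^ n * z / a))) = qPochInf q (a * q / z) := by
    congr 1; field_simp
  rw [ph b hb, ph c hc, ph d hd, ph e he]
  -- The n-th power of bcde = aqz eliminates b^n, and the multipliers of the separate theta
  -- functions become comparable.
  have hn : b ^ n * c ^ n * d ^ n * e ^ n = a ^ n * q ^ n * z ^ n := by
    rw [← mul_zpow, ← mul_zpow, ← mul_zpow, h, mul_zpow, mul_zpow]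
  have hw : (z ^ 2 * q / a) ^ n = (z ^ n) ^ 2 * q ^ n / a ^ n := by
    rw [div_zpow, mul_zpow, sq, mul_zpow, sq]
  rw [sixCross, sixCrossValue, t0, tp, tp, tp, t5, tb5, tb6, pe, inv, mul_comm (z / (z * q ^ n)) e,
    ← sq b] at key
  rw [mul_div_assoc b z a, hw]
  have nz : z ^ n ≠ 0 := zpow_ne_zero _ hz
  have nb : b ^ n ≠ 0 := zpow_ne_zero _ hb
  have nc : c ^ n ≠ 0 := zpow_ne_zero _ hc
  have nd : d ^ n ≠ 0 := zpow_ne_zero _ hd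
  have ne : e ^ n ≠ 0 := zpow_ne_zero _ he
  have na : a ^ n ≠ 0 := zpow_ne_zero _ ha
  rw [← z0, ← zc, ← zd, ← ze, ← z5, ← zb, ← shf]
  generalize qPochInf q (z * q / (b * (z / (z * q ^ n)))) = B₁ at *
  generalize qPochInf q (z * q / (c * (z / (z * q ^ n)))) = B₂ at *
  generalize qPochInf q (z * q / (d * (z / (z * q ^ n)))) = B₃ at *
  generalize qPochInf q (z * q / (e * (z / (z * q ^ n)))) = B₄ at *
  generalize qPochInf q (z * q / (b * (z * q ^ n * z / a))) = A₁ at *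
  generalize qPochInf q (z * q / (c * (z * q ^ n * z / a))) = A₂ at *
  generalize qPochInf q (z * q / (d * (z * q ^ n * z / a))) = A₃ at *
  generalize qPochInf q (z * q / (e * (z * q ^ n * z / a))) = A₄ at *
  generalize sixSum q b z b c d e (z * q ^ n * z / a) (z / (z * q ^ n)) = S₁ at *
  generalize sixSum q (z * q ^ n) z b c d e (z * q ^ n * z / a) (z / (z * q ^ n)) = S₆ at *
  clear z0 zc zd ze z5 zb shf inv tz tw ph pe t0 tp t5 tb5 tb6 zp shift g₁ g₂ g₃ g₄ g₅ h6 h5 hw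
  generalize thetaProd q (1 / z * ((q ^ n)⁻¹ * (q ^ n)⁻¹)) = T₀ at *
  generalize thetaProd q (c / z * (q ^ n)⁻¹) = T₂ at *
  generalize thetaProd q (d / z * (q ^ n)⁻¹) = T₃ at *
  generalize thetaProd q (e / z * (q ^ n)⁻¹) = T₄ at *
  generalize thetaProd q (b * (z / a) * q ^ n) = U at *
  generalize thetaProd q (b * q ^ n) = V at *
  generalize thetaProd q (z / a) = T₅ at *
  generalize thetaProd q (b ^ 2 / z) = U₁ at *
  generalize thetaProd q (b * c / z) = U₂ at *
  generalize thetaProd q (b * d / z) = U₃ at *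
  generalize thetaProd q (b * e / z) = U₄ at *
  generalize qPochInf q (z * q / (b * c)) = C₁ at *
  generalize qPochInf q (z * q / (b * d)) = C₂ at *
  generalize qPochInf q (z * q / (b * e)) = C₃ at *
  generalize qPochInf q (z * q / (c * d)) = C₄ at *
  generalize qPochInf q (z * q / (c * e)) = C₅ at *
  generalize qPochInf q (z * q / (d * e)) = C₆ at *
  generalize qPochInf q (a * q / z) = C₇ at *
  generalize qPochInf q q = P at *
  generalize gauss q n = G at *
  generalize q ^ n = Q at *
  generalize z ^ n = Z at *
  generalize b ^ n = b' at *
  generalize c ^ n = c' at *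
  generalize d ^ n = d' at *
  generalize e ^ n = e' at *
  generalize a ^ n = a' at *
  have hb' : b' = a' * Q * Z / (c' * d' * e') := by
    field_simp
    linear_combination hn
  have hzQ : z / (z * Q) = Q⁻¹ := by field_simp
  rw [hzQ] at key
  rw [hb']
  exact cross_algebra hG hQ nz nc nd ne na hz key

/-! ### The two-term and three-term transformations, bilateral form -/

/-- Two-term transformation between sums with base point `b`. -/
lemma sixSum_two_term (hq0 : q ≠ 0) (hq : ‖q‖ < 1) {a z b c d e f g : ℂ} (ha : a ≠ 0)
    (hz : z ≠ 0) (hb : b ≠ 0) (hc : c ≠ 0) (hd : d ≠ 0) (he : e ≠ 0) (hf : f ≠ 0) (hg : g ≠ 0)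
    (h : b * c * d * e = a * q * z) (hρ : ‖a ^ 2 * q / (f * g * z)‖ < 1)
    (hρσ : ‖a * q / (f * g)‖ < 1) (gc : ∀ k : ℤ, c / b ≠ q ^ k) (gd : ∀ k : ℤ, d / b ≠ q ^ k)
    (ge : ∀ k : ℤ, e / b ≠ q ^ k) :
    qPochInf q (a * q / (b * c)) * qPochInf q (a * q / (b * d)) * qPochInf q (a * q / (b * e)) *
      (qPochInf q (a * q / (f * g)) * qPochInf q (a * q / z) *
        (qPochInf q q * thetaProd q (b ^ 2 / a)) * sixSum q b z b c d e (f * z / a) (g * z / a)) =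
    qPochInf q (a ^ 2 * q / (f * g * z)) * (thetaProd q (b ^ 2 / z) * qPochInf q (a * q / z) *
      qPochInf q q *
      (qPochInf q (z * q / (b * c)) * qPochInf q (z * q / (b * d)) * qPochInf q (z * q / (b * e))) *
      sixSum q b a b c d e f g) := by
  -- Here t = s = b, the case in which every inner sum terminates.
  rw [← (bailey_transform hq0 hq hb hb ha hz hb hc hd he hf hg h hρ hρσ).2, mul_left_comm]
  congr 1
  rw [← tsum_mul_left, sixSum, ← tsum_mul_left]
  refine tsum_congr fun n => ?_
  have h₁ := inner_sum_terminating hq0 hq ha hz hb hc hd he h gc gd ge n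
  rw [← baileyLeft_mul b c d e f g ha n, mul_left_comm, h₁, mul_left_comm]

/-- Three-term transformation between sums with base points `b` and `z`. -/
lemma sixSum_three_term (hq0 : q ≠ 0) (hq : ‖q‖ < 1) {a z b c d e f g : ℂ} (ha : a ≠ 0)
    (hz : z ≠ 0) (hb : b ≠ 0) (hc : c ≠ 0) (hd : d ≠ 0) (he : e ≠ 0) (hf : f ≠ 0) (hg : g ≠ 0)
    (h : b * c * d * e = a * q * z) (hρ : ‖a ^ 2 * q / (f * g * z)‖ < 1)
    (hρσ : ‖a * q / (f * g)‖ < 1) (g₁ : ∀ k : ℤ, b * e / z ≠ q ^ k)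
    (g₂ : ∀ k : ℤ, c * e / z ≠ q ^ k) (g₃ : ∀ k : ℤ, d * e / z ≠ q ^ k)
    (g₄ : ∀ k : ℤ, e * z / a ≠ q ^ k) (g₅ : ∀ k : ℤ, e / z ≠ q ^ k) :
    b * (thetaProd q (1 / z) * thetaProd q (c / z) * thetaProd q (d / z) * thetaProd q (e / z) *
        thetaProd q (z / a)) *
      (qPochInf q (a * q / (f * g)) * qPochInf q (a * q / z) *
        (qPochInf q q * thetaProd q (z ^ 2 / a)) * sixSum q b z b c d e (f * z / a) (g * z / a)) +
    1 / z * (thetaProd q (b ^ 2 / z) * thetaProd q (b * c / z) * thetaProd q (b * d / z) *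
        thetaProd q (b * e / z) * thetaProd q (b * z / a)) *
      (qPochInf q (a * q / (f * g)) * qPochInf q (a * q / z) *
        (qPochInf q q * thetaProd q (z ^ 2 / a)) * sixSum q z z b c d e (f * z / a) (g * z / a)) =
    qPochInf q (a ^ 2 * q / (f * g * z)) *
      (-(qPochInf q q * thetaProd q b * thetaProd q (b ^ 2 / z) * thetaProd q (1 / z) *
      qPochInf q (a * q / z) *
      (qPochInf q (z * q / (b * c)) * qPochInf q (z * q / (b * d)) * qPochInf q (z * q / (b * e)) *
       qPochInf q (z * q / (c * d)) * qPochInf q (z * q / (c * e)) *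
       qPochInf q (z * q / (d * e)))) * sixSum q z a b c d e f g) := by
  -- Here t = z in both transforms, with s = b and s = z. Neither inner sum is a product by itself,
  -- so the two outer series are added termwise first.
  obtain ⟨S₁, h₁⟩ := bailey_transform hq0 hq hz hb ha hz hb hc hd he hf hg h hρ hρσ
  obtain ⟨S₂, h₂⟩ := bailey_transform hq0 hq hz hz ha hz hb hc hd he hf hg h hρ hρσ
  rw [← h₁, ← h₂, mul_left_comm _ (qPochInf q (a ^ 2 * q / (f * g * z))),
    mul_left_comm _ (qPochInf q (a ^ 2 * q / (f * g * z))), ← mul_add]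
  congr 1
  rw [← tsum_mul_left, ← tsum_mul_left, ← (S₁.mul_left _).tsum_add (S₂.mul_left _), sixSum,
    ← tsum_mul_left]
  refine tsum_congr fun n => ?_
  have h₃ := inner_sum_cross hq0 hq ha hz hb hc hd he h g₁ g₂ g₃ g₄ g₅ n
  rw [← baileyLeft_mul b c d e f g ha n, mul_left_comm, mul_left_comm _ (baileyLeft q z a f g n),
    ← mul_add, h₃, mul_left_comm]

/-! ### The one-sided series and the generic three-term relation -/

/-- The term of the one-sided very-well-poised series, cleared of denominators. -/
def oneSidedTerm (q a b c d e f g w : ℂ) (n : ℕ) : ℂ :=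
  (1 - b ^ 2 / a * q ^ (2 * n)) *
    ((∏ k ∈ Finset.range n, (1 - b * b / a * q ^ k)) * qPochInf q (b * q / b * q ^ n) *
    ((∏ k ∈ Finset.range n, (1 - b * c / a * q ^ k)) * qPochInf q (b * q / c * q ^ n)) *
    ((∏ k ∈ Finset.range n, (1 - b * d / a * q ^ k)) * qPochInf q (b * q / d * q ^ n)) *
    ((∏ k ∈ Finset.range n, (1 - b * e / a * q ^ k)) * qPochInf q (b * q / e * q ^ n)) *
    ((∏ k ∈ Finset.range n, (1 - b * f / a * q ^ k)) * qPochInf q (b * q / f * q ^ n)) *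
    ((∏ k ∈ Finset.range n, (1 - b * g / a * q ^ k)) * qPochInf q (b * q / g * q ^ n))) * w ^ n

/-- The one-sided very-well-poised series, cleared of denominators. -/
def oneSidedSum (q a b c d e f g w : ℂ) : ℂ := ∑' n, oneSidedTerm q a b c d e f g w n

lemma pairTerm_natCast' (hq0 : q ≠ 0) (hq : ‖q‖ < 1) {a b p : ℂ} (ha : a ≠ 0) (hb : b ≠ 0)
    (hp : p ≠ 0) (n : ℕ) :
    pairTerm q (b * q / p) (a / (b * p)) n =
      (∏ k ∈ Finset.range n, (1 - b * p / a * q ^ k)) * qPochInf q (b * q / p * q ^ n) *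
        qPochInf q (a * q / (b * p)) * (a / (b * p)) ^ n := by
  have : ∏ k ∈ Finset.range n, (a / (b * p) - q ^ k) =
      (a / (b * p)) ^ n * ∏ k ∈ Finset.range n, (1 - b * p / a * q ^ k) := by
    rw [← Finset.card_range n, ← Finset.prod_const, Finset.card_range, ← Finset.prod_mul_distrib]
    refine Finset.prod_congr rfl fun k _ => ?_
    field_simp
  rw [pairTerm_natCast hq0 hq, this, show a / (b * p) * q = a * q / (b * p) by ring]
  ring

/-- The sum with base point `b` and parameter `b` is one-sided. -/
lemma sixSum_eq_oneSidedSum (hq0 : q ≠ 0) (hq : ‖q‖ < 1) {a z b c d e f g : ℂ} (ha : a ≠ 0)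
    (hz : z ≠ 0) (hb : b ≠ 0) (hc : c ≠ 0) (hd : d ≠ 0) (he : e ≠ 0) (hf : f ≠ 0) (hg : g ≠ 0)
    (h : b * c * d * e = a * q * z) :
    sixSum q b a b c d e f g =
      qPochInf q (a * q / (b * b)) * qPochInf q (a * q / (b * c)) * qPochInf q (a * q / (b * d)) *
      qPochInf q (a * q / (b * e)) * qPochInf q (a * q / (b * f)) * qPochInf q (a * q / (b * g)) *
        oneSidedSum q a b c d e f g (a ^ 2 * q / (f * g * z)) := by
  have hsupp : Function.support (sixTerm q b a b c d e f g) ⊆ Set.range ((↑) : ℕ → ℤ) := by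
    intro n hn
    rcases lt_or_ge n 0 with hn' | hn'
    · refine absurd ?_ hn
      have h0 : pairTerm q (b * q / b) (a / (b * b)) n = 0 := by
        rw [pairTerm, mul_div_cancel_left₀ _ hb, ← zpow_one_add₀ hq0,
          qPochInf_zpow_eq_zero hq0 (by omega)]
        ring
      rw [sixTerm_eq, h0]
      ring
    · exact ⟨n.toNat, Int.toNat_of_nonneg hn'⟩
  rw [sixSum, ← Nat.cast_injective.tsum_eq hsupp, oneSidedSum, ← tsum_mul_left]
  refine tsum_congr fun n => ?_
  have hw : (a ^ 2 * q / (f * g * z)) ^ n = (a / (b * b)) ^ n * (a / (b * c)) ^ n * (a / (b * d)) ^ n *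
      (a / (b * e)) ^ n * (a / (b * f)) ^ n * (a / (b * g)) ^ n * (b ^ 6 * q ^ 2 / a ^ 3) ^ n := by
    simp only [← mul_pow]
    congr 1
    field_simp
    linear_combination h
  rw [sixTerm_eq, oneSidedTerm, hw]
  have e2 : q ^ (2 * (n : ℤ)) = q ^ (2 * n) := by exact_mod_cast zpow_natCast q (2 * n)
  rw [pairTerm_natCast' hq0 hq ha hb hb, pairTerm_natCast' hq0 hq ha hb hc,
    pairTerm_natCast' hq0 hq ha hb hd, pairTerm_natCast' hq0 hq ha hb he,
    pairTerm_natCast' hq0 hq ha hb hf, pairTerm_natCast' hq0 hq ha hb hg, zpow_natCast, e2]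
  generalize (b ^ 6 * q ^ 2 / a ^ 3) ^ n = w
  generalize 1 - b ^ 2 / a * q ^ (2 * n) = v
  generalize (a / (b * b)) ^ n = w₁
  generalize (a / (b * c)) ^ n = w₂
  generalize (a / (b * d)) ^ n = w₃
  generalize (a / (b * e)) ^ n = w₄
  generalize (a / (b * f)) ^ n = w₅
  generalize (a / (b * g)) ^ n = w₆
  generalize qPochInf q (b * q / b * q ^ n) = u₁
  generalize qPochInf q (b * q / c * q ^ n) = u₂
  generalize qPochInf q (b * q / d * q ^ n) = u₃
  generalize qPochInf q (b * q / e * q ^ n) = u₄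
  generalize qPochInf q (b * q / f * q ^ n) = u₅
  generalize qPochInf q (b * q / g * q ^ n) = u₆
  generalize qPochInf q (a * q / (b * b)) = v₁
  generalize qPochInf q (a * q / (b * c)) = v₂
  generalize qPochInf q (a * q / (b * d)) = v₃
  generalize qPochInf q (a * q / (b * e)) = v₄
  generalize qPochInf q (a * q / (b * f)) = v₅
  generalize qPochInf q (a * q / (b * g)) = v₆
  ring

/-- The ratios of parameters that must avoid `q ^ ℤ` in the generic case. -/
def genericRatios (a z b c d e : ℂ) : List ℂ :=
  [c / b, d / b, e / b, z / a, b * e / z, c * e / z, d * e / z, e * z / a, e / z, b ^ 2 / z,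
    b * c / z, b * d / z, b * c / a, b * d / a, b * e / a, b ^ 2 / a]

lemma qPochInf_ne_zero_of_mul_eq (hq0 : q ≠ 0) (hq : ‖q‖ < 1) {x y : ℂ}
    (hx : ∀ k : ℤ, x ≠ q ^ k) (h : x * y = q) : qPochInf q y ≠ 0 := by
  refine qPochInf_ne_zero_of_forall_zpow hq0 hq fun m hm => hx (1 - m) ?_
  rw [zpow_sub₀ hq0, zpow_one, eq_div_iff (zpow_ne_zero _ hq0), ← hm, h]

/-- B, the auxiliary sum over b q^ℤ, is eliminated between the two-term and the three-term relation.
The nonvanishing factors are cancelled here so that the result contains only quantities continuous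
in the parameters. -/
lemma three_term_algebra {b z π T Pfg Paz Pq Bb B ρ θz π₂ Pbb F G W U₁ U₂ U₃ Uz θ₂ S V T₀ C A : ℂ}
    (h₁ : π * (Pfg * Paz * (Pq * (Bb * Pbb)) * B) =
      ρ * (θz * Paz * Pq * π₂ * (Pbb * π * F * G * W)))
    (h₂ : b * T * (Pfg * Paz * (Pq * θ₂) * B) +
      1 / z * (θz * (U₁ * U₂ * U₃ * π₂) * Uz) * (Pfg * Paz * (Pq * θ₂) * S) =
      ρ * (-(Pq * V * θz * T₀ * Paz * (π₂ * C)) * A))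
    (hπ : π ≠ 0) (hPaz : Paz ≠ 0) (hPq : Pq ≠ 0) (hPbb : Pbb ≠ 0) (hθz : θz ≠ 0) (hπ₂ : π₂ ≠ 0) :
    b * T * θ₂ * ρ * (F * G) * W + 1 / z * (U₁ * U₂ * U₃) * Uz * Pfg * θ₂ * Bb * S =
      -(ρ * V * T₀ * C * Bb * A) := by
  have h₃ : Pfg * Bb * B = ρ * θz * π₂ * F * G * W := by
    apply mul_left_cancel₀ (mul_ne_zero (mul_ne_zero (mul_ne_zero hπ hPaz) hPq) hPbb)
    linear_combination h₁
  apply mul_left_cancel₀ (mul_ne_zero (mul_ne_zero (mul_ne_zero hPaz hPq) hθz) hπ₂)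
  linear_combination Bb * h₂ - b * T * Paz * Pq * θ₂ * h₃

/-- The three-term relation with cleared denominators, for generic parameters. -/
lemma three_term_generic (hq0 : q ≠ 0) (hq : ‖q‖ < 1) {a z b c d e f g : ℂ} (ha : a ≠ 0)
    (hz : z ≠ 0) (hb : b ≠ 0) (hc : c ≠ 0) (hd : d ≠ 0) (he : e ≠ 0) (hf : f ≠ 0) (hg : g ≠ 0)
    (h : b * c * d * e = a * q * z) (hρ : ‖a ^ 2 * q / (f * g * z)‖ < 1)
    (hρσ : ‖a * q / (f * g)‖ < 1) (hgen : ∀ x ∈ genericRatios a z b c d e, ∀ k : ℤ, x ≠ q ^ k) :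
    b * (thetaProd q (1 / z) * thetaProd q (c / z) * thetaProd q (d / z) * thetaProd q (e / z) *
        thetaProd q (z / a)) * thetaProd q (z ^ 2 / a) * qPochInf q (a ^ 2 * q / (f * g * z)) *
      (qPochInf q (a * q / (b * f)) * qPochInf q (a * q / (b * g))) *
      oneSidedSum q a b c d e f g (a ^ 2 * q / (f * g * z)) +
    1 / z * (qPochInf q (a * q / (d * e)) * qPochInf q (a * q / (c * e)) *
        qPochInf q (a * q / (c * d))) * thetaProd q (b * z / a) * qPochInf q (a * q / (f * g)) *
      thetaProd q (z ^ 2 / a) * qPochInf q (b ^ 2 / a) *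
      sixSum q z z b c d e (f * z / a) (g * z / a) =
    -(qPochInf q (a ^ 2 * q / (f * g * z)) * thetaProd q b * thetaProd q (1 / z) *
      (qPochInf q (b * e / a) * qPochInf q (b * d / a) * qPochInf q (b * c / a)) *
      qPochInf q (b ^ 2 / a) * sixSum q z a b c d e f g) := by
  simp only [genericRatios, List.forall_mem_cons, List.not_mem_nil, false_imp_iff, implies_true,
    and_true] at hgen
  obtain ⟨gcb, gdb, geb, gza, gbez, gcez, gdez, geza, gez, gbbz, gbcz, gbdz, gbca, gbda, gbea, gbba⟩ :=
    hgen
  have h₁ := sixSum_two_term hq0 hq ha hz hb hc hd he hf hg h hρ hρσ gcb gdb geb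
  have h₂ := sixSum_three_term hq0 hq ha hz hb hc hd he hf hg h hρ hρσ gbez gcez gdez geza gez
  rw [sixSum_eq_oneSidedSum hq0 hq ha hz hb hc hd he hf hg h] at h₁
  have nz {x y : ℂ} (hx : ∀ k : ℤ, x ≠ q ^ k) (h : x * y = q) : qPochInf q y ≠ 0 :=
    qPochInf_ne_zero_of_mul_eq hq0 hq hx h
  have n₁ := nz gbca (y := a * q / (b * c)) (by field_simp)
  have n₂ := nz gbda (y := a * q / (b * d)) (by field_simp)
  have n₃ := nz gbea (y := a * q / (b * e)) (by field_simp)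
  have n₄ := nz gza (y := a * q / z) (by field_simp)
  have n₅ := nz gbcz (y := z * q / (b * c)) (by field_simp)
  have n₆ := nz gbdz (y := z * q / (b * d)) (by field_simp)
  have n₇ := nz gbez (y := z * q / (b * e)) (by field_simp)
  have n₈ := nz gbba (y := a * q / (b * b)) (by field_simp)
  have n₉ := thetaProd_ne_zero hq0 hq gbbz
  have nq := qPochInf_q_ne_zero hq0 hq
  have t₀ : thetaProd q (b ^ 2 / a) = qPochInf q (b ^ 2 / a) * qPochInf q (a * q / (b * b)) := by
    rw [thetaProd]; congr 2; field_simp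
  -- By bcde = aqz, half of this theta function is (aq/(de);q)_∞, a factor of the stated
  -- coefficient; the other half cancels against the inner sums.
  have t₁ : thetaProd q (b * c / z) = qPochInf q (a * q / (d * e)) * qPochInf q (z * q / (b * c)) := by
    rw [thetaProd]
    congr 2
    · field_simp; linear_combination h
    · field_simp
  have t₂ : thetaProd q (b * d / z) = qPochInf q (a * q / (c * e)) * qPochInf q (z * q / (b * d)) := by
    rw [thetaProd]
    congr 2
    · field_simp; linear_combination h
    · field_simp
  have t₃ : thetaProd q (b * e / z) = qPochInf q (a * q / (c * d)) * qPochInf q (z * q / (b * e)) := by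
    rw [thetaProd]
    congr 2
    · field_simp; linear_combination h
    · field_simp
  have c₁ : z * q / (c * d) = b * e / a := by field_simp; linear_combination -h
  have c₂ : z * q / (c * e) = b * d / a := by field_simp; linear_combination -h
  have c₃ : z * q / (d * e) = b * c / a := by field_simp; linear_combination -h
  rw [t₁, t₂, t₃, c₁, c₂, c₃] at h₂
  rw [t₀] at h₁
  refine three_term_algebra (θz := thetaProd q (b ^ 2 / z)) (Pq := qPochInf q q)
    (π := qPochInf q (a * q / (b * c)) * qPochInf q (a * q / (b * d)) * qPochInf q (a * q / (b * e)))
    (π₂ := qPochInf q (z * q / (b * c)) * qPochInf q (z * q / (b * d)) * qPochInf q (z * q / (b * e)))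
    (Paz := qPochInf q (a * q / z)) (Pbb := qPochInf q (a * q / (b * b)))
    (B := sixSum q b z b c d e (f * z / a) (g * z / a))
    (h₁.trans ?_) ((Eq.trans ?_ h₂).trans ?_)
    (mul_ne_zero (mul_ne_zero n₁ n₂) n₃) n₄ nq n₈ n₉ (mul_ne_zero (mul_ne_zero n₅ n₆) n₇)
  all_goals clear * -
  all_goals ring

/-! ### Removing genericity by continuity -/

lemma norm_prod_mul_qPochInf_le (hq : ‖q‖ < 1) (u v : ℂ) (n : ℕ) :
    ‖(∏ k ∈ Finset.range n, (1 - u * q ^ k)) * qPochInf q (v * q ^ n)‖ ≤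
      Real.exp (‖u‖ / (1 - ‖q‖)) * Real.exp (‖v‖ / (1 - ‖q‖)) := by
  rw [norm_mul]
  gcongr
  · exact norm_prod_one_sub_le hq u n
  · refine (norm_qPochInf_le hq _).trans ?_
    have : 0 < 1 - ‖q‖ := by linarith
    gcongr
    rw [norm_mul, norm_pow]
    exact mul_le_of_le_one_right (norm_nonneg _) (pow_le_one₀ (norm_nonneg _) hq.le)

/-- A bound for the coefficients of the one-sided series. -/
def oneSidedBound (q a b c d e f g : ℂ) : ℝ :=
  (1 + ‖b ^ 2 / a‖) *
    (Real.exp (‖b * b / a‖ / (1 - ‖q‖)) * Real.exp (‖b * q / b‖ / (1 - ‖q‖)) *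
    (Real.exp (‖b * c / a‖ / (1 - ‖q‖)) * Real.exp (‖b * q / c‖ / (1 - ‖q‖))) *
    (Real.exp (‖b * d / a‖ / (1 - ‖q‖)) * Real.exp (‖b * q / d‖ / (1 - ‖q‖))) *
    (Real.exp (‖b * e / a‖ / (1 - ‖q‖)) * Real.exp (‖b * q / e‖ / (1 - ‖q‖))) *
    (Real.exp (‖b * f / a‖ / (1 - ‖q‖)) * Real.exp (‖b * q / f‖ / (1 - ‖q‖))) *
    (Real.exp (‖b * g / a‖ / (1 - ‖q‖)) * Real.exp (‖b * q / g‖ / (1 - ‖q‖))))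

lemma norm_oneSidedTerm_le (hq : ‖q‖ < 1) (a b c d e f g w : ℂ) (n : ℕ) :
    ‖oneSidedTerm q a b c d e f g w n‖ ≤ oneSidedBound q a b c d e f g * ‖w‖ ^ n := by
  have h₀ : ‖1 - b ^ 2 / a * q ^ (2 * n)‖ ≤ 1 + ‖b ^ 2 / a‖ := by
    refine (norm_sub_le _ _).trans ?_
    rw [norm_one, norm_mul (b ^ 2 / a), norm_pow q]
    gcongr
    exact mul_le_of_le_one_right (norm_nonneg _) (pow_le_one₀ (norm_nonneg _) hq.le)
  rw [oneSidedTerm, oneSidedBound, norm_mul _ (w ^ n), norm_pow w]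
  gcongr
  rw [norm_mul]
  gcongr
  iterate 5
    rw [norm_mul]
    refine mul_le_mul ?_ (norm_prod_mul_qPochInf_le hq _ _ n) (norm_nonneg _) (by positivity)
  exact norm_prod_mul_qPochInf_le hq _ _ n

lemma summable_oneSidedTerm (hq : ‖q‖ < 1) (a b c d e f g : ℂ) {w : ℂ} (hw : ‖w‖ < 1) :
    Summable (oneSidedTerm q a b c d e f g w) :=
  Summable.of_norm_bounded ((summable_geometric_of_lt_one (norm_nonneg _) hw).mul_left _)
    (norm_oneSidedTerm_le hq a b c d e f g w)

section Limits

variable {ι : Type*} {l : Filter ι}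

lemma tendsto_qPochInf (hq : ‖q‖ < 1) {u : ι → ℂ} {u₀ : ℂ} (hu : Tendsto u l (𝓝 u₀)) :
    Tendsto (fun i => qPochInf q (u i)) l (𝓝 (qPochInf q u₀)) :=
  ((continuous_qPochInf hq).tendsto u₀).comp hu

lemma tendsto_thetaProd (hq : ‖q‖ < 1) {u : ι → ℂ} {u₀ : ℂ} (hu : Tendsto u l (𝓝 u₀))
    (h0 : u₀ ≠ 0) : Tendsto (fun i => thetaProd q (u i)) l (𝓝 (thetaProd q u₀)) :=
  (tendsto_qPochInf hq hu).mul (tendsto_qPochInf hq (tendsto_const_nhds.div hu h0))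

lemma tendsto_oneSidedSum (hq : ‖q‖ < 1) {a f g : ℂ} {b c d e w : ι → ℂ} {b₀ c₀ d₀ e₀ w₀ : ℂ}
    (hb : Tendsto b l (𝓝 b₀)) (hc : Tendsto c l (𝓝 c₀)) (hd : Tendsto d l (𝓝 d₀))
    (he : Tendsto e l (𝓝 e₀)) (hw : Tendsto w l (𝓝 w₀)) (b0 : b₀ ≠ 0) (c0 : c₀ ≠ 0) (d0 : d₀ ≠ 0)
    (e0 : e₀ ≠ 0) (hw₀ : ‖w₀‖ < 1) :
    Tendsto (fun i => oneSidedSum q a (b i) (c i) (d i) (e i) f g (w i)) l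
      (𝓝 (oneSidedSum q a b₀ c₀ d₀ e₀ f g w₀)) := by
  obtain ⟨r, hr, hr1⟩ := exists_between hw₀
  have E {u : ι → ℂ} {u₀ : ℂ} (hu : Tendsto u l (𝓝 u₀)) :
      Tendsto (fun i => Real.exp (‖u i‖ / (1 - ‖q‖))) l (𝓝 (Real.exp (‖u₀‖ / (1 - ‖q‖)))) :=
    (Real.continuous_exp.tendsto _).comp (hu.norm.div_const _)
  have EE {p : ι → ℂ} {p₀ : ℂ} (hp : Tendsto p l (𝓝 p₀)) (hp0 : p₀ ≠ 0) :=
    (E ((hb.mul hp).div_const a)).mul (E ((hb.mul_const q).div hp hp0))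
  have EC (p : ℂ) :=
    (E ((hb.mul_const p).div_const a)).mul (E ((hb.mul_const q).div_const p))
  have hB : Tendsto (fun i => oneSidedBound q a (b i) (c i) (d i) (e i) f g) l
      (𝓝 (oneSidedBound q a b₀ c₀ d₀ e₀ f g)) :=
    (((hb.pow 2).div_const a).norm.const_add 1).mul
      ((((((EE hb b0).mul (EE hc c0)).mul (EE hd d0)).mul (EE he e0)).mul (EC f)).mul (EC g))
  have FF (n : ℕ) {u v : ι → ℂ} {u₀ v₀ : ℂ} (hu : Tendsto u l (𝓝 u₀)) (hv : Tendsto v l (𝓝 v₀)) :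
      Tendsto (fun i => (∏ k ∈ Finset.range n, (1 - u i * q ^ k)) * qPochInf q (v i * q ^ n)) l
        (𝓝 ((∏ k ∈ Finset.range n, (1 - u₀ * q ^ k)) * qPochInf q (v₀ * q ^ n))) :=
    (tendsto_finsetProd _ fun k _ => (hu.mul_const _).const_sub 1).mul
      (tendsto_qPochInf hq (hv.mul_const _))
  have FP (n : ℕ) {p : ι → ℂ} {p₀ : ℂ} (hp : Tendsto p l (𝓝 p₀)) (hp0 : p₀ ≠ 0) :=
    FF n ((hb.mul hp).div_const a) ((hb.mul_const q).div hp hp0)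
  have FC (n : ℕ) (p : ℂ) := FF n ((hb.mul_const p).div_const a) ((hb.mul_const q).div_const p)
  refine tendsto_tsum_of_dominated_convergence
    (bound := fun n => (oneSidedBound q a b₀ c₀ d₀ e₀ f g + 1) * r ^ n)
    ((summable_geometric_of_lt_one ((norm_nonneg _).trans hr.le) hr1).mul_left _) (fun n => ?_) ?_
  · exact ((((hb.pow 2).div_const a).mul_const _).const_sub 1).mul
      ((((((FP n hb b0).mul (FP n hc c0)).mul (FP n hd d0)).mul (FP n he e0)).mul
        (FC n f)).mul (FC n g)) |>.mul (hw.pow n)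
  · filter_upwards [hB.eventually_lt_const (lt_add_one _), hw.norm.eventually_lt_const hr]
      with i h₁ h₂ n
    have h0 : 0 ≤ oneSidedBound q a (b i) (c i) (d i) (e i) f g := by
      unfold oneSidedBound; positivity
    refine (norm_oneSidedTerm_le hq _ _ _ _ _ _ _ _ n).trans ?_
    have : 0 ≤ ‖w i‖ := norm_nonneg _
    refine mul_le_mul h₁.le (pow_le_pow_left₀ this h₂.le n) (by positivity) (h0.trans h₁.le)

end Limits

/-- A co-countable set of reals is dense, so limits along this filter are unique although countably
many bad points are discarded. -/
lemma neBot_nhds_inf_cocountable (x : ℝ) : (𝓝 x ⊓ cocountable).NeBot := by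
  refine inf_neBot_iff.2 fun s hs t ht => ?_
  rw [mem_cocountable] at ht
  obtain ⟨y, hy, hy'⟩ := (ht.dense_compl ℝ).inter_nhds_nonempty hs
  exact ⟨y, hy', by simpa using hy⟩

/-- On positive reals x ↦ m x^j is injective for j ≠ 0, and q^ℤ is countable. -/
lemma eventually_mul_zpow_ne (q : ℂ) {m : ℂ} (hm : m ≠ 0) {j : ℤ} (hj : j ≠ 0) :
    ∀ᶠ x : ℝ in 𝓝 1 ⊓ cocountable, ∀ k : ℤ, m * (x : ℂ) ^ j ≠ q ^ k := by
  have hc : {x : ℝ | 0 < x ∧ ∃ k : ℤ, m * (x : ℂ) ^ j = q ^ k}.Countable := by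
    refine Set.MapsTo.countable_of_injOn (f := fun x : ℝ => m * (x : ℂ) ^ j)
      (t := Set.range fun k : ℤ => q ^ k) ?_ ?_ (Set.countable_range _)
    · rintro x ⟨-, k, hk⟩
      exact ⟨k, hk.symm⟩
    · rintro x ⟨hx, -⟩ y ⟨hy, -⟩ hxy
      have : x ^ j = y ^ j := by exact_mod_cast mul_left_cancel₀ hm hxy
      exact zpow_left_injOn₀ hj hx.le hy.le this
  have h₁ : ∀ᶠ x : ℝ in 𝓝 1 ⊓ cocountable, 0 < x :=
    (lt_mem_nhds one_pos).filter_mono inf_le_left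
  have h₂ : ∀ᶠ x : ℝ in 𝓝 1 ⊓ cocountable, ¬(0 < x ∧ ∃ k : ℤ, m * (x : ℂ) ^ j = q ^ k) := by
    refine Filter.Eventually.filter_mono inf_le_right ?_
    rw [Filter.Eventually, mem_cocountable]
    simpa [Set.compl_ofPred] using hc
  filter_upwards [h₁, h₂] with x hx hx' k hk
  exact hx' ⟨hx, k, hk⟩

/-- The exponents 1, 2, 4, 8 of b, c, d, e force the exponent 15 for z, since bcde = aqz has to
persist. Along this curve every ratio in the list is a monomial in x with nonzero exponent. -/
lemma eventually_genericRatios (q : ℂ) {a z b c d e : ℂ} (ha : a ≠ 0) (hz : z ≠ 0) (hb : b ≠ 0)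
    (hc : c ≠ 0) (hd : d ≠ 0) (he : e ≠ 0) :
    ∀ᶠ x : ℝ in 𝓝 1 ⊓ cocountable, ∀ y ∈ genericRatios a (z * x ^ 15) (b * x) (c * x ^ 2)
      (d * x ^ 4) (e * x ^ 8), ∀ k : ℤ, y ≠ q ^ k := by
  have h₁ : ∀ᶠ x : ℝ in 𝓝 1 ⊓ cocountable, 0 < x :=
    (lt_mem_nhds one_pos).filter_mono inf_le_left
  simp only [genericRatios, List.forall_mem_cons, List.not_mem_nil, false_imp_iff, implies_true,
    and_true]
  have key {y : ℝ → ℂ} {m : ℂ} (j : ℤ) (hm : m ≠ 0) (hj : j ≠ 0)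
      (h : ∀ x : ℝ, (x : ℂ) ≠ 0 → y x = m * (x : ℂ) ^ j) :
      ∀ᶠ x : ℝ in 𝓝 1 ⊓ cocountable, ∀ k : ℤ, y x ≠ q ^ k := by
    filter_upwards [h₁, eventually_mul_zpow_ne q hm hj] with x hx hx' k hk
    exact hx' k (by rw [← hk, h x (by exact_mod_cast hx.ne')])
  refine (key (m := c / b) 1 ?_ ?_ ?_).and <| (key (m := d / b) 3 ?_ ?_ ?_).and <|
    (key (m := e / b) 7 ?_ ?_ ?_).and <| (key (m := z / a) 15 ?_ ?_ ?_).and <|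
    (key (m := b * e / z) (-6) ?_ ?_ ?_).and <| (key (m := c * e / z) (-5) ?_ ?_ ?_).and <|
    (key (m := d * e / z) (-3) ?_ ?_ ?_).and <| (key (m := e * z / a) 23 ?_ ?_ ?_).and <|
    (key (m := e / z) (-7) ?_ ?_ ?_).and <| (key (m := b ^ 2 / z) (-13) ?_ ?_ ?_).and <|
    (key (m := b * c / z) (-12) ?_ ?_ ?_).and <| (key (m := b * d / z) (-10) ?_ ?_ ?_).and <|
    (key (m := b * c / a) 3 ?_ ?_ ?_).and <| (key (m := b * d / a) 5 ?_ ?_ ?_).and <|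
    (key (m := b * e / a) 9 ?_ ?_ ?_).and <| (key (m := b ^ 2 / a) 2 ?_ ?_ ?_)
  all_goals first
    | (intro x hx; generalize (x : ℂ) = y at *; field_simp)
    | simp [*]

/-- The three-term relation with cleared denominators. -/
theorem three_term (hq0 : q ≠ 0) (hq : ‖q‖ < 1) {a z b c d e f g : ℂ} (ha : a ≠ 0)
    (hz : z ≠ 0) (hb : b ≠ 0) (hc : c ≠ 0) (hd : d ≠ 0) (he : e ≠ 0) (hf : f ≠ 0) (hg : g ≠ 0)
    (h : b * c * d * e = a * q * z) (hρ : ‖a ^ 2 * q / (f * g * z)‖ < 1)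
    (hρσ : ‖a * q / (f * g)‖ < 1) :
    b * (thetaProd q (1 / z) * thetaProd q (c / z) * thetaProd q (d / z) * thetaProd q (e / z) *
        thetaProd q (z / a)) * thetaProd q (z ^ 2 / a) * qPochInf q (a ^ 2 * q / (f * g * z)) *
      (qPochInf q (a * q / (b * f)) * qPochInf q (a * q / (b * g))) *
      oneSidedSum q a b c d e f g (a ^ 2 * q / (f * g * z)) +
    1 / z * (qPochInf q (a * q / (d * e)) * qPochInf q (a * q / (c * e)) *
        qPochInf q (a * q / (c * d))) * thetaProd q (b * z / a) * qPochInf q (a * q / (f * g)) *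
      thetaProd q (z ^ 2 / a) * qPochInf q (b ^ 2 / a) *
      sixSum q z z b c d e (f * z / a) (g * z / a) =
    -(qPochInf q (a ^ 2 * q / (f * g * z)) * thetaProd q b * thetaProd q (1 / z) *
      (qPochInf q (b * e / a) * qPochInf q (b * d / a) * qPochInf q (b * c / a)) *
      qPochInf q (b ^ 2 / a) * sixSum q z a b c d e f g) := by
  have := neBot_nhds_inf_cocountable 1
  have hx : Tendsto (fun x : ℝ => (x : ℂ)) (𝓝 1 ⊓ cocountable) (𝓝 1) := by
    simpa using (Complex.continuous_ofReal.tendsto 1).mono_left inf_le_left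
  have hpow (m : ℂ) (j : ℕ) : Tendsto (fun x : ℝ => m * (x : ℂ) ^ j) (𝓝 1 ⊓ cocountable) (𝓝 m) := by
    simpa using (hx.pow j).const_mul m
  have tb : Tendsto (fun x : ℝ => b * (x : ℂ)) (𝓝 1 ⊓ cocountable) (𝓝 b) := by
    simpa using hx.const_mul b
  have tc := hpow c 2
  have td := hpow d 4
  have te := hpow e 8
  have tz := hpow z 15
  have tρ : Tendsto (fun x : ℝ => a ^ 2 * q / (f * g * (z * (x : ℂ) ^ 15))) (𝓝 1 ⊓ cocountable)
      (𝓝 (a ^ 2 * q / (f * g * z))) := tendsto_const_nhds.div (tz.const_mul _) (by simp [*])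
  have P {u : ℝ → ℂ} {u₀ : ℂ} (hu : Tendsto u (𝓝 1 ⊓ cocountable) (𝓝 u₀)) := tendsto_qPochInf hq hu
  have Θ {u : ℝ → ℂ} {u₀ : ℂ} (hu : Tendsto u (𝓝 1 ⊓ cocountable) (𝓝 u₀)) (h0 : u₀ ≠ 0) :=
    tendsto_thetaProd hq hu h0
  have D {u v : ℝ → ℂ} {u₀ v₀ : ℂ} (hu : Tendsto u (𝓝 1 ⊓ cocountable) (𝓝 u₀))
      (hv : Tendsto v (𝓝 1 ⊓ cocountable) (𝓝 v₀)) (h0 : v₀ ≠ 0) :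
      Tendsto (fun x => u x / v x) (𝓝 1 ⊓ cocountable) (𝓝 (u₀ / v₀)) := hu.div hv h0
  have K (m : ℂ) : Tendsto (fun _ : ℝ => m) (𝓝 1 ⊓ cocountable) (𝓝 m) := tendsto_const_nhds
  have t₁ := Θ (D (K 1) tz hz) (by simp [*])
  have t₂ := Θ (D tc tz hz) (by simp [*])
  have t₃ := Θ (D td tz hz) (by simp [*])
  have t₄ := Θ (D te tz hz) (by simp [*])
  have t₅ := Θ (D tz (K a) ha) (by simp [*])
  have t₆ := Θ (D (tz.pow 2) (K a) ha) (by simp [*])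
  have t₇ := Θ (D (tb.mul tz) (K a) ha) (by simp [*])
  have t₈ := Θ tb hb
  have pbf := P (D (K (a * q)) (tb.mul (K f)) (by simp [*]))
  have pbg := P (D (K (a * q)) (tb.mul (K g)) (by simp [*]))
  have pde := P (D (K (a * q)) (td.mul te) (by simp [*]))
  have pce := P (D (K (a * q)) (tc.mul te) (by simp [*]))
  have pcd := P (D (K (a * q)) (tc.mul td) (by simp [*]))
  have pbb := P (D (tb.pow 2) (K a) ha)
  have pbc := P (D (tb.mul tc) (K a) ha)
  have pbd := P (D (tb.mul td) (K a) ha)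
  have pbe := P (D (tb.mul te) (K a) ha)
  have W := tendsto_oneSidedSum (a := a) (f := f) (g := g) hq tb tc td te tρ hb hc hd he hρ
  have S₁ := tendsto_sixSum hq0 hq tz tz tb tc td te (D ((K f).mul tz) (K a) ha)
    (D ((K g).mul tz) (K a) ha) hz hz hb hc hd he (by simp [*]) (by simp [*]) (by
      refine lt_of_eq_of_lt (congrArg _ ?_) hρσ
      field_simp
      linear_combination -h)
  have S₂ := tendsto_sixSum hq0 hq tz (K a) tb tc td te (K f) (K g) hz ha hb hc hd he hf hg (by
      refine lt_of_eq_of_lt (congrArg _ ?_) hρ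
      field_simp
      linear_combination -h)
  have L := ((((((tb.mul ((((t₁.mul t₂).mul t₃).mul t₄).mul t₅)).mul t₆).mul (P tρ)).mul
    (pbf.mul pbg)).mul W).add (((((((D (K 1) tz hz).mul ((pde.mul pce).mul pcd)).mul t₇).mul
    (K (qPochInf q (a * q / (f * g))))).mul t₆).mul pbb).mul S₁))
  have R := (((((P tρ).mul t₈).mul t₁).mul ((pbe.mul pbd).mul pbc)).mul pbb).mul S₂ |>.neg
  -- Both sides are continuous along the curve and agree at all generic points near x = 1.
  refine tendsto_nhds_unique_of_eventuallyEq L R ?_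
  have h₁ : ∀ᶠ x : ℝ in 𝓝 1 ⊓ cocountable, 0 < x :=
    (lt_mem_nhds one_pos).filter_mono inf_le_left
  filter_upwards [h₁, eventually_genericRatios q ha hz hb hc hd he,
    tρ.norm.eventually_lt_const hρ] with x hx hgen hρx
  have hx0 : (x : ℂ) ≠ 0 := by exact_mod_cast hx.ne'
  exact three_term_generic hq0 hq ha (by simp [*]) (by simp [*]) (by simp [*]) (by simp [*])
    (by simp [*]) hf hg (by linear_combination (x : ℂ) ^ 15 * h) hρx hρσ hgen

/-! ### Very-well-poised series in terms of the cleared sums -/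

lemma qPoch_natCast (q x : ℂ) (n : ℕ) : qPoch q x n = ∏ k ∈ Finset.range n, (1 - x * q ^ k) := rfl

lemma qPoch_neg_natCast (q x : ℂ) (n : ℕ) :
    qPoch q x (-n) = (∏ k ∈ Finset.range n, (1 - x / q ^ (k + 1)))⁻¹ := by
  cases n with
  | zero => simpa using qPoch_natCast q x 0
  | succ n => rfl

lemma qPoch_ratio_natCast (hq : ‖q‖ < 1) {α x : ℂ} (hα : ∀ k : ℕ, 1 - α * q ^ k ≠ 0) (n : ℕ) :
    qPoch q x n / qPoch q α n * qPochInf q α =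
      (∏ k ∈ Finset.range n, (1 - x * q ^ k)) * qPochInf q (α * q ^ n) := by
  have h : ∏ k ∈ Finset.range n, (1 - α * q ^ k) ≠ 0 := Finset.prod_ne_zero_iff.2 fun k _ => hα k
  rw [qPoch_natCast, qPoch_natCast, qPochInf_eq_prod_mul hq α n]
  field_simp

/-- The bridge between the two languages: a quotient of shifted factorials becomes a `pairTerm` once
multiplied by two infinite products, for both signs of the index. -/
lemma qPoch_ratio (hq0 : q ≠ 0) (hq : ‖q‖ < 1) {α x : ℂ} (hx0 : x ≠ 0)
    (hα : ∀ k : ℕ, 1 - α * q ^ k ≠ 0) (hx : ∀ k : ℕ, 1 - x / q ^ (k + 1) ≠ 0) (k : ℤ) :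
    qPoch q x k / qPoch q α k * (qPochInf q α * qPochInf q (q / x)) =
      pairTerm q α (1 / x) k * x ^ k := by
  obtain ⟨n, rfl | rfl⟩ := k.eq_nat_or_neg
  · have h : (∏ k ∈ Finset.range n, (1 / x - q ^ k)) * x ^ n = ∏ k ∈ Finset.range n, (1 - x * q ^ k) := by
      conv_lhs => rw [← Finset.card_range n, ← Finset.prod_const, Finset.card_range,
        ← Finset.prod_mul_distrib]
      refine Finset.prod_congr rfl fun k _ => ?_
      field_simp
    rw [← mul_assoc, qPoch_ratio_natCast hq hα, pairTerm_natCast hq0 hq, zpow_natCast, ← h,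
      one_div_mul_eq_div]
    ring
  · have hd : ∏ k ∈ Finset.range n, (1 - x / q ^ (k + 1)) ≠ 0 :=
      Finset.prod_ne_zero_iff.2 fun k _ => hx k
    have hr : q ^ n * (x ^ n)⁻¹ = ∏ _k ∈ Finset.range n, (q / x) := by
      rw [Finset.prod_const, Finset.card_range, div_pow, div_eq_mul_inv]
    have h₁ : (∏ k ∈ Finset.range n, (α / q - q ^ k)) * (q ^ n * (x ^ n)⁻¹) *
        ∏ k ∈ Finset.range n, (1 - x / q ^ (k + 1)) =
        (∏ k ∈ Finset.range n, (1 - α / q ^ (k + 1))) *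
          ∏ k ∈ Finset.range n, (1 - q / x * q ^ k) := by
      rw [hr, ← Finset.prod_mul_distrib, ← Finset.prod_mul_distrib, ← Finset.prod_mul_distrib]
      refine Finset.prod_congr rfl fun k _ => ?_
      rw [pow_succ q k]
      field_simp
      ring
    rw [qPoch_neg_natCast, qPoch_neg_natCast, pairTerm_neg hq0, pairTerm_natCast hq0 hq, zpow_neg,
      zpow_natCast, zpow_natCast, qPochInf_eq_prod_mul hq (q / x) n, one_div_mul_eq_div,
      div_mul_cancel₀ _ hq0, div_inv_eq_mul]
    generalize ∏ k ∈ Finset.range n, (1 - x / q ^ (k + 1)) = u at *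
    generalize ∏ k ∈ Finset.range n, (1 - α / q ^ (k + 1)) = v at *
    generalize ∏ k ∈ Finset.range n, (1 - q / x * q ^ k) = w at *
    generalize ∏ k ∈ Finset.range n, (α / q - q ^ k) = y at *
    rw [inv_mul_eq_div, div_mul_eq_mul_div, div_eq_iff hd]
    linear_combination -(qPochInf q α * qPochInf q (q / x * q ^ n)) * h₁

lemma qPoch_mul_q_ratio_natCast {r : ℂ} (hr : ∀ k : ℕ, 1 - r * q ^ k ≠ 0) (n : ℕ) :
    qPoch q (q * r) n / qPoch q r n = (1 - r * q ^ n) / (1 - r) := by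
  have h0 : 1 - r ≠ 0 := by simpa using hr 0
  have h : ∏ k ∈ Finset.range n, (1 - r * q ^ k) ≠ 0 := Finset.prod_ne_zero_iff.2 fun k _ => hr k
  rw [qPoch_natCast, qPoch_natCast, div_eq_div_iff h h0, mul_comm (1 - r * q ^ n),
    ← Finset.prod_range_succ, Finset.prod_range_succ']
  congr 1
  · exact Finset.prod_congr rfl fun k _ => by rw [pow_succ]; ring
  · simp

/-- All but the first and last factors cancel. Applied to both square roots of A this produces (1 -
A q^{2k})/(1 - A). -/
lemma qPoch_mul_q_ratio (hq0 : q ≠ 0) {r : ℂ} (hr : ∀ k : ℕ, 1 - r * q ^ k ≠ 0)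
    (hr' : ∀ k : ℕ, 1 - q * r / q ^ (k + 1) ≠ 0) (k : ℤ) :
    qPoch q (q * r) k / qPoch q r k = (1 - r * q ^ k) / (1 - r) := by
  have h0 : 1 - r ≠ 0 := by simpa using hr 0
  obtain ⟨n, rfl | rfl⟩ := k.eq_nat_or_neg
  · simpa using qPoch_mul_q_ratio_natCast hr n
  · have e (k : ℕ) : q * r / q ^ (k + 1) = r / q ^ k := by rw [pow_succ]; field_simp
    simp only [e] at hr'
    have h : ∏ k ∈ Finset.range n, (1 - r / q ^ k) ≠ 0 := Finset.prod_ne_zero_iff.2 fun k _ => hr' k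
    rw [qPoch_neg_natCast, qPoch_neg_natCast, div_inv_eq_mul, inv_mul_eq_div]
    simp only [e]
    rw [div_eq_div_iff h h0, zpow_neg, zpow_natCast, ← div_eq_mul_inv, mul_comm (1 - r / q ^ n),
      ← Finset.prod_range_succ, Finset.prod_range_succ']
    simp

lemma sqrt_mul_self (A : ℂ) : A ^ (1 / 2 : ℂ) * A ^ (1 / 2 : ℂ) = A := by
  rw [← sq]
  simp

lemma vwp_lower (hq0 : q ≠ 0) {A r : ℂ} (hA : A ≠ 0) (h : r * r = A) :
    A * q / (q * r) = r ∧ A * q / (-(q * r)) = -r := by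
  have hr : r ≠ 0 := by rintro rfl; exact hA (by rw [← h]; ring)
  constructor
  · rw [← h]; field_simp
  · rw [← h]; field_simp

/-- Only r² = A is used of the square root, so its branch is irrelevant. The condition 1 - A ≠ 0 is
the first nonvanishing condition for the lower parameters ±r. -/
lemma vwpPsiTerm_eq {m : ℕ} (hq0 : q ≠ 0) {A : ℂ} (hA : A ≠ 0) {ps : Fin m → ℂ}
    (hwd : VwpPsiWellDefined q A ps) (w : ℂ) (k : ℤ) :
    1 - A ≠ 0 ∧ vwpPsiTerm q A ps w k = (1 - A * q ^ (2 * k)) / (1 - A) *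
      (∏ i, qPoch q (ps i) k / qPoch q (A * q / ps i) k) * w ^ k := by
  have hr := sqrt_mul_self A
  generalize hrdef : A ^ (1 / 2 : ℂ) = r at hr
  obtain ⟨l₁, l₂⟩ := vwp_lower hq0 hA hr
  obtain ⟨hl, hu⟩ := hwd
  have hl₁ := hl 0
  have hl₂ := hl 1
  have hu₁ := hu 0
  have hu₂ := hu 1
  simp only [vwpPsiLower, vwpPsiUpper, Matrix.cons_val_zero, Matrix.cons_val_one, hrdef, l₁, l₂]
    at hl₁ hl₂ hu₁ hu₂
  rw [← mul_neg] at hu₂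
  have h₁ := qPoch_mul_q_ratio hq0 hl₁ hu₁ k
  have h₂ := qPoch_mul_q_ratio hq0 hl₂ hu₂ k
  have n₁ : 1 - r ≠ 0 := by simpa using hl₁ 0
  have n₂ : 1 - -r ≠ 0 := by simpa using hl₂ 0
  have hA' : 1 - A = (1 - r) * (1 - -r) := by rw [← hr]; ring
  refine ⟨hA' ▸ mul_ne_zero n₁ n₂, ?_⟩
  rw [vwpPsiTerm, psiTerm, ← Finset.prod_div_distrib, Fin.prod_univ_succ, Fin.prod_univ_succ]
  simp only [vwpPsiLower, vwpPsiUpper, Matrix.cons_val_zero, Matrix.cons_val_succ, hrdef, l₁, l₂]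
  rw [← mul_neg, h₁, h₂, ← mul_assoc, hA', div_mul_div_comm]
  congr 4
  rw [two_mul, zpow_add₀ hq0, ← hr]
  ring

lemma WTerm_eq {m : ℕ} (hq0 : q ≠ 0) {A : ℂ} (hA : A ≠ 0) {ps : Fin m → ℂ}
    (hwd : WWellDefined q A ps) (w : ℂ) (n : ℕ) :
    1 - A ≠ 0 ∧ WTerm q A ps w n = (1 - A * q ^ (2 * n)) / (1 - A) *
      (qPoch q A n / qPoch q q n * ∏ i, qPoch q (ps i) n / qPoch q (A * q / ps i) n) * w ^ n := by
  have hr := sqrt_mul_self A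
  generalize hrdef : A ^ (1 / 2 : ℂ) = r at hr
  obtain ⟨l₁, l₂⟩ := vwp_lower hq0 hA hr
  have hl₁ := hwd 0
  have hl₂ := hwd 1
  simp only [vwpPhiLower, vwpPhiUpper, Fin.succ_zero_eq_one,
    Matrix.cons_val_zero, Matrix.cons_val_one, Fin.succ_one_eq_two, Matrix.cons_val, hrdef, l₁, l₂]
    at hl₁ hl₂
  have h₁ := qPoch_mul_q_ratio_natCast hl₁ n
  have h₂ := qPoch_mul_q_ratio_natCast hl₂ n
  have n₁ : 1 - r ≠ 0 := by simpa using hl₁ 0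
  have n₂ : 1 - -r ≠ 0 := by simpa using hl₂ 0
  have hA' : 1 - A = (1 - r) * (1 - -r) := by rw [← hr]; ring
  refine ⟨hA' ▸ mul_ne_zero n₁ n₂, ?_⟩
  rw [WTerm, phiTerm, Fin.prod_univ_succ, mul_div_assoc, ← Finset.prod_div_distrib,
    Fin.prod_univ_succ, Fin.prod_univ_succ]
  simp only [vwpPhiLower, vwpPhiUpper, Matrix.cons_val_zero, Matrix.cons_val_succ, hrdef, l₁, l₂]
  rw [← mul_neg, h₁, h₂, hA']
  have e : 1 - A * q ^ (2 * n) = (1 - r * q ^ n) * (1 - -r * q ^ n) := by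
    rw [two_mul, pow_add, ← hr]; ring
  rw [e, ← div_mul_div_comm]
  ring

/-- The bilateral very-well-poised term with six parameters, cleared of denominators. -/
lemma vwpPsiTerm_mul (hq0 : q ≠ 0) (hq : ‖q‖ < 1) {s A p₁ p₂ p₃ p₄ p₅ p₆ : ℂ} (hs : s ≠ 0)
    (hA : A ≠ 0) (h₁ : p₁ ≠ 0) (h₂ : p₂ ≠ 0) (h₃ : p₃ ≠ 0) (h₄ : p₄ ≠ 0) (h₅ : p₅ ≠ 0)
    (h₆ : p₆ ≠ 0) {ps : Fin 6 → ℂ} {A' w : ℂ} (hA' : A' = s ^ 2 / A)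
    (hps : ps = ![s * p₁ / A, s * p₂ / A, s * p₃ / A, s * p₄ / A, s * p₅ / A, s * p₆ / A])
    (hw : w = A ^ 3 * q ^ 2 / (p₁ * p₂ * p₃ * p₄ * p₅ * p₆))
    (hwd : VwpPsiWellDefined q A' ps) (k : ℤ) :
    vwpPsiTerm q A' ps w k * ((1 - A') *
      (qPochInf q (s * q / p₁) * qPochInf q (s * q / p₂) * qPochInf q (s * q / p₃) *
       qPochInf q (s * q / p₄) * qPochInf q (s * q / p₅) * qPochInf q (s * q / p₆)) *
      (qPochInf q (A * q / (s * p₁)) * qPochInf q (A * q / (s * p₂)) *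
       qPochInf q (A * q / (s * p₃)) * qPochInf q (A * q / (s * p₄)) *
       qPochInf q (A * q / (s * p₅)) * qPochInf q (A * q / (s * p₆)))) =
      sixTerm q s A p₁ p₂ p₃ p₄ p₅ p₆ k := by
  subst hA'
  obtain ⟨n, e⟩ := vwpPsiTerm_eq hq0 (by simp [*]) hwd w k
  obtain ⟨hl, hu⟩ := hwd
  have R {p : ℂ} (hp : p ≠ 0) (i : Fin 6) (hi : ps i = s * p / A) :
      qPoch q (s * p / A) k / qPoch q (s ^ 2 / A * q / (s * p / A)) k *
        (qPochInf q (s * q / p) * qPochInf q (A * q / (s * p))) =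
      pairTerm q (s * q / p) (A / (s * p)) k * (s * p / A) ^ k := by
    have e₁ : s ^ 2 / A * q / (s * p / A) = s * q / p := by field_simp
    have hl' := hl i.succ.succ
    have hu' := hu i.succ.succ
    simp only [vwpPsiLower, vwpPsiUpper, Matrix.cons_val_succ, hi, e₁] at hl' hu'
    have := qPoch_ratio hq0 hq (x := s * p / A) (by simp [*]) hl' hu' k
    rw [show q / (s * p / A) = A * q / (s * p) by field_simp, one_div_div] at this
    rwa [e₁]
  have r₁ := R h₁ 0 (by rw [hps]; rfl)
  have r₂ := R h₂ 1 (by rw [hps]; rfl)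
  have r₃ := R h₃ 2 (by rw [hps]; rfl)
  have r₄ := R h₄ 3 (by rw [hps]; rfl)
  have r₅ := R h₅ 4 (by rw [hps]; rfl)
  have r₆ := R h₆ 5 (by rw [hps]; rfl)
  have hw' : (s ^ 6 * q ^ 2 / A ^ 3) ^ k = (s * p₁ / A) ^ k * (s * p₂ / A) ^ k * (s * p₃ / A) ^ k *
      (s * p₄ / A) ^ k * (s * p₅ / A) ^ k * (s * p₆ / A) ^ k * w ^ k := by
    simp only [← mul_zpow]
    congr 1
    rw [hw]
    field_simp
  rw [e, sixTerm_eq, hw', Fin.prod_univ_six, hps]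
  simp only [Matrix.cons_val]
  clear hw' e R hl hu hps hw
  generalize (s * p₁ / A) ^ k = u₁ at *
  generalize (s * p₂ / A) ^ k = u₂ at *
  generalize (s * p₃ / A) ^ k = u₃ at *
  generalize (s * p₄ / A) ^ k = u₄ at *
  generalize (s * p₅ / A) ^ k = u₅ at *
  generalize (s * p₆ / A) ^ k = u₆ at *
  have E : ∀ {v w a₁ a₂ a₃ a₄ a₅ a₆ b₁ b₂ b₃ b₄ b₅ b₆ c₁ c₂ c₃ c₄ c₅ c₆ d₁ d₂ d₃ d₄ d₅ d₆ y : ℂ},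
      y ≠ 0 → a₁ * (b₁ * c₁) = d₁ * u₁ → a₂ * (b₂ * c₂) = d₂ * u₂ → a₃ * (b₃ * c₃) = d₃ * u₃ →
      a₄ * (b₄ * c₄) = d₄ * u₄ → a₅ * (b₅ * c₅) = d₅ * u₅ → a₆ * (b₆ * c₆) = d₆ * u₆ →
      v / y * (a₁ * a₂ * a₃ * a₄ * a₅ * a₆) * w * (y * (b₁ * b₂ * b₃ * b₄ * b₅ * b₆) *
        (c₁ * c₂ * c₃ * c₄ * c₅ * c₆)) =
      v * (d₁ * d₂ * d₃ * d₄ * d₅ * d₆) * (u₁ * u₂ * u₃ * u₄ * u₅ * u₆ * w) := by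
    intro v w a₁ a₂ a₃ a₄ a₅ a₆ b₁ b₂ b₃ b₄ b₅ b₆ c₁ c₂ c₃ c₄ c₅ c₆ d₁ d₂ d₃ d₄ d₅ d₆ y hy
      e₁ e₂ e₃ e₄ e₅ e₆
    calc _ = v * w * ((a₁ * (b₁ * c₁)) * (a₂ * (b₂ * c₂)) * (a₃ * (b₃ * c₃)) * (a₄ * (b₄ * c₄)) *
          (a₅ * (b₅ * c₅)) * (a₆ * (b₆ * c₆))) * (y / y) := by ring
      _ = _ := by rw [e₁, e₂, e₃, e₄, e₅, e₆, div_self hy]; ring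
  exact E n r₁ r₂ r₃ r₄ r₅ r₆

/-- The one-sided very-well-poised term, cleared of denominators. -/
lemma WTerm_mul (hq0 : q ≠ 0) (hq : ‖q‖ < 1) {a b c d e f g : ℂ} (ha : a ≠ 0)
    (hb : b ≠ 0) (hc : c ≠ 0) (hd : d ≠ 0) (he : e ≠ 0) (hf : f ≠ 0) (hg : g ≠ 0)
    (hwd : WWellDefined q (b ^ 2 / a) ![b * c / a, b * d / a, b * e / a, b * f / a, b * g / a])
    (w : ℂ) (n : ℕ) :
    WTerm q (b ^ 2 / a) ![b * c / a, b * d / a, b * e / a, b * f / a, b * g / a] w n *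
      ((1 - b ^ 2 / a) * (qPochInf q q * qPochInf q (b * q / c) * qPochInf q (b * q / d) *
        qPochInf q (b * q / e) * qPochInf q (b * q / f) * qPochInf q (b * q / g))) =
      oneSidedTerm q a b c d e f g w n := by
  obtain ⟨n0, h⟩ := WTerm_eq hq0 (by simp [*]) hwd w n
  have R {p : ℂ} (hp : p ≠ 0) (i : Fin 5)
      (hi : ![b * c / a, b * d / a, b * e / a, b * f / a, b * g / a] i = b * p / a) :
      qPoch q (b * p / a) n / qPoch q (b ^ 2 / a * q / (b * p / a)) n * qPochInf q (b * q / p) =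
      (∏ k ∈ Finset.range n, (1 - b * p / a * q ^ k)) * qPochInf q (b * q / p * q ^ n) := by
    have e₁ : b ^ 2 / a * q / (b * p / a) = b * q / p := by field_simp
    have hl := hwd i.succ.succ
    simp only [vwpPhiLower, vwpPhiUpper, Matrix.cons_val_succ, hi, e₁] at hl
    rw [e₁]
    exact qPoch_ratio_natCast hq hl n
  have r₁ := qPoch_ratio_natCast hq (x := b * b / a) (α := q)
    (fun k => by
      rw [← pow_succ']
      refine sub_ne_zero.2 fun h => ?_
      have := pow_lt_one₀ (norm_nonneg q) hq k.succ_ne_zero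
      rw [← norm_pow, ← h, norm_one] at this
      exact lt_irrefl _ this) n
  have r₂ := R hc 0 rfl
  have r₃ := R hd 1 rfl
  have r₄ := R he 2 rfl
  have r₅ := R hf 3 rfl
  have r₆ := R hg 4 rfl
  rw [h, oneSidedTerm, Fin.prod_univ_five, mul_div_cancel_left₀ q hb, ← r₁, ← r₂, ← r₃, ← r₄, ← r₅,
    ← r₆, ← sq b]
  simp only [Matrix.cons_val]
  have E : ∀ {v w a₁ a₂ a₃ a₄ a₅ a₆ b₁ b₂ b₃ b₄ b₅ b₆ y : ℂ}, y ≠ 0 →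
      v / y * (a₁ * (a₂ * a₃ * a₄ * a₅ * a₆)) * w * (y * (b₁ * b₂ * b₃ * b₄ * b₅ * b₆)) =
      v * (a₁ * b₁ * (a₂ * b₂) * (a₃ * b₃) * (a₄ * b₄) * (a₅ * b₅) * (a₆ * b₆)) * w := by
    intro v w a₁ a₂ a₃ a₄ a₅ a₆ b₁ b₂ b₃ b₄ b₅ b₆ y hy
    calc _ = v * (a₁ * b₁ * (a₂ * b₂) * (a₃ * b₃) * (a₄ * b₄) * (a₅ * b₅) * (a₆ * b₆)) * w *
          (y / y) := by ring
      _ = _ := by rw [div_self hy, mul_one]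
  exact E n0

lemma VwpPsiWellDefined.qPochInf_ne_zero {m : ℕ} (hq0 : q ≠ 0) (hq : ‖q‖ < 1) {A : ℂ}
    {ps : Fin m → ℂ} (hwd : VwpPsiWellDefined q A ps) (i : Fin m) (hi : ps i ≠ 0) :
    qPochInf q (A * q / ps i) ≠ 0 ∧ qPochInf q (q / ps i) ≠ 0 := by
  have hl := hwd.1 i.succ.succ
  have hu := hwd.2 i.succ.succ
  simp only [vwpPsiLower, vwpPsiUpper, Matrix.cons_val_succ] at hl hu
  refine ⟨QSeries.qPochInf_ne_zero hq hl, QSeries.qPochInf_ne_zero hq fun k hk => hu k ?_⟩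
  rw [pow_succ]
  rw [sub_eq_zero] at hk ⊢
  field_simp at hk ⊢
  linear_combination -hk

lemma WWellDefined.qPochInf_ne_zero {m : ℕ} (hq : ‖q‖ < 1) {A : ℂ} {ps : Fin m → ℂ}
    (hwd : WWellDefined q A ps) (i : Fin m) : qPochInf q (A * q / ps i) ≠ 0 := by
  have hl := hwd i.succ.succ
  simp only [vwpPhiLower, vwpPhiUpper, Matrix.cons_val_succ] at hl
  exact QSeries.qPochInf_ne_zero hq hl

/-- The bilateral very-well-poised series with six parameters converges, and clearing denominators
gives `sixSum`. -/
lemma vwpPsi_mul (hq0 : q ≠ 0) (hq : ‖q‖ < 1) {s A p₁ p₂ p₃ p₄ p₅ p₆ : ℂ} (hs : s ≠ 0)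
    (hA : A ≠ 0) (h₁ : p₁ ≠ 0) (h₂ : p₂ ≠ 0) (h₃ : p₃ ≠ 0) (h₄ : p₄ ≠ 0) (h₅ : p₅ ≠ 0)
    (h₆ : p₆ ≠ 0) {ps : Fin 6 → ℂ} {A' w : ℂ} (hA' : A' = s ^ 2 / A)
    (hps : ps = ![s * p₁ / A, s * p₂ / A, s * p₃ / A, s * p₄ / A, s * p₅ / A, s * p₆ / A])
    (hw : w = A ^ 3 * q ^ 2 / (p₁ * p₂ * p₃ * p₄ * p₅ * p₆)) (hw1 : ‖w‖ < 1)
    (hwd : VwpPsiWellDefined q A' ps) :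
    Summable (vwpPsiTerm q A' ps w) ∧ vwpPsi q A' ps w * ((1 - A') *
      (qPochInf q (s * q / p₁) * qPochInf q (s * q / p₂) * qPochInf q (s * q / p₃) *
       qPochInf q (s * q / p₄) * qPochInf q (s * q / p₅) * qPochInf q (s * q / p₆)) *
      (qPochInf q (A * q / (s * p₁)) * qPochInf q (A * q / (s * p₂)) *
       qPochInf q (A * q / (s * p₃)) * qPochInf q (A * q / (s * p₄)) *
       qPochInf q (A * q / (s * p₅)) * qPochInf q (A * q / (s * p₆)))) =
      sixSum q s A p₁ p₂ p₃ p₄ p₅ p₆ := by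
  have key := vwpPsiTerm_mul hq0 hq hs hA h₁ h₂ h₃ h₄ h₅ h₆ hA' hps hw hwd
  have S := summable_sixTerm hq0 hq hs hA h₁ h₂ h₃ h₄ h₅ h₆ (hw ▸ hw1)
  have n0 : 1 - A' ≠ 0 := (vwpPsiTerm_eq hq0 (by simp [*]) hwd w 0).1
  have N {p : ℂ} (hp : p ≠ 0) (i : Fin 6) (hi : ps i = s * p / A) :
      qPochInf q (s * q / p) ≠ 0 ∧ qPochInf q (A * q / (s * p)) ≠ 0 := by
    have := hwd.qPochInf_ne_zero hq0 hq i (by rw [hi]; simp [*])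
    rw [hi, hA'] at this
    rwa [show s ^ 2 / A * q / (s * p / A) = s * q / p by field_simp,
      show q / (s * p / A) = A * q / (s * p) by field_simp] at this
  have r₁ := N h₁ 0 (by rw [hps]; rfl)
  have r₂ := N h₂ 1 (by rw [hps]; rfl)
  have r₃ := N h₃ 2 (by rw [hps]; rfl)
  have r₄ := N h₄ 3 (by rw [hps]; rfl)
  have r₅ := N h₅ 4 (by rw [hps]; rfl)
  have r₆ := N h₆ 5 (by rw [hps]; rfl)
  rw [← funext key] at S
  refine ⟨(summable_mul_right_iff ?_).1 S, ?_⟩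
  · simp only [mul_ne_zero_iff]
    exact ⟨⟨n0, ⟨⟨⟨⟨r₁.1, r₂.1⟩, r₃.1⟩, r₄.1⟩, r₅.1⟩, r₆.1⟩, ⟨⟨⟨⟨r₁.2, r₂.2⟩, r₃.2⟩, r₄.2⟩, r₅.2⟩, r₆.2⟩
  · rw [vwpPsi, ← tsum_mul_right, sixSum]
    exact tsum_congr key

/-- The one-sided very-well-poised series converges, and clearing denominators gives
`oneSidedSum`. -/
lemma W_mul (hq0 : q ≠ 0) (hq : ‖q‖ < 1) {a b c d e f g : ℂ} (ha : a ≠ 0)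
    (hb : b ≠ 0) (hc : c ≠ 0) (hd : d ≠ 0) (he : e ≠ 0) (hf : f ≠ 0) (hg : g ≠ 0)
    (hwd : WWellDefined q (b ^ 2 / a) ![b * c / a, b * d / a, b * e / a, b * f / a, b * g / a])
    {w : ℂ} (hw : ‖w‖ < 1) :
    1 - b ^ 2 / a ≠ 0 ∧
    Summable (WTerm q (b ^ 2 / a) ![b * c / a, b * d / a, b * e / a, b * f / a, b * g / a] w) ∧
    W q (b ^ 2 / a) ![b * c / a, b * d / a, b * e / a, b * f / a, b * g / a] w *
      ((1 - b ^ 2 / a) * (qPochInf q q * qPochInf q (b * q / c) * qPochInf q (b * q / d) *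
        qPochInf q (b * q / e) * qPochInf q (b * q / f) * qPochInf q (b * q / g))) =
      oneSidedSum q a b c d e f g w := by
  have key := WTerm_mul hq0 hq ha hb hc hd he hf hg hwd w
  have S := summable_oneSidedTerm hq a b c d e f g hw
  have n0 : 1 - b ^ 2 / a ≠ 0 := (WTerm_eq hq0 (by simp [*]) hwd w 0).1
  have N {p : ℂ} (hp : p ≠ 0) (i : Fin 5)
      (hi : ![b * c / a, b * d / a, b * e / a, b * f / a, b * g / a] i = b * p / a) :
      qPochInf q (b * q / p) ≠ 0 := by
    have := hwd.qPochInf_ne_zero hq i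
    rw [hi] at this
    rwa [show b ^ 2 / a * q / (b * p / a) = b * q / p by field_simp] at this
  rw [← funext key] at S
  refine ⟨n0, (summable_mul_right_iff ?_).1 S, ?_⟩
  · simp only [mul_ne_zero_iff]
    exact ⟨n0, ⟨⟨⟨⟨qPochInf_q_ne_zero hq0 hq, N hc 0 rfl⟩, N hd 1 rfl⟩, N he 2 rfl⟩, N hf 3 rfl⟩,
      N hg 4 rfl⟩
  · rw [W, ← tsum_mul_right, oneSidedSum]
    exact tsum_congr key

/-- Removes the factors that come only from clearing denominators: 1 - b²/a, 1 - z²/a and the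
products Z shared by the theta functions and the first ₈ψ₈. -/
lemma reduced_algebra {b z v y Tz Ta Tbz Tb C D E Z P R F Pb Q Pfg Pp Pbp Zb A Zfg M W ψ₁ ψ₂ : ℂ}
    (h : b * (-(Tz / z) * (C * D * E * Z) * Ta) * (y * P) * R * F * (W * (v * Q)) +
      1 / z * Pp * Tbz * Pfg * (y * P) * (v * Pb) * (ψ₁ * ((1 - z) * (Zb * Z) * A)) =
      -(R * Tb * -(Tz / z) * Pbp * (v * Pb) * (ψ₂ * (y * (Zb * Z * Zfg) * M))))
    (hz : z ≠ 0) (hv : v ≠ 0) (hy : y ≠ 0) (hZ : Z ≠ 0) :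
    b * Tz * (C * D * E) * Ta * P * R * F * Q * W =
      Pp * Tbz * Pfg * P * Pb * (1 - z) * Zb * A * ψ₁ - R * Tb * Tz * Pbp * Pb * (Zb * Zfg * M) * ψ₂ := by
  have h' : z⁻¹ * (v * y * Z) * (b * Tz * (C * D * E) * Ta * P * R * F * Q * W -
      (Pp * Tbz * Pfg * P * Pb * (1 - z) * Zb * A * ψ₁ -
        R * Tb * Tz * Pbp * Pb * (Zb * Zfg * M) * ψ₂)) = 0 := by
    rw [div_eq_mul_inv, div_eq_mul_inv] at h
    generalize 1 - z = u at *
    linear_combination -h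
  have hne : z⁻¹ * (v * y * Z) ≠ 0 := by simp [*]
  exact sub_eq_zero.1 ((mul_eq_zero_iff_left hne).1 h')

/-- Division by the coefficient of W; the hypotheses are the factors of the denominators in the
theorem, together with b and z. -/
lemma solve_algebra {b z Tz Ta Tbz Tb Bz C Pz Pw R F Pb Qb Q Qf Pfg Pp Pbp Zb K A Zfg M W ψ₁ ψ₂ : ℂ}
    (h : b * Tz * C * Ta * (Pz * Pw) * R * F * (Qb * Q * Qf) * W =
      Pp * Tbz * Pfg * (Pz * Pw) * Pb * (1 - z) * Zb * (K * A) * ψ₁ -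
        R * Tb * Tz * Pbp * Pb * (Zb * Zfg * M) * ψ₂)
    (hb : b ≠ 0) (hz : z ≠ 0) (hTz : Tz ≠ 0) (hTa : Ta ≠ 0) (hBz : Bz ≠ 0) (hC : C ≠ 0) (hPz : Pz ≠ 0)
    (hPw : Pw ≠ 0) (hR : R ≠ 0) (hF : F ≠ 0) (hQb : Qb ≠ 0) (hQ : Q ≠ 0) (hQf : Qf ≠ 0) :
    W = (1 - 1 / z) * (Tbz * -(z / b * (Bz * Zb)) / (Ta * Tz)) * (Pb / (F * Qf)) *
        (K * (A * Pp * Pfg) / (Qb * Q * (Bz * C * R))) * ψ₁ +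
      Zb / Pz * (-(Tb / b) / Ta) * (Pb * Pbp * Zfg / (Pw * C * F)) * (M / (Qb * Q * Qf)) * ψ₂ := by
  have e : 1 - 1 / z = -(1 - z) / z := by field_simp; ring
  rw [e]
  generalize 1 - z = u at *
  apply mul_left_cancel₀ (a := b * Tz * C * Ta * (Pz * Pw) * R * F * (Qb * Q * Qf)) (by simp [*])
  rw [h, mul_add, sub_eq_add_neg]
  congr 1
  · field_simp
  · field_simp

end QSeries

end

/-! ### The three-term transformation in the original normalisation -/

theorem mainTheorem2 (q a b c d e f g z : ℂ)
    (hq0 : q ≠ 0) (hq1 : ‖q‖ < 1)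
    (ha : a ≠ 0) (hb : b ≠ 0) (hc : c ≠ 0) (hd : d ≠ 0) (he : e ≠ 0) (hf : f ≠ 0) (hg : g ≠ 0)
    (hz : z = b * c * d * e / (a * q))
    (hconv₁ : ‖a ^ 2 * q / (f * g * z)‖ < 1) (hconv₂ : ‖a * q / (f * g)‖ < 1)
    -- the terms of the three series are meaningful
    (hW : QSeries.WWellDefined q (b ^ 2 / a) ![b * c / a, b * d / a, b * e / a, b * f / a, b * g / a])
    (hψ₁ : QSeries.VwpPsiWellDefined q z ![b, c, d, e, f * z / a, g * z / a])
    (hψ₂ : QSeries.VwpPsiWellDefined q (z ^ 2 / a)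
      ![b * z / a, c * z / a, d * z / a, e * z / a, f * z / a, g * z / a])
    -- the denominators of the two coefficients do not vanish
    (hθ₁ : QSeries.theta q (z / a) ≠ 0) (hθ₂ : QSeries.theta q z ≠ 0)
    (hΩ₁ : QSeries.Omega q [a * q / b, b * q] [f, g] ≠ 0)
    (hΩ₂ : QSeries.Omega q [b * q] [b, c, d, e] ≠ 0)
    (hΩ₃ : QSeries.Omega q [1 / z] [1 / b, 1 / c, 1 / d, 1 / e, f * g / (a ^ 2 * q)] ≠ 0)
    (hΩ₄ : QSeries.Omega q [1 / z] [z / (a * q), 1 / c, 1 / d, 1 / e] ≠ 0)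
    (hP : QSeries.qPochInf q (z ^ 2 * q / a) ≠ 0) :
    Summable (QSeries.WTerm q (b ^ 2 / a)
      ![b * c / a, b * d / a, b * e / a, b * f / a, b * g / a] (a ^ 2 * q / (f * g * z))) ∧
    Summable (QSeries.vwpPsiTerm q z ![b, c, d, e, f * z / a, g * z / a] (a * q / (f * g))) ∧
    Summable (QSeries.vwpPsiTerm q (z ^ 2 / a)
      ![b * z / a, c * z / a, d * z / a, e * z / a, f * z / a, g * z / a]
      (a ^ 2 * q / (f * g * z))) ∧
    QSeries.W q (b ^ 2 / a)
        ![b * c / a, b * d / a, b * e / a, b * f / a, b * g / a] (a ^ 2 * q / (f * g * z)) =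
      (1 - 1 / z) *
        ((QSeries.theta q (b * z / a) * QSeries.theta q (z / b)) /
          (QSeries.theta q (z / a) * QSeries.theta q z)) *
        (QSeries.qPochInf q (b ^ 2 * q / a) / QSeries.Omega q [a * q / b, b * q] [f, g]) *
        ((QSeries.Omega q [q] [b, c, d, e] *
            QSeries.Omega q [a * q] [f, g, c * d, c * e, d * e, f * g, f * z, g * z]) /
          (QSeries.Omega q [b * q] [b, c, d, e] *
            QSeries.Omega q [1 / z] [1 / b, 1 / c, 1 / d, 1 / e, f * g / (a ^ 2 * q)])) *
        QSeries.vwpPsi q z ![b, c, d, e, f * z / a, g * z / a] (a * q / (f * g)) +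
      (QSeries.qPochInf q (z * q / b) / QSeries.qPochInf q (z ^ 2 * q / a)) *
        (QSeries.theta q (1 / b) / QSeries.theta q (z / a)) *
        ((QSeries.Omega q [b / a] [1 / (b * q), 1 / c, 1 / d, 1 / e] *
            QSeries.Omega q [z * q] [f, g]) /
          (QSeries.Omega q [1 / z] [z / (a * q), 1 / c, 1 / d, 1 / e] *
            QSeries.Omega q [a * q / b] [f, g])) *
        (QSeries.Omega q [a * q / z] [b, c, d, e, f, g] /
          QSeries.Omega q [b * q] [b, c, d, e, f, g]) *
        QSeries.vwpPsi q (z ^ 2 / a)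
          ![b * z / a, c * z / a, d * z / a, e * z / a, f * z / a, g * z / a]
          (a ^ 2 * q / (f * g * z)) := by
  have hz0 : z ≠ 0 := by rw [hz]; simp [*]
  have h : b * c * d * e = a * q * z := by rw [hz]; field_simp
  clear hz
  obtain ⟨nA, SW, hWs⟩ := QSeries.W_mul hq0 hq1 ha hb hc hd he hf hg hW hconv₁
  -- Both bilateral series have base point z; they differ in the modulus, z for the first and a for
  -- the second, giving leading parameters z and z²/a.
  obtain ⟨S₁, h₁⟩ := QSeries.vwpPsi_mul hq0 hq1 (s := z) (A := z) (p₁ := b) (p₂ := c) (p₃ := d)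
    (p₄ := e) (p₅ := f * z / a) (p₆ := g * z / a) (w := a * q / (f * g)) hz0 hz0 hb hc hd he
    (by simp [*]) (by simp [*]) (by field_simp)
    (by simp only [mul_div_cancel_left₀ _ hz0]) (by field_simp; linear_combination h) hconv₂ hψ₁
  obtain ⟨S₂, h₂⟩ := QSeries.vwpPsi_mul hq0 hq1 (s := z) (A := a) (p₁ := b) (p₂ := c) (p₃ := d)
    (p₄ := e) (p₅ := f) (p₆ := g) (w := a ^ 2 * q / (f * g * z)) hz0 ha hb hc hd he hf hg rfl
    (by simp only [mul_comm z]) (by field_simp; linear_combination h) hconv₁ hψ₂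
  refine ⟨SW, S₁, S₂, ?_⟩
  have key := QSeries.three_term hq0 hq1 ha hz0 hb hc hd he hf hg h hconv₁ hconv₂
  rw [← hWs, ← h₁, ← h₂] at key
  clear SW S₁ S₂ hWs h₁ h₂
  -- The argument 0 and the index 0 are placeholders; only the first component is used.
  have nB : 1 - z ^ 2 / a ≠ 0 := (QSeries.vwpPsiTerm_eq hq0 (by simp [*]) hψ₂ 0 0).1
  -- The products (zq/c;q)_∞, (zq/d;q)_∞ and (zq/e;q)_∞ occur in theta functions and in the clearing
  -- factor of the first ₈ψ₈. They are absent from the final coefficients, so their nonvanishing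
  -- comes from the lower parameters of that series.
  have nc := (hψ₁.qPochInf_ne_zero hq0 hq1 1 hc).1
  have nd := (hψ₁.qPochInf_ne_zero hq0 hq1 2 hd).1
  have ne := (hψ₁.qPochInf_ne_zero hq0 hq1 3 he).1
  simp only [Matrix.cons_val] at nc nd ne
  -- the theta functions
  rw [QSeries.theta_eq_thetaProd hq0 hq1 (by simp [*])] at hθ₁ hθ₂
  have θ₀ : QSeries.thetaProd q (z / b) =
      -(z / b * (QSeries.qPochInf q (b / z) * QSeries.qPochInf q (z * q / b))) := by
    rw [← one_div_div b z, QSeries.thetaProd_inv hq0 hq1 (div_ne_zero hb hz0), QSeries.thetaProd,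
      show q / (b / z) = z * q / b by field_simp]
    field_simp
  have θ₁ (p : ℂ) (hp : p ≠ 0) : QSeries.thetaProd q (p / z) =
      QSeries.qPochInf q (p / z) * QSeries.qPochInf q (z * q / p) := by
    rw [QSeries.thetaProd, show q / (p / z) = z * q / p by field_simp]
  have θ₂ : QSeries.thetaProd q (z ^ 2 / a) = (1 - z ^ 2 / a) *
      (QSeries.qPochInf q (z ^ 2 * q / a) * QSeries.qPochInf q (a * q / z ^ 2)) := by
    rw [QSeries.thetaProd, QSeries.qPochInf_eq_mul hq1,
      show q / (z ^ 2 / a) = a * q / z ^ 2 by field_simp,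
      show z ^ 2 / a * q = z ^ 2 * q / a by field_simp, mul_assoc]
  have θ₃ : QSeries.qPochInf q (b ^ 2 / a) =
      (1 - b ^ 2 / a) * QSeries.qPochInf q (b ^ 2 * q / a) := by
    rw [QSeries.qPochInf_eq_mul hq1, show b ^ 2 / a * q = b ^ 2 * q / a by field_simp]
  -- the products of infinite factorials
  have o₁ : QSeries.Omega q [a * q / b, b * q] [f, g] =
      QSeries.qPochInf q (a * q / (b * f)) * QSeries.qPochInf q (a * q / (b * g)) *
      (QSeries.qPochInf q (b * q / f) * QSeries.qPochInf q (b * q / g)) := by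
    simp [QSeries.Omega, div_div]
  have o₂ : QSeries.Omega q [b * q] [b, c, d, e] = QSeries.qPochInf q q *
      (QSeries.qPochInf q (b * q / c) * QSeries.qPochInf q (b * q / d) *
        QSeries.qPochInf q (b * q / e)) := by
    simp [QSeries.Omega, mul_div_cancel_left₀ _ hb, mul_assoc]
  have o₃ : QSeries.Omega q [1 / z] [1 / b, 1 / c, 1 / d, 1 / e, f * g / (a ^ 2 * q)] =
      QSeries.qPochInf q (b / z) * (QSeries.qPochInf q (c / z) * QSeries.qPochInf q (d / z) *
        QSeries.qPochInf q (e / z)) * QSeries.qPochInf q (a ^ 2 * q / (f * g * z)) := by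
    simp only [QSeries.Omega, List.map_cons, List.map_nil, List.prod_cons, List.prod_nil, mul_one,
      div_div_div_eq, one_mul, mul_one, mul_assoc, mul_comm z]
  have o₄ : QSeries.Omega q [1 / z] [z / (a * q), 1 / c, 1 / d, 1 / e] =
      QSeries.qPochInf q (a * q / z ^ 2) * (QSeries.qPochInf q (c / z) *
        QSeries.qPochInf q (d / z) * QSeries.qPochInf q (e / z)) := by
    simp only [QSeries.Omega, List.map_cons, List.map_nil, List.prod_cons, List.prod_nil, mul_one,
      div_div_div_eq, one_mul, mul_one, mul_assoc, sq]
  have o₅ : QSeries.Omega q [q] [b, c, d, e] = QSeries.qPochInf q (q / b) *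
      QSeries.qPochInf q (q / c) * QSeries.qPochInf q (q / d) * QSeries.qPochInf q (q / e) := by
    simp [QSeries.Omega, mul_assoc]
  have o₆ : QSeries.Omega q [a * q] [f, g, c * d, c * e, d * e, f * g, f * z, g * z] =
      QSeries.qPochInf q (a * q / f) * QSeries.qPochInf q (a * q / g) *
      QSeries.qPochInf q (a * q / (f * z)) * QSeries.qPochInf q (a * q / (g * z)) *
      (QSeries.qPochInf q (a * q / (d * e)) * QSeries.qPochInf q (a * q / (c * e)) *
        QSeries.qPochInf q (a * q / (c * d))) * QSeries.qPochInf q (a * q / (f * g)) := by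
    simp only [QSeries.Omega, List.map_cons, List.map_nil, List.prod_cons, List.prod_nil, mul_one]
    ring
  have o₇ : QSeries.Omega q [b / a] [1 / (b * q), 1 / c, 1 / d, 1 / e] =
      QSeries.qPochInf q (b ^ 2 * q / a) * (QSeries.qPochInf q (b * e / a) *
        QSeries.qPochInf q (b * d / a) * QSeries.qPochInf q (b * c / a)) := by
    have x₁ (p : ℂ) : b / a / (1 / p) = b * p / a := by rw [div_div_eq_mul_div, div_one]; ring
    simp only [QSeries.Omega, List.map_cons, List.map_nil, List.prod_cons, List.prod_nil, mul_one,
      x₁, sq, mul_assoc]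
    ring
  have o₈ : QSeries.Omega q [z * q] [f, g] =
      QSeries.qPochInf q (z * q / f) * QSeries.qPochInf q (z * q / g) := by
    simp [QSeries.Omega]
  have o₉ : QSeries.Omega q [a * q / b] [f, g] =
      QSeries.qPochInf q (a * q / (b * f)) * QSeries.qPochInf q (a * q / (b * g)) := by
    simp [QSeries.Omega, div_div]
  have o₁₀ : QSeries.Omega q [a * q / z] [b, c, d, e, f, g] =
      QSeries.qPochInf q (a * q / (z * b)) * QSeries.qPochInf q (a * q / (z * c)) *
      QSeries.qPochInf q (a * q / (z * d)) * QSeries.qPochInf q (a * q / (z * e)) *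
      QSeries.qPochInf q (a * q / (z * f)) * QSeries.qPochInf q (a * q / (z * g)) := by
    simp [QSeries.Omega, div_div, mul_assoc]
  have o₁₁ : QSeries.Omega q [b * q] [b, c, d, e, f, g] = QSeries.qPochInf q q *
      (QSeries.qPochInf q (b * q / c) * QSeries.qPochInf q (b * q / d) *
        QSeries.qPochInf q (b * q / e)) *
      (QSeries.qPochInf q (b * q / f) * QSeries.qPochInf q (b * q / g)) := by
    simp [QSeries.Omega, mul_div_cancel_left₀ _ hb, mul_assoc]
  rw [o₁] at hΩ₁
  rw [o₂] at hΩ₂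
  rw [o₃] at hΩ₃
  rw [o₄] at hΩ₄
  rw [o₁, o₂, o₃, o₄, o₅, o₆, o₇, o₈, o₉, o₁₀, o₁₁]
  iterate 5 rw [QSeries.theta_eq_thetaProd hq0 hq1 (by simp [*])]
  rw [θ₀, QSeries.thetaProd_inv hq0 hq1 hb]
  -- Every cancellation is covered by an assumed nonzero denominator, taken apart into its factors,
  -- or by the nonvanishing facts obtained from the series.
  refine QSeries.solve_algebra (QSeries.reduced_algebra (v := 1 - b ^ 2 / a) (y := 1 - z ^ 2 / a)
    (C := QSeries.qPochInf q (c / z)) (D := QSeries.qPochInf q (d / z))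
    (E := QSeries.qPochInf q (e / z)) (Z := QSeries.qPochInf q (z * q / c) *
      QSeries.qPochInf q (z * q / d) * QSeries.qPochInf q (z * q / e)) ?_
      hz0 nA nB (mul_ne_zero (mul_ne_zero nc nd) ne))
    hb hz0 hθ₂ hθ₁ (left_ne_zero_of_mul (left_ne_zero_of_mul hΩ₃)) (right_ne_zero_of_mul hΩ₄) hP
    (left_ne_zero_of_mul hΩ₄) (right_ne_zero_of_mul hΩ₃) (left_ne_zero_of_mul hΩ₁)
    (left_ne_zero_of_mul hΩ₂) (right_ne_zero_of_mul hΩ₂) (right_ne_zero_of_mul hΩ₁)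
  rw [θ₁ c hc, θ₁ d hd, θ₁ e he, θ₂, θ₃, QSeries.thetaProd_inv hq0 hq1 hz0] at key
  have y₁ (p : ℂ) (hp : p ≠ 0) : z * q / (p * z / a) = a * q / p := by field_simp
  have y₂ (p : ℂ) (hp : p ≠ 0) : z * q / (z * p) = q / p := by field_simp
  have y₃ (p : ℂ) (hp : p ≠ 0) : z * q / (z * (p * z / a)) = a * q / (p * z) := by field_simp
  rw [y₁ f hf, y₁ g hg, y₂ b hb, y₂ c hc, y₂ d hd, y₂ e he, y₃ f hf, y₃ g hg] at key
  generalize 1 - z ^ 2 / a = y at *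
  generalize 1 - b ^ 2 / a = v at *
  generalize 1 - z = u at *
  linear_combination key
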